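/- **Setting.** Let $d\ge 1$, let $\mathcal Y\subset\mathbb R^d$ be a closed ball of radius $R>0$ with uniform distribution $U(\mathcal Y)$ (normalised Lebesgue measure), and fix a perplexity $\rho>1$. Let $f:\mathcal Y\to\mathbb R^D$ be a smooth embedding: $f$ is $C^\infty$ on a neighbourhood of $\mathcal Y$, injective on $\mathcal Y$, and its Jacobian $J=J(y)$ has full column rank at every $y\in\mathcal Y$. *$\alpha$-discrepancy at $\alpha=1$.* For a field $M$ of symmetric matrices on $\mathbb R^D$ (the metric of the observation space) let $p_{y_0}$ be the density on $\mathbb R^d$ of the Gaussian distribution with mean $y_0$ and precision matrix $J^\top M(f(y_0))J$, where $J=J(y_0)$; let $s_{y_0}(y)=e^{-\|y-y_0\|^2/2}$, and $D_1(p:q)=\int_{\mathbb R^d}\bigl[p\log\frac pq-p+q\bigr]dy$. The discrepancy of $f$ at $y_0$ is $D_1(f,M;y_0)=\inf_{\gamma>0}D_1(p_{y_0}:\gamma s_{y_0})$, and the discrepancy of $f$ is $D_1(f,M)=\mathbb E_{y_0\sim U(\mathcal Y)}\,D_1(f,M;y_0)$. *SNE cost.* Let $y_1,y_2,\dots$ be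 independent with law $U(\mathcal Y)$ and $x_i=f(y_i)$. For $n$ samples and $\lambda>0$ let $P^\lambda_{j|i}\propto e^{-\lambda\|x_i-x_j\|^2/2}$ and $Q_{j|i}\propto e^{-\|y_i-y_j\|^2/2}$, both normalised over $j\in\{1,\dots,n\}\setminus\{i\}$. Let $\lambda_i>0$ be the precision for which $P^{\lambda_i}_{\cdot|i}$ has perplexity $\exp\bigl(-\sum_j P^{\lambda_i}_{j|i}\log P^{\lambda_i}_{j|i}\bigr)=\rho$. The SNE cost is $$\mathrm{SNE}_n=\sum_{i=1}^n\sum_{j\ne i}P^{\lambda_i}_{j|i}\log\frac{P^{\lambda_i}_{j|i}}{Q_{j|i}} .$$ Let $M_n(x_0)=\lambda_n(x_0)I$, where $\lambda_n(x_0)>0$ is the precision for which the weights $e^{-\lambda\|x_0-x_j\|^2/2}$, normalised over the $j\le n$ with $x_j\neq x_0$, have perplexity $\rho$ (so $M_n(x_i)=\lambda_iI$ when the samples are distinct). A precision is set to $0$ if none with the required perplexity exists. **Theorem.** There is a constant $C=C(\mathcal Y,\rho)$, not depending on $D$ or $f$, such that for every such $f$: 1. for every matrix field $M$ and every $y_0\in\mathcal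 Y$ at which $M(f(y_0))$ is positive definite, $$D_1(f,M;y_0)=\tfrac12\log\bigl|J^\top M(f(y_0))J\bigr|+\tfrac12\operatorname{tr}\bigl((J^\top M(f(y_0))J)^{-1}\bigr)-\tfrac d2,\qquad J=J(y_0);$$ 2. up to the scaling $1/n$ and the shift $C$, the SNE cost converges to the discrepancy of $f$ with respect to the perplexity-calibrated metric: $$\frac1n\,\mathrm{SNE}_n-D_1(f,M_n)\;\longrightarrow\;C\qquad\text{in probability as }n\to\infty .$$ -/

import Mathlib

noncomputable section

namespace NeighbourEmbedding

/-- The Euclidean space `ℝᵏ`. -/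
abbrev Euc (k : ℕ) : Type := EuclideanSpace ℝ (Fin k)

/-! ### The `α`-discrepancy of a map `f : ℝᵈ → ℝᴰ` -/

/-- The `α`-divergence `D_α(p : q)` between two positive densities on `ℝᵈ`; the values at `α = 1`
and `α = 0` are the (unnormalised) KL divergence and the reverse KL divergence. -/
def alphaDiv {d : ℕ} (α : ℝ) (p q : Euc d → ℝ) : ℝ :=
  if α = 1 then ∫ y, (p y * Real.log (p y / q y) - p y + q y)
  else if α = 0 then ∫ y, (q y * Real.log (q y / p y) - q y + p y)
  else 1 / (α * (1 - α)) *
    ∫ y, (α * p y + (1 - α) * q y - p y ^ α * q y ^ (1 - α))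

/-- The density at `y` of the Gaussian distribution with mean `y₀` and precision matrix `A`. -/
def gaussianDensity {d : ℕ} (y₀ : Euc d) (A : Matrix (Fin d) (Fin d) ℝ) (y : Euc d) : ℝ :=
  Real.sqrt A.det / (2 * Real.pi) ^ ((d : ℝ) / 2) *
    Real.exp (-(1 / 2) * ((fun k => y k - y₀ k) ⬝ᵥ A.mulVec (fun k => y k - y₀ k)))

/-- The Jacobian matrix of `f` at `y₀`. -/
def jacobian {d D : ℕ} (f : Euc d → Euc D) (y₀ : Euc d) : Matrix (Fin D) (Fin d) ℝ :=
  Matrix.of fun a b => fderiv ℝ f y₀ (EuclideanSpace.single b 1) a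

/-- The pull-back `Jᵀ M(f y₀) J` of the metric `M` of the observation space. -/
def pullback {d D : ℕ} (M : Euc D → Matrix (Fin D) (Fin D) ℝ) (f : Euc d → Euc D) (y₀ : Euc d) :
    Matrix (Fin d) (Fin d) ℝ :=
  (jacobian f y₀).transpose * M (f y₀) * jacobian f y₀

/-- The latent similarity `s_{y₀}(y) = exp(-‖y - y₀‖² / 2)`. -/
def similarity {d : ℕ} (y₀ y : Euc d) : ℝ := Real.exp (-(1 / 2) * ‖y - y₀‖ ^ 2)

/-- The discrepancy `inf_{γ > 0} D_α(p_{y₀} : γ s_{y₀})` at the reference point `y₀`, where `p_{y₀}`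
is the Gaussian density whose precision is the pull-back metric at `y₀`. -/
def pointDiscrepancy {d D : ℕ} (α : ℝ) (M : Euc D → Matrix (Fin D) (Fin D) ℝ)
    (f : Euc d → Euc D) (y₀ : Euc d) : ℝ :=
  ⨅ γ : Set.Ioi (0 : ℝ),
    alphaDiv α (gaussianDensity y₀ (pullback M f y₀)) (fun y => (γ : ℝ) * similarity y₀ y)

/-- The `α`-discrepancy of `f`, with prior `U` on the latent space and metric `M` on the
observation space. -/
def alphaDiscrepancy {d D : ℕ} (α : ℝ) (U : MeasureTheory.Measure (Euc d))
    (M : Euc D → Matrix (Fin D) (Fin D) ℝ) (f : Euc d → Euc D) : ℝ :=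
  ∫ y₀, pointDiscrepancy α M f y₀ ∂U

/-- The uniform distribution on the closed ball of centre `c` and radius `R`. -/
def uniformBall {d : ℕ} (c : Euc d) (R : ℝ) : MeasureTheory.Measure (Euc d) :=
  ProbabilityTheory.cond MeasureTheory.volume (Metric.closedBall c R)

/-! ### Stochastic neighbour embedding -/

/-- The point of the simplex on the index set `N` obtained by normalising the weights `w`. -/
def normalize {ι : Type*} (N : Finset ι) (w : ι → ℝ) (j : ι) : ℝ := w j / ∑ k ∈ N, w k

/-- The perplexity `exp H(p)` of `p`, where `H` is the Shannon entropy in natural units. -/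
def perplexity {ι : Type*} (N : Finset ι) (p : ι → ℝ) : ℝ :=
  Real.exp (-∑ j ∈ N, p j * Real.log (p j))

/-- The KL divergence between two points of the simplex on `N`. -/
def simplexKL {ι : Type*} (N : Finset ι) (p q : ι → ℝ) : ℝ :=
  ∑ j ∈ N, p j * Real.log (p j / q j)

/-- The Gaussian input similarities, normalised over the neighbours `N`, of the reference point
`x₀` with isotropic precision `lam`. -/
def inputProb {ι : Type*} {D : ℕ} (N : Finset ι) (x : ι → Euc D) (x₀ : Euc D) (lam : ℝ) : ι → ℝ :=
  normalize N fun j => Real.exp (-(lam / 2) * ‖x₀ - x j‖ ^ 2)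

/-- The similarities in the latent space, normalised over the neighbours `N`. -/
def outputProb {ι : Type*} {d : ℕ} (N : Finset ι) (y : ι → Euc d) (y₀ : Euc d) : ι → ℝ :=
  normalize N fun j => similarity y₀ (y j)

/-- The precision `lam > 0` for which the input similarities have perplexity `ρ`. The perplexity is
strictly decreasing in `lam` unless all the distances `‖x₀ - x j‖` agree, so there is at most one
such `lam`; the value is `0` if there is none. -/
def calibratedPrecision {ι : Type*} {D : ℕ} (ρ : ℝ) (N : Finset ι) (x : ι → Euc D)
    (x₀ : Euc D) : ℝ :=
  sInf {lam : ℝ | 0 < lam ∧ perplexity N (inputProb N x x₀ lam) = ρ}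

/-- The cost `∑ᵢ KL(Pᵢ : Qᵢ)` of stochastic neighbour embedding at perplexity `ρ` of the
observations `x₁, …, xₙ` by `y₁, …, yₙ`; the neighbours of `i` are all `j ≠ i`. -/
def sneCost {d D n : ℕ} (ρ : ℝ) (x : Fin n → Euc D) (y : Fin n → Euc d) : ℝ :=
  ∑ i : Fin n, simplexKL (Finset.univ.erase i)
    (inputProb (Finset.univ.erase i) x (x i)
      (calibratedPrecision ρ (Finset.univ.erase i) x (x i)))
    (outputProb (Finset.univ.erase i) y (y i))

open Classical in
/-- The isotropic metric `M(x₀) = lam(x₀) I` on the observation space, where `lam(x₀)` is calibrated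
to perplexity `ρ` with the observations other than `x₀` as neighbours. -/
def calibratedMetric {D n : ℕ} (ρ : ℝ) (x : Fin n → Euc D) (x₀ : Euc D) :
    Matrix (Fin D) (Fin D) ℝ :=
  calibratedPrecision ρ (Finset.univ.filter fun j => x j ≠ x₀) x x₀ • 1

end NeighbourEmbedding

end

/-! Part 1 is a Gaussian computation (`iInf_alphaDiv_gaussian`): the divergence is explicit in `γ`
and is minimised where `γ s` has total mass one.

For part 2, each term of the cost is minus an entropy, plus a cross term `∑ P ‖y_j - y_i‖² / 2`,
plus the logarithm of the normaliser of `Q`. Calibration makes the entropy exactly `log ρ`. The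
calibrated precision tends to infinity, so `P` concentrates at `y_i` and the cross term vanishes.
The normaliser is about `n` times the mean similarity to `y_i`. Hence `SNE_n / n - log n` tends to
`-log ρ + E log (mean similarity)`, whatever `f` is (`eventually_sneCost_near`).

On the other side, the closed form with metric `λ I` is `(d/2) log λ + (1/2) log det JᵀJ +
tr((JᵀJ)⁻¹) / (2λ) - d/2`. Writing `λ = det(JᵀJ)^(-1/d) n^(2/d) ℓ` cancels the determinant, produces
the same `log n`, and leaves `(d/2) log ℓ` and a trace term that vanishes
(`eventually_alphaDiscrepancy_near`). The theorem thus reduces to the convergence of the mean of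
`log ℓ` over `y₀` to a constant not depending on `f` (`MetricKernel.eventually_logMeanNear`).

That convergence is a local limit. Seen from an interior `y₀` at scale `n^(-1/d)`, the sample looks
like a Poisson process, and the kernel `det(JᵀJ)^(-1/d) ‖f y - f y₀‖² / 2` looks like `‖z‖² / 2`
after a volume-preserving linear map. So at each fixed precision the partition and energy sums have
a limit law depending only on the ball and on the precision, and the sums at two distinct points are
asymptotically independent. The second moment method then makes averages over `y₀` concentrate
(`tendsto_integral_sq_average`).

The event `α < ℓ` is the positivity of a continuous function of the two sums, so `log ℓ` is
approximated by averaging ramps of that function over a grid of values `log α`. Two estimates,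
uniform in `y₀` and in large `n`, control the error: the excess entropy is rarely close to zero at
one grid point and still positive at the next (`exists_forall_measureReal_excess_le`), and the tails
of `log ℓ` are summable (`exists_summable_tail`). The upper tail requires that two sample points
rarely have nearly equal smallest energies, which follows from a volume bound for thin shells of the
kernel. The approximations converge because they all approximate the same random mean, for any
kernel, in particular the Euclidean one. -/

noncomputable section
namespace NeighbourEmbedding
open Finset Filter Topology

/-! ### Entropy of Gibbs weights and the calibrated precision -/

section Gibbs

variable {ι : Type*}

/-- The partition function `∑ⱼ exp(-lam eⱼ)`. -/
def partitionSum (N : Finset ι) (e : ι → ℝ) (lam : ℝ) : ℝ := ∑ j ∈ N, Real.exp (-(lam * e j))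

/-- The unnormalised mean energy `∑ⱼ eⱼ exp(-lam eⱼ)`. -/
def energySum (N : Finset ι) (e : ι → ℝ) (lam : ℝ) : ℝ := ∑ j ∈ N, e j * Real.exp (-(lam * e j))

/-- The entropy of the Gibbs weights with energies `e` at inverse temperature `lam`. -/
def gibbsEntropy (N : Finset ι) (e : ι → ℝ) (lam : ℝ) : ℝ :=
  Real.log (partitionSum N e lam) + lam * energySum N e lam / partitionSum N e lam

/-- The inverse temperature at which the Gibbs weights have entropy `log ρ`. -/
def gibbsPrecision (ρ : ℝ) (N : Finset ι) (e : ι → ℝ) : ℝ :=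
  sInf {lam : ℝ | 0 < lam ∧ gibbsEntropy N e lam = Real.log ρ}

/-- The partition function times the excess of the entropy over `log ρ`. -/
def entropyExcess (ρ : ℝ) (N : Finset ι) (e : ι → ℝ) (lam : ℝ) : ℝ :=
  partitionSum N e lam * Real.log (partitionSum N e lam) + lam * energySum N e lam
    - partitionSum N e lam * Real.log ρ

lemma partitionSum_pos {N : Finset ι} (hN : N.Nonempty) (e : ι → ℝ) (lam : ℝ) :
    0 < partitionSum N e lam := Finset.sum_pos (fun _ _ => Real.exp_pos _) hN

/-- Multiplying by the partition function removes the division. Since `x log x` is continuous at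
`0`, the sign of the entropy excess becomes the sign of a function continuous on the whole plane of
the two sums, to which weak convergence applies. -/
lemma entropyExcess_eq {ρ : ℝ} {N : Finset ι} (hN : N.Nonempty) (e : ι → ℝ) (lam : ℝ) :
    entropyExcess ρ N e lam =
      partitionSum N e lam * (gibbsEntropy N e lam - Real.log ρ) := by
  have := (partitionSum_pos hN e lam).ne'
  unfold entropyExcess gibbsEntropy
  field_simp

/-- Chebyshev's association trick: the difference of mean energies is a double sum, and averaging it
with the sum in which `j` and `k` are exchanged makes every term a product of two differences of the
same sign when `a ≤ b`. -/
lemma energySum_mul_partitionSum_sub (N : Finset ι) (e : ι → ℝ) (a b : ℝ) :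
    2 * (energySum N e a * partitionSum N e b - energySum N e b * partitionSum N e a) =
      ∑ j ∈ N, ∑ k ∈ N, Real.exp (-(a * e j)) * Real.exp (-(a * e k)) *
        ((e j - e k) * (Real.exp (-((b - a) * e k)) - Real.exp (-((b - a) * e j)))) := by
  have hb : ∀ j, Real.exp (-(b * e j)) = Real.exp (-(a * e j)) * Real.exp (-((b - a) * e j)) := by
    intro j; rw [← Real.exp_add]; ring_nf
  have h1 : energySum N e a * partitionSum N e b - energySum N e b * partitionSum N e a =
      ∑ j ∈ N, ∑ k ∈ N, Real.exp (-(a * e j)) * Real.exp (-(a * e k)) *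
        ((e j - e k) * Real.exp (-((b - a) * e k))) := by
    unfold energySum partitionSum
    rw [mul_comm (∑ j ∈ N, e j * Real.exp (-(b * e j))), Finset.sum_mul_sum, Finset.sum_mul_sum,
      ← Finset.sum_sub_distrib]
    refine Finset.sum_congr rfl fun j _ => ?_
    rw [← Finset.sum_sub_distrib]
    refine Finset.sum_congr rfl fun k _ => ?_
    rw [hb k]; ring
  have h2 : energySum N e a * partitionSum N e b - energySum N e b * partitionSum N e a =
      ∑ j ∈ N, ∑ k ∈ N, Real.exp (-(a * e j)) * Real.exp (-(a * e k)) *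
        ((e j - e k) * (-Real.exp (-((b - a) * e j)))) := by
    rw [h1, Finset.sum_comm]
    refine Finset.sum_congr rfl fun j _ => Finset.sum_congr rfl fun k _ => ?_
    ring
  rw [two_mul]
  nth_rewrite 1 [h1]
  rw [h2, ← Finset.sum_add_distrib]
  refine Finset.sum_congr rfl fun j _ => ?_
  rw [← Finset.sum_add_distrib]
  refine Finset.sum_congr rfl fun k _ => ?_
  ring

lemma sub_mul_exp_sub_nonneg {a b x y : ℝ} (hab : a ≤ b) :
    0 ≤ (x - y) * (Real.exp (-((b - a) * y)) - Real.exp (-((b - a) * x))) := by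
  rcases le_total x y with h | h
  · refine mul_nonneg_of_nonpos_of_nonpos (by linarith) ?_
    rw [sub_nonpos, Real.exp_le_exp]
    nlinarith
  · refine mul_nonneg (by linarith) ?_
    rw [sub_nonneg, Real.exp_le_exp]
    nlinarith

/-- All terms of the symmetrised double sum are nonnegative, so a single pair already gives a lower
bound. -/
lemma le_energySum_mul_partitionSum_sub {N : Finset ι} {e : ι → ℝ} {a b : ℝ} (hab : a ≤ b)
    {j k : ι} (hj : j ∈ N) (hk : k ∈ N) :
    Real.exp (-(a * e j)) * Real.exp (-(a * e k)) *
        ((e j - e k) * (Real.exp (-((b - a) * e k)) - Real.exp (-((b - a) * e j)))) / 2 ≤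
      energySum N e a * partitionSum N e b - energySum N e b * partitionSum N e a := by
  have h := energySum_mul_partitionSum_sub N e a b
  have hnn : ∀ j k, 0 ≤ Real.exp (-(a * e j)) * Real.exp (-(a * e k)) *
      ((e j - e k) * (Real.exp (-((b - a) * e k)) - Real.exp (-((b - a) * e j)))) := fun j k =>
    mul_nonneg (by positivity) (sub_mul_exp_sub_nonneg hab)
  have h1 := Finset.single_le_sum (f := fun k => Real.exp (-(a * e j)) * Real.exp (-(a * e k)) *
    ((e j - e k) * (Real.exp (-((b - a) * e k)) - Real.exp (-((b - a) * e j)))))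
    (fun k _ => hnn j k) hk
  have h2 := Finset.single_le_sum (f := fun j => ∑ k ∈ N, Real.exp (-(a * e j)) *
    Real.exp (-(a * e k)) *
    ((e j - e k) * (Real.exp (-((b - a) * e k)) - Real.exp (-((b - a) * e j)))))
    (fun j _ => Finset.sum_nonneg fun k _ => hnn j k) hj
  linarith

/-- The logarithm of the partition function lies above its tangents. -/
lemma log_partitionSum_sub_ge {N : Finset ι} (hN : N.Nonempty) (e : ι → ℝ) (a b : ℝ) :
    (b - a) * (energySum N e b / partitionSum N e b) ≤
      Real.log (partitionSum N e a) - Real.log (partitionSum N e b) := by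
  have hWa := partitionSum_pos hN e a
  have hWb := partitionSum_pos hN e b
  set m := (b - a) * (energySum N e b / partitionSum N e b) with hm
  rw [← Real.log_div hWa.ne' hWb.ne', Real.le_log_iff_exp_le (by positivity), le_div_iff₀ hWb]
  -- Jensen's inequality by hand: `1 + x ≤ exp x` is applied at energies centred by the Gibbs mean
  -- at `b`, so the linear terms sum to zero.
  have h1 : ∀ j ∈ N, Real.exp m * (Real.exp (-(b * e j)) * (1 + ((b - a) * e j - m))) ≤
      Real.exp (-(a * e j)) := by
    intro j _
    have h2 : Real.exp (-(a * e j)) =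
        Real.exp m * (Real.exp (-(b * e j)) * Real.exp ((b - a) * e j - m)) := by
      rw [← Real.exp_add, ← Real.exp_add]; ring_nf
    rw [h2]
    gcongr
    linarith [Real.add_one_le_exp ((b - a) * e j - m)]
  have h3 := Finset.sum_le_sum h1
  rw [← Finset.mul_sum] at h3
  have h4 : ∑ j ∈ N, Real.exp (-(b * e j)) * (1 + ((b - a) * e j - m)) =
      partitionSum N e b + (b - a) * energySum N e b - m * partitionSum N e b := by
    unfold partitionSum energySum
    rw [Finset.mul_sum, Finset.mul_sum, ← Finset.sum_add_distrib, ← Finset.sum_sub_distrib]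
    exact Finset.sum_congr rfl fun j _ => by ring
  have h5 : (b - a) * energySum N e b - m * partitionSum N e b = 0 := by
    rw [hm]; field_simp; ring
  rw [h4, add_sub_assoc, h5, add_zero] at h3
  exact h3

/-- With `U` the mean energy, the tangent inequality turns the difference of entropies into at least
`(b - a) U(b) + a U(a) - b U(b) = a (U(a) - U(b))`. -/
lemma gibbsEntropy_sub_ge {N : Finset ι} (hN : N.Nonempty) (e : ι → ℝ) (a b : ℝ) :
    a * ((energySum N e a * partitionSum N e b - energySum N e b * partitionSum N e a) /
      (partitionSum N e a * partitionSum N e b)) ≤ gibbsEntropy N e a - gibbsEntropy N e b := by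
  have hWa := (partitionSum_pos hN e a).ne'
  have hWb := (partitionSum_pos hN e b).ne'
  have h := log_partitionSum_sub_ge hN e a b
  have h2 : (energySum N e a * partitionSum N e b - energySum N e b * partitionSum N e a) /
      (partitionSum N e a * partitionSum N e b) =
      energySum N e a / partitionSum N e a - energySum N e b / partitionSum N e b := by
    field_simp
  rw [h2]
  unfold gibbsEntropy
  rw [mul_div_assoc, mul_div_assoc]
  linarith

/-- Quantitative decrease of the entropy. -/
lemma gibbsEntropy_sub_ge_pair {N : Finset ι} {e : ι → ℝ} {a b : ℝ} (ha : 0 ≤ a) (hab : a ≤ b)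
    {j k : ι} (hj : j ∈ N) (hk : k ∈ N) :
    a * (Real.exp (-(a * e j)) * Real.exp (-(a * e k)) *
        ((e j - e k) * (Real.exp (-((b - a) * e k)) - Real.exp (-((b - a) * e j)))) / 2 /
      (partitionSum N e a * partitionSum N e b)) ≤ gibbsEntropy N e a - gibbsEntropy N e b := by
  have hN : N.Nonempty := ⟨j, hj⟩
  have hWa := partitionSum_pos hN e a
  have hWb := partitionSum_pos hN e b
  refine le_trans ?_ (gibbsEntropy_sub_ge hN e a b)
  gcongr
  exact le_energySum_mul_partitionSum_sub hab hj hk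

lemma gibbsEntropy_strictAnti {N : Finset ι} {e : ι → ℝ} {a b : ℝ} (ha : 0 < a)
    (hab : a < b) {j k : ι} (hj : j ∈ N) (hk : k ∈ N) (hjk : e j ≠ e k) :
    gibbsEntropy N e b < gibbsEntropy N e a := by
  have hN : N.Nonempty := ⟨j, hj⟩
  have hWa := partitionSum_pos hN e a
  have hWb := partitionSum_pos hN e b
  have h := gibbsEntropy_sub_ge_pair (e := e) ha.le hab.le hj hk
  have h2 : 0 < (e j - e k) * (Real.exp (-((b - a) * e k)) - Real.exp (-((b - a) * e j))) := by
    refine lt_of_le_of_ne (sub_mul_exp_sub_nonneg hab.le) (Ne.symm (mul_ne_zero ?_ ?_))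
    · exact sub_ne_zero.2 hjk
    · rw [sub_ne_zero, Ne, Real.exp_eq_exp]
      intro h3
      have h4 : (b - a) * (e j - e k) = 0 := by linarith
      rcases mul_eq_zero.1 h4 with h5 | h5
      · linarith
      · exact hjk (by linarith)
  have h3 : 0 < a * (Real.exp (-(a * e j)) * Real.exp (-(a * e k)) *
        ((e j - e k) * (Real.exp (-((b - a) * e k)) - Real.exp (-((b - a) * e j)))) / 2 /
      (partitionSum N e a * partitionSum N e b)) := by positivity
  linarith

lemma gibbsEntropy_const {N : Finset ι} (hN : N.Nonempty) {e : ι → ℝ} {v : ℝ}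
    (he : ∀ j ∈ N, e j = v) (lam : ℝ) : gibbsEntropy N e lam = Real.log #N := by
  have h1 : partitionSum N e lam = #N * Real.exp (-(lam * v)) := by
    unfold partitionSum
    rw [Finset.sum_congr rfl fun j hj => by rw [he j hj]]; simp
  have h2 : energySum N e lam = v * (#N * Real.exp (-(lam * v))) := by
    unfold energySum
    rw [Finset.sum_congr rfl fun j hj => by rw [he j hj]]; simp; ring
  have hc : (0 : ℝ) < #N := by exact_mod_cast hN.card_pos
  unfold gibbsEntropy
  rw [h1, h2, Real.log_mul hc.ne' (Real.exp_pos _).ne', Real.log_exp]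
  field_simp
  ring

lemma gibbsEntropy_empty (e : ι → ℝ) (lam : ℝ) : gibbsEntropy ∅ e lam = 0 := by
  simp [gibbsEntropy, partitionSum]

lemma gibbsPrecision_eq {ρ : ℝ} {N : Finset ι} {e : ι → ℝ} {lam : ℝ} (hlam : 0 < lam)
    (h : gibbsEntropy N e lam = Real.log ρ) {j k : ι} (hj : j ∈ N) (hk : k ∈ N)
    (hjk : e j ≠ e k) : gibbsPrecision ρ N e = lam := by
  have : {l : ℝ | 0 < l ∧ gibbsEntropy N e l = Real.log ρ} = {lam} := by
    ext l
    simp only [Set.mem_ofPred_eq, Set.mem_singleton_iff]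
    constructor
    · rintro ⟨hl, hl2⟩
      rcases lt_trichotomy l lam with h3 | h3 | h3
      · have := gibbsEntropy_strictAnti hl h3 hj hk hjk
        linarith
      · exact h3
      · have := gibbsEntropy_strictAnti hlam h3 hj hk hjk
        linarith
    · rintro rfl
      exact ⟨hlam, h⟩
  unfold gibbsPrecision
  rw [this, csInf_singleton]

lemma gibbsPrecision_nonneg (ρ : ℝ) (N : Finset ι) (e : ι → ℝ) : 0 ≤ gibbsPrecision ρ N e :=
  Real.sInf_nonneg fun _ h => h.1.le

/-- Positivity certifies a genuine solution. The infimum of the empty set is `0`, and for equal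
energies the entropy is constant, so the set of solutions is empty or the whole open half-line,
again with infimum `0`. -/
lemma exists_ne_of_gibbsPrecision_pos {ρ : ℝ} {N : Finset ι} {e : ι → ℝ} (hρ : 1 < ρ)
    (h : 0 < gibbsPrecision ρ N e) :
    (∃ j ∈ N, ∃ k ∈ N, e j ≠ e k) ∧
      gibbsEntropy N e (gibbsPrecision ρ N e) = Real.log ρ := by
  have hne : {l : ℝ | 0 < l ∧ gibbsEntropy N e l = Real.log ρ}.Nonempty := by
    by_contra hc
    rw [Set.not_nonempty_iff_eq_empty] at hc
    unfold gibbsPrecision at h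
    rw [hc, Real.sInf_empty] at h
    exact lt_irrefl _ h
  obtain ⟨l, hl, hl2⟩ := hne
  have hN : N.Nonempty := by
    by_contra hc
    rw [Finset.not_nonempty_iff_eq_empty] at hc
    rw [hc, gibbsEntropy_empty] at hl2
    exact (Real.log_pos hρ).ne hl2
  have hex : ∃ j ∈ N, ∃ k ∈ N, e j ≠ e k := by
    by_contra! hc
    obtain ⟨j, hj⟩ := hN
    have hconst := gibbsEntropy_const ⟨j, hj⟩ (fun k hk => hc k hk j hj)
    have : {l : ℝ | 0 < l ∧ gibbsEntropy N e l = Real.log ρ} = Set.Ioi 0 := by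
      ext l'
      simp only [Set.mem_ofPred_eq, Set.mem_Ioi, and_iff_left_iff_imp]
      intro _
      rw [hconst, ← hconst l, hl2]
    unfold gibbsPrecision at h
    rw [this, csInf_Ioi] at h
    exact lt_irrefl _ h
  refine ⟨hex, ?_⟩
  obtain ⟨j, hj, k, hk, hjk⟩ := hex
  rw [gibbsPrecision_eq hl hl2 hj hk hjk, hl2]

lemma log_lt_gibbsEntropy_of_lt {ρ : ℝ} {N : Finset ι} {e : ι → ℝ} (hρ : 1 < ρ) {a : ℝ}
    (ha : 0 < a) (h : a < gibbsPrecision ρ N e) : Real.log ρ < gibbsEntropy N e a := by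
  obtain ⟨⟨j, hj, k, hk, hjk⟩, h2⟩ := exists_ne_of_gibbsPrecision_pos hρ (ha.trans h)
  rw [← h2]
  exact gibbsEntropy_strictAnti ha h hj hk hjk

lemma gibbsEntropy_lt_log_of_lt {ρ : ℝ} {N : Finset ι} {e : ι → ℝ} (hρ : 1 < ρ) {a : ℝ}
    (hpos : 0 < gibbsPrecision ρ N e) (h : gibbsPrecision ρ N e < a) :
    gibbsEntropy N e a < Real.log ρ := by
  obtain ⟨⟨j, hj, k, hk, hjk⟩, h2⟩ := exists_ne_of_gibbsPrecision_pos hρ hpos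
  rw [← h2]
  exact gibbsEntropy_strictAnti hpos h hj hk hjk

lemma nonempty_of_gibbsPrecision_pos {ρ : ℝ} {N : Finset ι} {e : ι → ℝ} (hρ : 1 < ρ)
    (hpos : 0 < gibbsPrecision ρ N e) : N.Nonempty := by
  obtain ⟨⟨j, hj, -⟩, -⟩ := exists_ne_of_gibbsPrecision_pos hρ hpos
  exact ⟨j, hj⟩

lemma entropyExcess_pos_iff {ρ : ℝ} {N : Finset ι} (hN : N.Nonempty) (e : ι → ℝ) (a : ℝ) :
    0 < entropyExcess ρ N e a ↔ Real.log ρ < gibbsEntropy N e a := by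
  rw [entropyExcess_eq hN, mul_pos_iff_of_pos_left (partitionSum_pos hN e a), sub_pos]

/-- This is the link between the precision and the limit law: comparing the precision with a fixed
`a` only involves the two sums at `a`. -/
lemma entropyExcess_pos_iff_lt {ρ : ℝ} {N : Finset ι} {e : ι → ℝ} (hρ : 1 < ρ) {a : ℝ}
    (ha : 0 < a) (hpos : 0 < gibbsPrecision ρ N e) :
    0 < entropyExcess ρ N e a ↔ a < gibbsPrecision ρ N e := by
  rw [entropyExcess_pos_iff (nonempty_of_gibbsPrecision_pos hρ hpos)]
  refine ⟨fun h => ?_, log_lt_gibbsEntropy_of_lt hρ ha⟩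
  by_contra! hc
  rcases hc.eq_or_lt with h2 | h2
  · obtain ⟨-, h3⟩ := exists_ne_of_gibbsPrecision_pos hρ hpos
    rw [h2] at h3
    linarith
  · have := gibbsEntropy_lt_log_of_lt hρ hpos h2
    linarith

lemma log_partitionSum_le_gibbsEntropy {N : Finset ι} {e : ι → ℝ} (he : ∀ j ∈ N, 0 ≤ e j)
    {lam : ℝ} (hlam : 0 ≤ lam) : Real.log (partitionSum N e lam) ≤ gibbsEntropy N e lam := by
  have h1 : 0 ≤ energySum N e lam :=
    Finset.sum_nonneg fun j hj => mul_nonneg (he j hj) (Real.exp_pos _).le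
  have h2 : 0 ≤ partitionSum N e lam := Finset.sum_nonneg fun j _ => (Real.exp_pos _).le
  unfold gibbsEntropy
  have : 0 ≤ lam * energySum N e lam / partitionSum N e lam := by positivity
  linarith

lemma one_add_mul_exp_neg_le (x : ℝ) :
    Real.exp (-x) + x * Real.exp (-x) ≤ 2 * Real.exp (-(x / 2)) := by
  have h1 : Real.exp (-(x / 2)) = Real.exp (-x) * Real.exp (x / 2) := by
    rw [← Real.exp_add]; ring_nf
  have h2 := Real.add_one_le_exp (x / 2)
  rw [h1]
  nlinarith [Real.exp_pos (-x)]

/-- The entropy is small if the ground state is well separated. -/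
lemma gibbsEntropy_le [DecidableEq ι] {N : Finset ι} {e : ι → ℝ} {lam : ℝ} (hlam : 0 ≤ lam)
    {i : ι} (hi : i ∈ N) (hmin : ∀ j ∈ N, e i ≤ e j) :
    gibbsEntropy N e lam ≤ ∑ j ∈ N.erase i, 2 * Real.exp (-(lam * (e j - e i) / 2)) := by
  -- Measuring energies from the ground state leaves the entropy unchanged and gives it the form
  -- `log (1 + S) + T / (1 + S) ≤ S + T`; the terms of `S + T` are then bounded by `exp (-x) + x exp
  -- (-x) ≤ 2 exp (-x / 2)`.
  set S := ∑ j ∈ N.erase i, Real.exp (-(lam * (e j - e i))) with hS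
  set T := ∑ j ∈ N.erase i, lam * (e j - e i) * Real.exp (-(lam * (e j - e i))) with hT
  have hx : ∀ j ∈ N.erase i, 0 ≤ lam * (e j - e i) := fun j hj =>
    mul_nonneg hlam (sub_nonneg.2 (hmin j (Finset.mem_of_mem_erase hj)))
  have hS0 : 0 ≤ S := Finset.sum_nonneg fun j _ => (Real.exp_pos _).le
  have hT0 : 0 ≤ T := Finset.sum_nonneg fun j hj => mul_nonneg (hx j hj) (Real.exp_pos _).le
  have hW : partitionSum N e lam = Real.exp (-(lam * e i)) * (1 + S) := by
    unfold partitionSum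
    rw [← Finset.add_sum_erase N _ hi, mul_add, mul_one, hS, Finset.mul_sum]
    congr 1
    refine Finset.sum_congr rfl fun j _ => ?_
    rw [← Real.exp_add]; ring_nf
  have hE : lam * energySum N e lam =
      Real.exp (-(lam * e i)) * (lam * e i * (1 + S) + T) := by
    unfold energySum
    have hr : Real.exp (-(lam * e i)) * (lam * e i * (1 + S) + T) =
        lam * (e i * Real.exp (-(lam * e i))) +
          ∑ j ∈ N.erase i, Real.exp (-(lam * e i)) * (lam * e i *
            Real.exp (-(lam * (e j - e i))) + lam * (e j - e i) *
              Real.exp (-(lam * (e j - e i)))) := by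
      rw [← Finset.mul_sum, Finset.sum_add_distrib, ← Finset.mul_sum, ← hS, ← hT]
      ring
    rw [hr, ← Finset.add_sum_erase N _ hi, mul_add, Finset.mul_sum]
    congr 1
    refine Finset.sum_congr rfl fun j _ => ?_
    have : Real.exp (-(lam * e j)) =
        Real.exp (-(lam * e i)) * Real.exp (-(lam * (e j - e i))) := by
      rw [← Real.exp_add]; ring_nf
    rw [this]; ring
  have hH : gibbsEntropy N e lam = Real.log (1 + S) + T / (1 + S) := by
    unfold gibbsEntropy
    rw [hE, hW, Real.log_mul (Real.exp_pos _).ne' (by positivity), Real.log_exp,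
      mul_div_mul_left _ _ (Real.exp_pos _).ne', add_div, mul_div_cancel_right₀ _ (by positivity)]
    ring
  have h1 : Real.log (1 + S) ≤ S := by
    have := Real.log_le_sub_one_of_pos (show 0 < 1 + S by positivity)
    linarith
  have h2 : T / (1 + S) ≤ T := div_le_self hT0 (by linarith)
  rw [hH]
  calc _ ≤ S + T := add_le_add h1 h2
    _ = ∑ j ∈ N.erase i, (Real.exp (-(lam * (e j - e i))) +
          lam * (e j - e i) * Real.exp (-(lam * (e j - e i)))) := by
        rw [hS, hT, Finset.sum_add_distrib]
    _ ≤ _ := Finset.sum_le_sum fun j _ => one_add_mul_exp_neg_le _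

lemma continuous_partitionSum (N : Finset ι) (e : ι → ℝ) : Continuous (partitionSum N e) := by
  unfold partitionSum; fun_prop

lemma continuous_energySum (N : Finset ι) (e : ι → ℝ) : Continuous (energySum N e) := by
  unfold energySum; fun_prop

lemma continuous_gibbsEntropy {N : Finset ι} (hN : N.Nonempty) (e : ι → ℝ) :
    Continuous (gibbsEntropy N e) := by
  have h0 : ∀ x, partitionSum N e x ≠ 0 := fun x => (partitionSum_pos hN e x).ne'
  have h1 := continuous_partitionSum N e
  have h2 := continuous_energySum N e
  unfold gibbsEntropy
  exact (h1.log h0).add ((continuous_id.mul h2).div h1 h0)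

/-- The calibrated precision is positive if the ground state is unique. -/
lemma gibbsPrecision_pos {ρ : ℝ} (hρ : 1 < ρ) {N : Finset ι} {e : ι → ℝ} {i : ι} (hi : i ∈ N)
    (hmin : ∀ j ∈ N, j ≠ i → e i < e j) (hcard : ρ < #N) : 0 < gibbsPrecision ρ N e := by
  classical
  have hN : N.Nonempty := ⟨i, hi⟩
  have hlogρ := Real.log_pos hρ
  have hcont := continuous_gibbsEntropy hN e
  -- The entropy is `log #N > log ρ` at precision `0` and is below `log ρ` at large precision
  -- because the ground state is unique; the intermediate value theorem gives a solution.
  have h0 : gibbsEntropy N e 0 = Real.log #N := by simp [gibbsEntropy, partitionSum]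
  have hlt : Real.log ρ < gibbsEntropy N e 0 := by
    rw [h0]; exact Real.log_lt_log (by linarith) hcard
  have hev : ∀ᶠ lam in 𝓝[>] (0 : ℝ), Real.log ρ < gibbsEntropy N e lam :=
    (hcont.tendsto 0).mono_left nhdsWithin_le_nhds |>.eventually (lt_mem_nhds hlt)
  obtain ⟨a, ha, ha0⟩ := (hev.and self_mem_nhdsWithin).exists
  have ha0 : 0 < a := ha0
  have htend : Tendsto (fun lam => ∑ j ∈ N.erase i, 2 * Real.exp (-(lam * (e j - e i) / 2)))
      atTop (𝓝 0) := by
    have : (0 : ℝ) = ∑ j ∈ N.erase i, 2 * (0 : ℝ) := by simp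
    rw [this]
    refine tendsto_finsetSum _ fun j hj => Tendsto.const_mul 2 ?_
    refine Real.tendsto_exp_neg_atTop_nhds_zero.comp ?_
    have hp : 0 < (e j - e i) / 2 := by
      have := hmin j (Finset.mem_of_mem_erase hj) (Finset.ne_of_mem_erase hj)
      linarith
    simpa [mul_div_assoc] using tendsto_id.atTop_mul_const hp
  obtain ⟨b, hb, hab⟩ := ((htend.eventually (gt_mem_nhds hlogρ)).and (eventually_ge_atTop a)).exists
  have hb2 : gibbsEntropy N e b ≤ Real.log ρ := by
    refine (gibbsEntropy_le (ha0.le.trans hab) hi fun j hj => ?_).trans hb.le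
    rcases eq_or_ne j i with rfl | hji
    · exact le_rfl
    · exact (hmin j hj hji).le
  obtain ⟨lam, ⟨hl1, -⟩, hl2⟩ := intermediate_value_Icc' hab hcont.continuousOn
    (show Real.log ρ ∈ Set.Icc (gibbsEntropy N e b) (gibbsEntropy N e a) from ⟨hb2, ha.le⟩)
  have h1 : 1 < #N := by
    have : (1 : ℝ) < #N := by linarith
    exact_mod_cast this
  obtain ⟨j, hj, hji⟩ := Finset.exists_mem_ne h1 i
  rw [gibbsPrecision_eq (ha0.trans_le hl1) hl2 hj hi (hmin j hj hji).ne']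
  exact ha0.trans_le hl1

lemma partitionSum_const_mul (N : Finset ι) (e : ι → ℝ) (c lam : ℝ) :
    partitionSum N (fun j => c * e j) lam = partitionSum N e (c * lam) := by
  unfold partitionSum
  exact Finset.sum_congr rfl fun j _ => by ring_nf

lemma gibbsEntropy_const_mul (N : Finset ι) (e : ι → ℝ) (c lam : ℝ) :
    gibbsEntropy N (fun j => c * e j) lam = gibbsEntropy N e (c * lam) := by
  have h2 : energySum N (fun j => c * e j) lam = c * energySum N e (c * lam) := by
    unfold energySum
    rw [Finset.mul_sum]
    exact Finset.sum_congr rfl fun j _ => by ring_nf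
  unfold gibbsEntropy
  rw [partitionSum_const_mul, h2]
  ring

/-- This scaling rule moves the constants `n^(2/d)` and `det(JᵀJ)^(-1/d)` between the kernel and the
precision. -/
lemma gibbsPrecision_const_mul (ρ : ℝ) (N : Finset ι) (e : ι → ℝ) {c : ℝ} (hc : 0 < c) :
    c * gibbsPrecision ρ N (fun j => c * e j) = gibbsPrecision ρ N e := by
  unfold gibbsPrecision
  rw [← smul_eq_mul, ← Real.sInf_smul_of_nonneg hc.le]
  congr 1
  ext l
  simp only [Set.mem_smul_set, Set.mem_ofPred_eq, gibbsEntropy_const_mul, smul_eq_mul]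
  constructor
  · rintro ⟨x, ⟨hx, hx2⟩, rfl⟩
    exact ⟨by positivity, hx2⟩
  · rintro ⟨hl, hl2⟩
    refine ⟨l / c, ⟨by positivity, ?_⟩, by field_simp⟩
    rwa [mul_div_cancel₀ _ hc.ne']

lemma gibbsPrecision_congr (ρ : ℝ) {N : Finset ι} {e e' : ι → ℝ} (h : ∀ j ∈ N, e j = e' j) :
    gibbsPrecision ρ N e = gibbsPrecision ρ N e' := by
  have : gibbsEntropy N e = gibbsEntropy N e' := by
    funext l
    have h1 : partitionSum N e l = partitionSum N e' l :=
      Finset.sum_congr rfl fun j hj => by rw [h j hj]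
    have h2 : energySum N e l = energySum N e' l :=
      Finset.sum_congr rfl fun j hj => by rw [h j hj]
    simp only [gibbsEntropy, h1, h2]
  simp only [gibbsPrecision, this]

lemma gibbsPrecision_univ_eq_range (ρ : ℝ) (n : ℕ) (e : ℕ → ℝ) :
    gibbsPrecision ρ (Finset.univ : Finset (Fin n)) (fun j => e j) =
      gibbsPrecision ρ (Finset.range n) e := by
  have : gibbsEntropy (Finset.univ : Finset (Fin n)) (fun j => e j) =
      gibbsEntropy (Finset.range n) e := by
    funext l
    have h1 : partitionSum (Finset.univ : Finset (Fin n)) (fun j => e j) l =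
        partitionSum (Finset.range n) e l :=
      Fin.sum_univ_eq_sum_range (fun j => Real.exp (-(l * e j))) n
    have h2 : energySum (Finset.univ : Finset (Fin n)) (fun j => e j) l =
        energySum (Finset.range n) e l :=
      Fin.sum_univ_eq_sum_range (fun j => e j * Real.exp (-(l * e j))) n
    simp only [gibbsEntropy, h1, h2]
  simp only [gibbsPrecision, this]

/-- A lower bound for the precision when all energies are bounded. -/
lemma log_card_div_le_gibbsPrecision_mul {ρ : ℝ} (hρ : 1 < ρ) {N : Finset ι} {e : ι → ℝ} {b : ℝ}
    (he : ∀ j ∈ N, 0 ≤ e j) (hb : ∀ j ∈ N, e j ≤ b) (hpos : 0 < gibbsPrecision ρ N e) :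
    Real.log (#N / ρ) ≤ gibbsPrecision ρ N e * b := by
  have hN := nonempty_of_gibbsPrecision_pos hρ hpos
  obtain ⟨-, h2⟩ := exists_ne_of_gibbsPrecision_pos hρ hpos
  set lam := gibbsPrecision ρ N e
  have h3 := log_partitionSum_le_gibbsEntropy he hpos.le
  have hc : (0 : ℝ) < #N := by exact_mod_cast hN.card_pos
  have h4 : #N * Real.exp (-(lam * b)) ≤ partitionSum N e lam := by
    unfold partitionSum
    rw [← nsmul_eq_mul]
    refine Finset.card_nsmul_le_sum _ _ _ fun j hj => ?_
    rw [Real.exp_le_exp]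
    nlinarith [hb j hj]
  have h5 := Real.log_le_log (by positivity) h4
  rw [Real.log_mul hc.ne' (Real.exp_pos _).ne', Real.log_exp] at h5
  rw [Real.log_div hc.ne' (by linarith)]
  linarith

/-! ### Translation of perplexity into the entropy of Gibbs weights. -/

lemma perplexity_inputProb {D : ℕ} (N : Finset ι) (x : ι → Euc D) (x₀ : Euc D) (lam : ℝ) :
    perplexity N (inputProb N x x₀ lam) =
      Real.exp (gibbsEntropy N (fun j => ‖x₀ - x j‖ ^ 2 / 2) lam) := by
  rcases N.eq_empty_or_nonempty with rfl | hN
  · simp [perplexity, gibbsEntropy_empty]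
  set e : ι → ℝ := fun j => ‖x₀ - x j‖ ^ 2 / 2 with he
  have hW := partitionSum_pos hN e lam
  have hp : ∀ j, inputProb N x x₀ lam j = Real.exp (-(lam * e j)) / partitionSum N e lam := by
    intro j
    unfold inputProb normalize partitionSum
    simp only [he]
    congr 1
    · ring_nf
    · exact Finset.sum_congr rfl fun k _ => by ring_nf
  unfold perplexity
  congr 1
  have : ∀ j ∈ N, inputProb N x x₀ lam j * Real.log (inputProb N x x₀ lam j) =
      -(lam * (e j * Real.exp (-(lam * e j))) / partitionSum N e lam
        + Real.exp (-(lam * e j)) * (Real.log (partitionSum N e lam) / partitionSum N e lam)) := by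
    intro j _
    rw [hp, Real.log_div (Real.exp_pos _).ne' hW.ne', Real.log_exp]
    field_simp
    ring
  rw [Finset.sum_congr rfl this, Finset.sum_neg_distrib, neg_neg, Finset.sum_add_distrib,
    ← Finset.sum_div, ← Finset.mul_sum, ← Finset.sum_mul]
  change lam * energySum N e lam / partitionSum N e lam + partitionSum N e lam * _ = _
  unfold gibbsEntropy
  field_simp
  ring

lemma calibratedPrecision_eq {ρ : ℝ} (hρ : 1 < ρ) {D : ℕ} (N : Finset ι) (x : ι → Euc D)
    (x₀ : Euc D) :
    calibratedPrecision ρ N x x₀ = gibbsPrecision ρ N (fun j => ‖x₀ - x j‖ ^ 2 / 2) := by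
  unfold calibratedPrecision gibbsPrecision
  congr 1
  ext l
  simp only [Set.mem_ofPred_eq, perplexity_inputProb, and_congr_right_iff]
  intro _
  constructor
  · intro h
    rw [← h, Real.log_exp]
  · intro h
    rw [h, Real.exp_log (by linarith)]

end Gibbs

/-- The set of energies with calibrated precision above a positive threshold. -/
lemma measurable_gibbsPrecision {ι : Type*} {ρ : ℝ} (hρ : 1 < ρ) {X : Type*} [MeasurableSpace X]
    (N : Finset ι) {e : X → ι → ℝ} (he : ∀ j, Measurable fun x => e x j) :
    Measurable fun x => gibbsPrecision ρ N (e x) := by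
  have hH : ∀ lam, Measurable fun x => gibbsEntropy N (e x) lam := by
    intro lam
    unfold gibbsEntropy partitionSum energySum
    fun_prop
  rcases N.eq_empty_or_nonempty with rfl | hN
  · have : (fun x => gibbsPrecision ρ ∅ (e x)) = fun _ => 0 := by
      funext x
      by_contra hc
      exact Finset.not_nonempty_empty (nonempty_of_gibbsPrecision_pos hρ
        (lt_of_le_of_ne (gibbsPrecision_nonneg ρ ∅ (e x)) (Ne.symm hc)))
    rw [this]; exact measurable_const
  refine measurable_of_Ioi fun a => ?_
  -- For `a ≥ 0`, the precision exceeds `a` exactly when the entropy crosses `log ρ` downwards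
  -- between two rationals beyond `a`. This is a countable condition on measurable functions; a
  -- strict change of sign also excludes equal energies.
  have key : (fun x => gibbsPrecision ρ N (e x)) ⁻¹' Set.Ioi a =
      if a < 0 then Set.univ else ⋃ (p : ℚ) (q : ℚ), {x | a < p ∧ p < q ∧
        Real.log ρ < gibbsEntropy N (e x) p ∧ gibbsEntropy N (e x) q < Real.log ρ} := by
    split_ifs with ha
    · ext x
      simpa using ha.trans_le (gibbsPrecision_nonneg ρ N (e x))
    · push Not at ha
      ext x
      simp only [Set.mem_preimage, Set.mem_Ioi, Set.mem_iUnion, Set.mem_ofPred_eq]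
      constructor
      · intro h
        obtain ⟨p, hp1, hp2⟩ := exists_rat_btwn h
        obtain ⟨q, hq1, hq2⟩ := exists_rat_btwn (lt_add_one (gibbsPrecision ρ N (e x)))
        exact ⟨p, q, hp1, by exact_mod_cast hp2.trans hq1,
          log_lt_gibbsEntropy_of_lt hρ (ha.trans_lt hp1) hp2,
          gibbsEntropy_lt_log_of_lt hρ (ha.trans_lt h) hq1⟩
      · rintro ⟨p, q, hp, hpq, h1, h2⟩
        have hpq' : (p : ℝ) < q := by exact_mod_cast hpq
        obtain ⟨lam, ⟨hl1, -⟩, hl2⟩ := intermediate_value_Icc' hpq'.le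
          (continuous_gibbsEntropy hN (e x)).continuousOn
          (show Real.log ρ ∈ Set.Icc _ _ from ⟨h2.le, h1.le⟩)
        have hne : ∃ j ∈ N, ∃ k ∈ N, e x j ≠ e x k := by
          by_contra! hc
          obtain ⟨j, hj⟩ := hN
          have := gibbsEntropy_const ⟨j, hj⟩ (fun k hk => hc k hk j hj)
          rw [this] at h1 h2
          linarith
        obtain ⟨j, hj, k, hk, hjk⟩ := hne
        rw [gibbsPrecision_eq (by linarith) hl2 hj hk hjk]
        linarith
  rw [key]
  split_ifs
  · exact MeasurableSet.univ
  · refine MeasurableSet.iUnion fun p => MeasurableSet.iUnion fun q => ?_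
    have := (measurableSet_lt (measurable_const (a := Real.log ρ)) (hH p)).inter
      (measurableSet_lt (hH q) (measurable_const (a := Real.log ρ)))
    by_cases h1 : a < p
    · by_cases h2 : p < q
      · have h3 : {x | a < p ∧ p < q ∧ Real.log ρ < gibbsEntropy N (e x) p ∧
            gibbsEntropy N (e x) q < Real.log ρ} = {x | Real.log ρ < gibbsEntropy N (e x) p} ∩
              {x | gibbsEntropy N (e x) q < Real.log ρ} := by
          ext x; simp [h1, h2]
        rw [h3]; exact this
      · simp [h2]
    · simp [h1]

end NeighbourEmbedding
end

noncomputable section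
namespace NeighbourEmbedding
open MeasureTheory Matrix

/-! ### Gaussian integrals and the pointwise discrepancy -/

/-- The factor `B` is the linear change of variables that turns a Gaussian with precision `A` into
the standard one. -/
lemma exists_transpose_mul_self_of_posDef {d : ℕ} {A : Matrix (Fin d) (Fin d) ℝ} (hA : A.PosDef) :
    ∃ B : Matrix (Fin d) (Fin d) ℝ, A = Bᵀ * B ∧ B.det ≠ 0 := by
  open scoped MatrixOrder Matrix.Norms.L2Operator in
  obtain ⟨B, hB⟩ := CStarAlgebra.nonneg_iff_eq_star_mul_self.mp hA.posSemidef.nonneg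
  have hB' : A = Bᵀ * B := by rw [hB, star_eq_conjTranspose, conjTranspose_eq_transpose_of_trivial]
  refine ⟨B, hB', fun h => ?_⟩
  have := hA.det_pos
  rw [hB', det_mul, h, mul_zero] at this
  exact lt_irrefl _ this

lemma measurableEmbedding_toEuclideanLin {d : ℕ} {B : Matrix (Fin d) (Fin d) ℝ} (hB : B.det ≠ 0) :
    MeasurableEmbedding (toEuclideanLin B : Euc d → Euc d) := by
  have hdet : LinearMap.det (toEuclideanLin B) ≠ 0 := by rwa [LinearMap.det_toLpLin]
  have := (LinearEquiv.ofIsUnitDet (f := toEuclideanLin B)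
    (v := PiLp.basisFun 2 ℝ (Fin d)) (v' := PiLp.basisFun 2 ℝ (Fin d))
    (by rw [LinearMap.det_toMatrix]; exact hdet.isUnit)).toContinuousLinearEquiv.toHomeomorph.measurableEmbedding
  exact this

lemma map_toEuclideanLin_volume {d : ℕ} {B : Matrix (Fin d) (Fin d) ℝ} (hB : B.det ≠ 0) :
    Measure.map (toEuclideanLin B : Euc d → Euc d) volume =
      ENNReal.ofReal |(B.det)⁻¹| • (volume : Measure (Euc d)) := by
  have hdet : LinearMap.det (toEuclideanLin B) ≠ 0 := by rwa [LinearMap.det_toLpLin]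
  have := Measure.map_linearMap_addHaar_eq_smul_addHaar (volume : Measure (Euc d)) hdet
  rwa [LinearMap.det_toLpLin] at this

/-- Linear change of variables. -/
lemma integral_comp_toEuclideanLin {d : ℕ} {F : Type*} [NormedAddCommGroup F] [NormedSpace ℝ F]
    {B : Matrix (Fin d) (Fin d) ℝ} (hB : B.det ≠ 0) (g : Euc d → F) :
    ∫ v, g (toEuclideanLin B v) = |B.det|⁻¹ • ∫ v, g v := by
  rw [← (measurableEmbedding_toEuclideanLin hB).integral_map, map_toEuclideanLin_volume hB,
    integral_smul_measure, ENNReal.toReal_ofReal (abs_nonneg _), abs_inv]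

lemma integrable_comp_toEuclideanLin {d : ℕ} {F : Type*} [NormedAddCommGroup F]
    {B : Matrix (Fin d) (Fin d) ℝ} (hB : B.det ≠ 0) {g : Euc d → F} (hg : Integrable g) :
    Integrable fun v => g (toEuclideanLin B v) := by
  have h : Integrable g (Measure.map (toEuclideanLin B : Euc d → Euc d) volume) := by
    rw [map_toEuclideanLin_volume hB]
    exact hg.smul_measure ENNReal.ofReal_ne_top
  exact (measurableEmbedding_toEuclideanLin hB).integrable_map_iff.1 h

lemma integral_exp_neg_half_sq : ∫ x : ℝ, Real.exp (-(1 / 2) * x ^ 2) = √(2 * Real.pi) := by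
  rw [integral_gaussian]; congr 1; ring

lemma gaussian_moments_one_dim :
    ∫ x : ℝ, x * Real.exp (-(1 / 2) * x ^ 2) = 0 ∧
    ∫ x : ℝ, x * x * Real.exp (-(1 / 2) * x ^ 2) = √(2 * Real.pi) := by
  have hpdf : ∀ x : ℝ, ProbabilityTheory.gaussianPDFReal 0 1 x =
      (√(2 * Real.pi))⁻¹ * Real.exp (-(1 / 2) * x ^ 2) := by
    intro x
    simp only [ProbabilityTheory.gaussianPDFReal, NNReal.coe_one, mul_one, sub_zero]
    congr 2; ring
  have hpos : √(2 * Real.pi) ≠ 0 := by positivity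
  constructor
  · have h := ProbabilityTheory.integral_id_gaussianReal (μ := 0) (v := 1)
    rw [ProbabilityTheory.integral_gaussianReal_eq_integral_smul one_ne_zero] at h
    simp only [hpdf, smul_eq_mul, mul_assoc, integral_const_mul] at h
    have h2 := (mul_eq_zero.1 h).resolve_left (inv_ne_zero hpos)
    rw [← h2]; congr 1; ext x; ring
  · have h := ProbabilityTheory.variance_fun_id_gaussianReal (μ := 0) (v := 1)
    rw [ProbabilityTheory.variance_eq_integral (by fun_prop)] at h
    simp only [ProbabilityTheory.integral_id_gaussianReal, sub_zero] at h
    rw [ProbabilityTheory.integral_gaussianReal_eq_integral_smul one_ne_zero] at h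
    simp only [hpdf, smul_eq_mul, mul_assoc, integral_const_mul, NNReal.coe_one] at h
    rw [inv_mul_eq_one₀ hpos] at h
    rw [h]; congr 1; ext x; ring

lemma integrable_exp_neg_half_sq_norm (d : ℕ) :
    Integrable fun v : Euc d => Real.exp (-(1 / 2) * ‖v‖ ^ 2) := by
  have := (GaussianFourier.integrable_cexp_neg_mul_sq_norm_add (V := Euc d)
    (b := ((1 / 2 : ℝ) : ℂ)) (by simp) 0 0).norm
  refine this.congr (Filter.Eventually.of_forall fun v => ?_)
  simp only [Complex.norm_exp]
  norm_num
  norm_cast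

lemma integral_exp_neg_half_sq_norm (d : ℕ) :
    ∫ v : Euc d, Real.exp (-(1 / 2) * ‖v‖ ^ 2) = (2 * Real.pi) ^ ((d : ℝ) / 2) := by
  rw [GaussianFourier.integral_rexp_neg_mul_sq_norm (by norm_num)]
  simp only [finrank_euclideanSpace, Fintype.card_fin]
  congr 1; ring

lemma integrable_mul_exp_neg_half_sq_norm {d : ℕ} (i j : Fin d) :
    Integrable fun v : Euc d => v i * v j * Real.exp (-(1 / 2) * ‖v‖ ^ 2) := by
  have hintegr := (GaussianFourier.integrable_cexp_neg_mul_sq_norm_add (V := Euc d)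
    (b := ((1 / 4 : ℝ) : ℂ)) (by simp) 0 0).norm
  refine Integrable.mono' (hintegr.const_mul 4) (by fun_prop)
    (Filter.Eventually.of_forall fun v => ?_)
  have h1 : ‖Complex.exp (-((1 / 4 : ℝ) : ℂ) * ‖v‖ ^ 2 + 0 * ((inner ℝ (0 : Euc d) v : ℝ) : ℂ))‖ =
      Real.exp (-(1 / 4) * ‖v‖ ^ 2) := by
    simp only [Complex.norm_exp]
    norm_num
    norm_cast
  rw [h1, norm_mul, norm_mul, Real.norm_of_nonneg (Real.exp_pos _).le]
  have h2 : ‖v i‖ * ‖v j‖ ≤ ‖v‖ ^ 2 := by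
    rw [sq]; gcongr <;> exact PiLp.norm_apply_le _ _
  have h3 : ‖v‖ ^ 2 ≤ 4 * Real.exp (1 / 4 * ‖v‖ ^ 2) := by
    linarith [Real.add_one_le_exp (1 / 4 * ‖v‖ ^ 2)]
  calc _ ≤ 4 * Real.exp (1 / 4 * ‖v‖ ^ 2) * Real.exp (-(1 / 2) * ‖v‖ ^ 2) := by
        exact mul_le_mul_of_nonneg_right (h2.trans h3) (Real.exp_pos _).le
    _ = _ := by rw [mul_assoc, ← Real.exp_add]; ring_nf

lemma integral_mul_exp_neg_half_sq_norm {d : ℕ} (i j : Fin d) :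
    ∫ v : Euc d, v i * v j * Real.exp (-(1 / 2) * ‖v‖ ^ 2) =
      if i = j then (2 * Real.pi) ^ ((d : ℝ) / 2) else 0 := by
  set F : Fin d → ℝ → ℝ := fun k x =>
    (if k = i then x else 1) * (if k = j then x else 1) * Real.exp (-(1 / 2) * x ^ 2) with hF
  have h1 : ∀ v : Fin d → ℝ, v i * v j *
      Real.exp (-(1 / 2) * ‖(WithLp.toLp 2 v : Euc d)‖ ^ 2) = ∏ k, F k (v k) := by
    intro v
    simp only [hF, Finset.prod_mul_distrib, Finset.prod_ite_eq', Finset.mem_univ, if_true,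
      EuclideanSpace.norm_sq_eq, Real.norm_eq_abs, sq_abs, Finset.mul_sum, Real.exp_sum]
  rw [← (PiLp.volume_preserving_toLp (Fin d)).integral_comp
    (MeasurableEquiv.toLp 2 _).measurableEmbedding]
  simp only [h1]
  rw [integral_fintype_prod_volume_eq_prod]
  split_ifs with hij
  · subst hij
    have h2 : ∀ k, ∫ x, F k x = √(2 * Real.pi) := by
      intro k
      by_cases hk : k = i
      · simp only [hF, hk, if_true]; exact gaussian_moments_one_dim.2
      · simp only [hF, hk, if_false, one_mul]; exact integral_exp_neg_half_sq
    simp only [h2, Finset.prod_const, Finset.card_univ, Fintype.card_fin]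
    rw [Real.sqrt_eq_rpow, ← Real.rpow_natCast, ← Real.rpow_mul (by positivity)]
    congr 1; ring
  · refine Finset.prod_eq_zero (Finset.mem_univ i) ?_
    simp only [hF, if_true, hij, if_false, mul_one]; exact gaussian_moments_one_dim.1

lemma integral_quadratic_mul_exp {d : ℕ} (M : Matrix (Fin d) (Fin d) ℝ) :
    Integrable (fun v : Euc d => (∑ i, ∑ j, M i j * (v i * v j)) *
      Real.exp (-(1 / 2) * ‖v‖ ^ 2)) ∧
    ∫ v : Euc d, (∑ i, ∑ j, M i j * (v i * v j)) * Real.exp (-(1 / 2) * ‖v‖ ^ 2) =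
      M.trace * (2 * Real.pi) ^ ((d : ℝ) / 2) := by
  have h1 : (fun v : Euc d => (∑ i, ∑ j, M i j * (v i * v j)) * Real.exp (-(1 / 2) * ‖v‖ ^ 2)) =
      fun v => ∑ i, ∑ j, M i j * (v i * v j * Real.exp (-(1 / 2) * ‖v‖ ^ 2)) := by
    ext v
    simp only [Finset.sum_mul, mul_assoc]
  have hintegr : ∀ i j, Integrable fun v : Euc d =>
      M i j * (v i * v j * Real.exp (-(1 / 2) * ‖v‖ ^ 2)) := fun i j =>
    (integrable_mul_exp_neg_half_sq_norm i j).const_mul _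
  rw [h1]
  constructor
  · exact integrable_finsetSum _ fun i _ => integrable_finsetSum _ fun j _ => hintegr i j
  · rw [integral_finsetSum _ fun i _ => integrable_finsetSum _ fun j _ => hintegr i j]
    simp only [integral_finsetSum _ fun j _ => hintegr _ j, integral_const_mul,
      integral_mul_exp_neg_half_sq_norm, Matrix.trace, Matrix.diag, Finset.sum_mul]
    refine Finset.sum_congr rfl fun i _ => ?_
    simp

lemma dotProduct_mulVec_transpose_mul_self {d : ℕ} (B : Matrix (Fin d) (Fin d) ℝ) (v : Euc d) :
    (fun k => v k) ⬝ᵥ (Bᵀ * B).mulVec (fun k => v k) = ‖toEuclideanLin B v‖ ^ 2 := by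
  rw [← mulVec_mulVec, dotProduct_mulVec, vecMul_transpose, EuclideanSpace.norm_sq_eq]
  simp only [dotProduct, toLpLin_apply, Real.norm_eq_abs, sq, abs_mul_abs_self]

lemma quadratic_eq_norm_sq {d : ℕ} (B : Matrix (Fin d) (Fin d) ℝ) (v : Euc d) :
    ∑ i, ∑ j, (Bᵀ * B) i j * (v i * v j) = ‖toEuclideanLin B v‖ ^ 2 := by
  rw [← dotProduct_mulVec_transpose_mul_self]
  simp only [dotProduct, mulVec, Finset.mul_sum]
  exact Finset.sum_congr rfl fun i _ => Finset.sum_congr rfl fun j _ => by ring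

/-- The closed form of the pointwise discrepancy of a Gaussian. -/
lemma iInf_alphaDiv_gaussian {d : ℕ} (y₀ : Euc d) {A : Matrix (Fin d) (Fin d) ℝ}
    (hA : A.PosDef) :
    ⨅ γ : Set.Ioi (0 : ℝ), alphaDiv 1 (gaussianDensity y₀ A) (fun y => (γ : ℝ) * similarity y₀ y) =
      1 / 2 * Real.log A.det + 1 / 2 * (A⁻¹).trace - (d : ℝ) / 2 := by
  obtain ⟨B, hAB, hB⟩ := exists_transpose_mul_self_of_posDef hA
  have hdetA := hA.det_pos
  have hdet : A.det = B.det ^ 2 := by rw [hAB, det_mul, det_transpose, sq]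
  have hsq : √A.det = |B.det| := by rw [hdet, Real.sqrt_sq_eq_abs]
  set S : ℝ := (2 * Real.pi) ^ ((d : ℝ) / 2) with hS
  have hS0 : 0 < S := by positivity
  set Z : ℝ := √A.det / S with hZ
  have hZ0 : 0 < Z := by positivity
  set T := toEuclideanLin B with hT
  have hp : ∀ v : Euc d, gaussianDensity 0 A v = Z * Real.exp (-(1 / 2) * ‖T v‖ ^ 2) := by
    intro v
    unfold gaussianDensity
    have := dotProduct_mulVec_transpose_mul_self B v
    rw [← hAB] at this
    simp only [PiLp.zero_apply, sub_zero, this, hT, hZ, hS]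
  have hBi : IsUnit B.det := hB.isUnit
  have hTinv : ∀ v : Euc d, toEuclideanLin B⁻¹ (T v) = v := by
    intro v
    ext k
    simp [hT, toLpLin_apply, mulVec_mulVec, nonsing_inv_mul _ hBi]
  have hpush : ∀ g : Euc d → ℝ, ∫ v, g (T v) = |B.det|⁻¹ * ∫ v, g v := fun g => by
    rw [hT, integral_comp_toEuclideanLin hB, smul_eq_mul]
  have hZB : Z * |B.det|⁻¹ = S⁻¹ := by
    rw [hZ, hsq]; have := abs_ne_zero.2 hB; field_simp
  have hi0 : Integrable fun v : Euc d => Real.exp (-(1 / 2) * ‖T v‖ ^ 2) :=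
    integrable_comp_toEuclideanLin hB (integrable_exp_neg_half_sq_norm d)
  have hv0 : ∫ v : Euc d, Z * Real.exp (-(1 / 2) * ‖T v‖ ^ 2) = 1 := by
    rw [integral_const_mul, hpush (fun v => Real.exp (-(1 / 2) * ‖v‖ ^ 2)),
      integral_exp_neg_half_sq_norm, ← mul_assoc, hZB, inv_mul_cancel₀ hS0.ne']
  have hone : ∀ v : Euc d, ∑ i, ∑ j, (1 : Matrix (Fin d) (Fin d) ℝ) i j * (v i * v j) =
      ‖v‖ ^ 2 := by
    intro v
    have := quadratic_eq_norm_sq (1 : Matrix (Fin d) (Fin d) ℝ) v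
    simpa [toLpLin_apply] using this
  -- After the substitution `v ↦ T v`, the identity matrix gives the second moment `d` of `‖T v‖`,
  -- and below `(B⁻¹)ᵀ B⁻¹` gives the second moment `tr A⁻¹` of `‖v‖`.
  obtain ⟨hi1, hv1⟩ := integral_quadratic_mul_exp (1 : Matrix (Fin d) (Fin d) ℝ)
  simp only [hone, trace_one, Fintype.card_fin] at hi1 hv1
  have hi1' : Integrable fun v : Euc d => ‖T v‖ ^ 2 * Real.exp (-(1 / 2) * ‖T v‖ ^ 2) :=
    integrable_comp_toEuclideanLin hB hi1
  have hv1' : ∫ v : Euc d, Z * (‖T v‖ ^ 2 * Real.exp (-(1 / 2) * ‖T v‖ ^ 2)) = d := by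
    rw [integral_const_mul, hpush (fun v => ‖v‖ ^ 2 * Real.exp (-(1 / 2) * ‖v‖ ^ 2)), hv1,
      ← hS, ← mul_assoc, hZB]
    field_simp
  have htr : ((B⁻¹)ᵀ * B⁻¹).trace = (A⁻¹).trace := by
    rw [hAB, Matrix.mul_inv_rev, trace_mul_comm, transpose_nonsing_inv]
  obtain ⟨hi2, hv2⟩ := integral_quadratic_mul_exp ((B⁻¹)ᵀ * B⁻¹)
  simp only [quadratic_eq_norm_sq, htr] at hi2 hv2
  have hi2' : Integrable fun v : Euc d => ‖v‖ ^ 2 * Real.exp (-(1 / 2) * ‖T v‖ ^ 2) := by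
    have := integrable_comp_toEuclideanLin hB hi2
    simpa only [← hT, hTinv] using this
  have hv2' : ∫ v : Euc d, Z * (‖v‖ ^ 2 * Real.exp (-(1 / 2) * ‖T v‖ ^ 2)) = (A⁻¹).trace := by
    have := hpush (fun v => ‖toEuclideanLin B⁻¹ v‖ ^ 2 * Real.exp (-(1 / 2) * ‖v‖ ^ 2))
    simp only [hTinv] at this
    rw [integral_const_mul, this, hv2, ← hS, ← mul_assoc, hZB]
    field_simp
  have hval : ∀ γ : ℝ, 0 < γ →
      alphaDiv 1 (gaussianDensity y₀ A) (fun y => γ * similarity y₀ y) =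
        (Real.log Z - Real.log γ - 1) - 1 / 2 * d + 1 / 2 * (A⁻¹).trace + γ * S := by
    intro γ hγ
    have hshift : alphaDiv 1 (gaussianDensity y₀ A) (fun y => γ * similarity y₀ y) =
        alphaDiv 1 (gaussianDensity 0 A) (fun y => γ * similarity 0 y) := by
      simp only [alphaDiv, if_true]
      rw [← integral_add_right_eq_self _ y₀]
      congr 1; ext v
      simp [gaussianDensity, similarity]
    rw [hshift]
    simp only [alphaDiv, if_true]
    have hpt : ∀ v : Euc d, gaussianDensity 0 A v *
        Real.log (gaussianDensity 0 A v / (γ * similarity 0 v)) - gaussianDensity 0 A v +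
          γ * similarity 0 v =
        (Real.log Z - Real.log γ - 1) * (Z * Real.exp (-(1 / 2) * ‖T v‖ ^ 2))
        - 1 / 2 * (Z * (‖T v‖ ^ 2 * Real.exp (-(1 / 2) * ‖T v‖ ^ 2)))
        + 1 / 2 * (Z * (‖v‖ ^ 2 * Real.exp (-(1 / 2) * ‖T v‖ ^ 2)))
        + γ * Real.exp (-(1 / 2) * ‖v‖ ^ 2) := by
      intro v
      rw [hp]
      unfold similarity
      rw [Real.log_div (by positivity) (by positivity), Real.log_mul hZ0.ne' (Real.exp_pos _).ne',
        Real.log_mul hγ.ne' (Real.exp_pos _).ne', Real.log_exp, Real.log_exp, sub_zero]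
      ring
    simp only [hpt]
    have i0 := (hi0.const_mul Z).const_mul (Real.log Z - Real.log γ - 1)
    have i1 := (hi1'.const_mul Z).const_mul (1 / 2)
    have i2 := (hi2'.const_mul Z).const_mul (1 / 2)
    have i3 := (integrable_exp_neg_half_sq_norm d).const_mul γ
    have i01 : Integrable fun v : Euc d =>
        (Real.log Z - Real.log γ - 1) * (Z * Real.exp (-(1 / 2) * ‖T v‖ ^ 2))
        - 1 / 2 * (Z * (‖T v‖ ^ 2 * Real.exp (-(1 / 2) * ‖T v‖ ^ 2))) := i0.sub i1
    have i012 : Integrable fun v : Euc d =>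
        (Real.log Z - Real.log γ - 1) * (Z * Real.exp (-(1 / 2) * ‖T v‖ ^ 2))
        - 1 / 2 * (Z * (‖T v‖ ^ 2 * Real.exp (-(1 / 2) * ‖T v‖ ^ 2)))
        + 1 / 2 * (Z * (‖v‖ ^ 2 * Real.exp (-(1 / 2) * ‖T v‖ ^ 2))) := i01.add i2
    rw [integral_add i012 i3, integral_add i01 i2, integral_sub i0 i1,
      integral_const_mul, hv0, integral_const_mul (1 / 2 : ℝ), hv1', integral_const_mul (1 / 2 : ℝ),
      hv2', integral_const_mul, integral_exp_neg_half_sq_norm]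
    ring
  have hlogZ : Real.log Z = 1 / 2 * Real.log A.det - Real.log S := by
    rw [hZ, Real.log_div (by positivity) hS0.ne', Real.log_sqrt hdetA.le]; ring
  -- The dependence on `γ` is `γ S - log γ`, and `log x ≤ x - 1` at `x = γ S` gives the minimum. It
  -- is attained at `γ = S⁻¹`, where `γ s` is the standard Gaussian density.
  have hlb : ∀ γ : Set.Ioi (0 : ℝ), 1 / 2 * Real.log A.det + 1 / 2 * (A⁻¹).trace - (d : ℝ) / 2 ≤
      alphaDiv 1 (gaussianDensity y₀ A) (fun y => (γ : ℝ) * similarity y₀ y) := by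
    rintro ⟨γ, hγ⟩
    have hγ' : 0 < γ := hγ
    rw [hval γ hγ', hlogZ]
    have := Real.log_le_sub_one_of_pos (mul_pos hγ' hS0)
    rw [Real.log_mul hγ'.ne' hS0.ne'] at this
    linarith
  refine le_antisymm ?_ (le_ciInf hlb)
  refine (ciInf_le ⟨_, by rintro _ ⟨γ, rfl⟩; exact hlb γ⟩
    (⟨S⁻¹, by simpa using hS0⟩ : Set.Ioi (0 : ℝ))).trans (le_of_eq ?_)
  rw [hval _ (by simpa using hS0), hlogZ, Real.log_inv, inv_mul_cancel₀ hS0.ne']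
  ring

lemma jacobian_toEuclideanLin {d D : ℕ} (f : Euc d → Euc D) (y : Euc d) (v : Euc d) :
    toEuclideanLin (jacobian f y) v = fderiv ℝ f y v := by
  have : toEuclideanLin (jacobian f y) = (fderiv ℝ f y : Euc d →ₗ[ℝ] Euc D) := by
    refine (EuclideanSpace.basisFun (Fin d) ℝ).toBasis.ext fun b => ?_
    ext a
    simp [toLpLin_apply, jacobian]
  rw [this]; rfl

lemma jacobian_mulVec_injective {d D : ℕ} {f : Euc d → Euc D} {y : Euc d}
    (hf : Function.Injective (fderiv ℝ f y)) : Function.Injective (jacobian f y).mulVec := by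
  intro u v huv
  have : fderiv ℝ f y (WithLp.toLp 2 u) = fderiv ℝ f y (WithLp.toLp 2 v) := by
    rw [← jacobian_toEuclideanLin, ← jacobian_toEuclideanLin, toLpLin_apply, toLpLin_apply, huv]
  simpa using hf this

lemma pointDiscrepancy_one_eq {d D : ℕ} {f : Euc d → Euc D} {y₀ : Euc d}
    (hf : Function.Injective (fderiv ℝ f y₀)) {M : Euc D → Matrix (Fin D) (Fin D) ℝ}
    (hM : (M (f y₀)).PosDef) :
    pointDiscrepancy 1 M f y₀ =
      1 / 2 * Real.log (pullback M f y₀).det + 1 / 2 * ((pullback M f y₀)⁻¹).trace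
        - (d : ℝ) / 2 := by
  refine iInf_alphaDiv_gaussian y₀ ?_
  have := hM.conjTranspose_mul_mul_same (B := jacobian f y₀) (jacobian_mulVec_injective hf)
  rwa [conjTranspose_eq_transpose_of_trivial] at this

end NeighbourEmbedding
end

noncomputable section
namespace NeighbourEmbedding
open MeasureTheory Matrix Filter Topology Metric

/-! ### Geometry of an embedding of a ball -/

lemma measurable_indicator_of_continuousOn {X F : Type*} [TopologicalSpace X] [MeasurableSpace X]
    [OpensMeasurableSpace X] [NormedAddCommGroup F] [MeasurableSpace F] [BorelSpace F]
    {g : X → F} {s : Set X} (hg : ContinuousOn g s) (hs : MeasurableSet s) :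
    Measurable (s.indicator g) := by
  classical
  have := hg.measurable_piecewise (continuousOn_const (c := (0 : F)) (s := sᶜ)) hs
  rwa [← Set.piecewise_eq_indicator]

/-- A squared-distance-like kernel on a ball: comparable to the squared Euclidean distance, growing
along rays, and asymptotic at interior points to a quadratic form of unit determinant. -/
structure MetricKernel {d : ℕ} (c : Euc d) (R : ℝ) where
  toFun : Euc d → Euc d → ℝ
  measurable : Measurable fun p : Euc d × Euc d => toFun p.1 p.2
  lo : ℝ
  hi : ℝ
  rad : ℝ
  lo_pos : 0 < lo
  hi_pos : 0 < hi
  rad_pos : 0 < rad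
  lower : ∀ y₀ ∈ closedBall c R, ∀ y ∈ closedBall c R, lo * ‖y - y₀‖ ^ 2 ≤ toFun y₀ y
  upper : ∀ y₀ ∈ closedBall c R, ∀ y ∈ closedBall c R, toFun y₀ y ≤ hi * ‖y - y₀‖ ^ 2
  radial : ∀ y₀ ∈ closedBall c R, ∀ y ∈ closedBall c R, ‖y - y₀‖ ≤ rad →
    ∀ s : ℝ, 0 < s → s ≤ 1 → toFun y₀ (y₀ + s • (y - y₀)) ≤ s * toFun y₀ y
  tangent : ∀ y₀ ∈ ball c R, ∃ B : Matrix (Fin d) (Fin d) ℝ, |B.det| = 1 ∧ ∀ z : Euc d,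
    Tendsto (fun t : ℝ => (t ^ 2)⁻¹ * toFun y₀ (y₀ + t • z)) (𝓝[>] 0)
      (𝓝 (‖toEuclideanLin B z‖ ^ 2 / 2))

/-- The kernel `‖y - y₀‖² / 2`. -/
def euclideanKernel {d : ℕ} (c : Euc d) (R : ℝ) : MetricKernel c R where
  toFun y₀ y := ‖y - y₀‖ ^ 2 / 2
  measurable := by fun_prop
  lo := 1 / 2
  hi := 1 / 2
  rad := 1
  lo_pos := by norm_num
  hi_pos := by norm_num
  rad_pos := by norm_num
  lower _ _ _ _ := le_of_eq (by ring)
  upper _ _ _ _ := le_of_eq (by ring)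
  radial y₀ _ y _ _ s hs hs1 := by
    rw [add_sub_cancel_left, norm_smul, Real.norm_of_nonneg hs.le, mul_pow]
    nlinarith [sq_nonneg ‖y - y₀‖, mul_nonneg hs.le (sub_nonneg.2 hs1)]
  tangent y₀ _ := by
    refine ⟨1, by simp, fun z => ?_⟩
    refine tendsto_const_nhds.congr' ?_
    filter_upwards [self_mem_nhdsWithin] with t ht
    have ht : 0 < t := ht
    simp only [add_sub_cancel_left, norm_smul, mul_pow, Real.norm_eq_abs, sq_abs, toLpLin_apply,
      one_mulVec, WithLp.toLp_ofLp]
    field_simp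

/-! ### First-order estimates for an embedding of a ball. -/

section Embedding

variable {d D : ℕ} {f : Euc d → Euc D} {V : Set (Euc d)} {c : Euc d} {R : ℝ}

lemma continuousOn_fderiv_closedBall (hV : IsOpen V) (hK : closedBall c R ⊆ V)
    (hf : ContDiffOn ℝ (⊤ : ℕ∞) f V) : ContinuousOn (fderiv ℝ f) (closedBall c R) :=
  (hf.continuousOn_fderiv_of_isOpen hV (by exact_mod_cast le_top)).mono hK

lemma hasFDerivAt_of_mem_closedBall (hV : IsOpen V) (hK : closedBall c R ⊆ V)
    (hf : ContDiffOn ℝ (⊤ : ℕ∞) f V) {y : Euc d} (hy : y ∈ closedBall c R) :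
    HasFDerivAt f (fderiv ℝ f y) y :=
  ((hf.contDiffAt (hV.mem_nhds (hK hy))).differentiableAt (by simp)).hasFDerivAt

/-- Uniform first-order approximation on the ball. -/
lemma exists_uniform_linearization (hV : IsOpen V) (hK : closedBall c R ⊆ V)
    (hf : ContDiffOn ℝ (⊤ : ℕ∞) f V) {η : ℝ} (hη : 0 < η) :
    ∃ δ > 0, ∀ y₀ ∈ closedBall c R, ∀ y ∈ closedBall c R, ∀ y' ∈ closedBall c R,
      ‖y - y₀‖ ≤ δ → ‖y' - y₀‖ ≤ δ →
        ‖f y - f y' - fderiv ℝ f y₀ (y - y')‖ ≤ η * ‖y - y'‖ := by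
  have huc := (isCompact_closedBall c R).uniformContinuousOn_of_continuous
    (continuousOn_fderiv_closedBall hV hK hf)
  rw [Metric.uniformContinuousOn_iff] at huc
  obtain ⟨δ, hδ, h⟩ := huc η hη
  refine ⟨δ / 2, by positivity, fun y₀ hy₀ y hy y' hy' h1 h2 => ?_⟩
  have hconv : Convex ℝ (closedBall c R ∩ closedBall y₀ (δ / 2)) :=
    (convex_closedBall _ _).inter (convex_closedBall _ _)
  refine hconv.norm_image_sub_le_of_norm_hasFDerivWithin_le' (f' := fderiv ℝ f)
    (fun x hx => (hasFDerivAt_of_mem_closedBall hV hK hf hx.1).hasFDerivWithinAt)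
    (fun x hx => ?_) ⟨hy', by simpa [dist_eq_norm] using h2⟩ ⟨hy, by simpa [dist_eq_norm] using h1⟩
  have h3 : dist x y₀ < δ := lt_of_le_of_lt hx.2 (by linarith)
  have := h x hx.1 y₀ hy₀ h3
  rw [dist_eq_norm] at this
  exact this.le

lemma exists_fderiv_lower_bound (hV : IsOpen V) (hK : closedBall c R ⊆ V)
    (hf : ContDiffOn ℝ (⊤ : ℕ∞) f V)
    (himm : ∀ y ∈ closedBall c R, Function.Injective (fderiv ℝ f y)) :
    ∃ m > 0, ∀ y ∈ closedBall c R, ∀ v, m * ‖v‖ ≤ ‖fderiv ℝ f y v‖ := by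
  have hcomp : IsCompact (closedBall c R ×ˢ sphere (0 : Euc d) 1) :=
    (isCompact_closedBall c R).prod (isCompact_sphere _ _)
  have hcont : ContinuousOn (fun p : Euc d × Euc d => ‖fderiv ℝ f p.1 p.2‖)
      (closedBall c R ×ˢ sphere (0 : Euc d) 1) := by
    refine ContinuousOn.norm (ContinuousOn.clm_apply ?_ continuousOn_snd)
    exact (continuousOn_fderiv_closedBall hV hK hf).comp continuousOn_fst fun p hp => hp.1
  obtain ⟨m, hm, h⟩ := hcomp.exists_forall_le' hcont (a := 0) fun p hp => by
    rw [norm_pos_iff]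
    intro h0
    have : p.2 = 0 := himm p.1 hp.1 (by rw [h0, map_zero])
    have h1 := hp.2
    rw [this] at h1
    simp at h1
  refine ⟨m, hm, fun y hy v => ?_⟩
  rcases eq_or_ne v 0 with rfl | hv
  · simp
  have hv' := norm_pos_iff.2 hv
  have := h (y, ‖v‖⁻¹ • v) ⟨hy, by simp [norm_smul, hv'.ne']⟩
  simp only [map_smul, norm_smul, norm_inv, norm_norm] at this
  rwa [inv_mul_eq_div, le_div_iff₀ hv'] at this

/-- Pairs at distance at most `δ` are handled by linearisation, with an error of half the lower
bound of the derivative; pairs further apart form a compact set on which injectivity keeps `‖f y - f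
y'‖` away from zero. -/
lemma exists_antilipschitz (hV : IsOpen V) (hK : closedBall c R ⊆ V)
    (hf : ContDiffOn ℝ (⊤ : ℕ∞) f V) (hinj : Set.InjOn f (closedBall c R))
    (himm : ∀ y ∈ closedBall c R, Function.Injective (fderiv ℝ f y)) :
    ∃ l > 0, ∀ y ∈ closedBall c R, ∀ y' ∈ closedBall c R, l * ‖y - y'‖ ≤ ‖f y - f y'‖ := by
  obtain ⟨m, hm, hm'⟩ := exists_fderiv_lower_bound hV hK hf himm
  obtain ⟨δ, hδ, hlin⟩ := exists_uniform_linearization hV hK hf (half_pos hm)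
  have hcomp : IsCompact ((closedBall c R ×ˢ closedBall c R) ∩
      {p : Euc d × Euc d | δ ≤ ‖p.1 - p.2‖}) :=
    ((isCompact_closedBall c R).prod (isCompact_closedBall c R)).inter_right
      (isClosed_le continuous_const (by fun_prop))
  have hfc : ContinuousOn f (closedBall c R) := hf.continuousOn.mono hK
  have hcont : ContinuousOn (fun p : Euc d × Euc d => ‖f p.1 - f p.2‖)
      ((closedBall c R ×ˢ closedBall c R) ∩ {p : Euc d × Euc d | δ ≤ ‖p.1 - p.2‖}) :=
    ((hfc.comp continuousOn_fst fun p hp => hp.1.1).sub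
      (hfc.comp continuousOn_snd fun p hp => hp.1.2)).norm
  obtain ⟨a, ha, h⟩ := hcomp.exists_forall_le' hcont (a := 0) fun p hp => by
    rw [norm_pos_iff, sub_ne_zero]
    intro h0
    have : p.1 = p.2 := hinj hp.1.1 hp.1.2 h0
    have h1 : δ ≤ ‖p.1 - p.2‖ := hp.2
    rw [this, sub_self, norm_zero] at h1
    linarith
  refine ⟨min (m / 2) (a / (2 * |R| + 1)), by positivity, fun y hy y' hy' => ?_⟩
  rcases le_total ‖y - y'‖ δ with hle | hge
  · have h1 := hlin y' hy' y hy y' hy' hle (by simp [hδ.le])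
    have h2 := hm' y' hy' (y - y')
    have h3 := norm_sub_norm_le (fderiv ℝ f y' (y - y')) (f y - f y')
    rw [norm_sub_rev (fderiv ℝ f y' (y - y'))] at h3
    calc _ ≤ m / 2 * ‖y - y'‖ := by gcongr; exact min_le_left _ _
      _ ≤ _ := by linarith
  · have h1 := h (y, y') ⟨⟨hy, hy'⟩, hge⟩
    have h2 : ‖y - y'‖ ≤ 2 * |R| + 1 := by
      have h4 := dist_triangle_right y y' c
      rw [dist_eq_norm] at h4
      have := mem_closedBall.1 hy
      have := mem_closedBall.1 hy'
      linarith [le_abs_self R]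
    calc _ ≤ a / (2 * |R| + 1) * (2 * |R| + 1) := by gcongr; exact min_le_right _ _
      _ = a := by field_simp
      _ ≤ _ := h1

lemma exists_lipschitz (hV : IsOpen V) (hK : closedBall c R ⊆ V)
    (hf : ContDiffOn ℝ (⊤ : ℕ∞) f V) :
    ∃ L > 0, ∀ y ∈ closedBall c R, ∀ y' ∈ closedBall c R, ‖f y - f y'‖ ≤ L * ‖y - y'‖ := by
  obtain ⟨L, hL⟩ := (isCompact_closedBall c R).exists_bound_of_continuousOn
    (continuousOn_fderiv_closedBall hV hK hf)
  refine ⟨max L 1, by positivity, fun y hy y' hy' => ?_⟩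
  exact (convex_closedBall c R).norm_image_sub_le_of_norm_hasFDerivWithin_le
    (fun x hx => (hasFDerivAt_of_mem_closedBall hV hK hf hx).hasFDerivWithinAt)
    (fun x hx => (hL x hx).trans (le_max_left _ _)) hy' hy

/-- Near a point, the squared distance of the images grows along rays. -/
lemma exists_radial_growth (hV : IsOpen V) (hK : closedBall c R ⊆ V)
    (hf : ContDiffOn ℝ (⊤ : ℕ∞) f V) (hinj : Set.InjOn f (closedBall c R))
    (himm : ∀ y ∈ closedBall c R, Function.Injective (fderiv ℝ f y)) :
    ∃ δ > 0, ∀ y₀ ∈ closedBall c R, ∀ y ∈ closedBall c R, ‖y - y₀‖ ≤ δ →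
      ∀ s : ℝ, 0 < s → s ≤ 1 →
        ‖f (y₀ + s • (y - y₀)) - f y₀‖ ^ 2 ≤ s * ‖f y - f y₀‖ ^ 2 := by
  obtain ⟨l, hl, hanti⟩ := exists_antilipschitz hV hK hf hinj himm
  obtain ⟨δ, hδ, hlin⟩ := exists_uniform_linearization hV hK hf (show 0 < l / 4 by positivity)
  refine ⟨δ, hδ, fun y₀ hy₀ y hy hyy s hs hs1 => ?_⟩
  set z := y - y₀ with hz
  set y' := y₀ + s • z with hy'
  have hy'K : y' ∈ closedBall c R := by
    have := (convex_closedBall c R) hy₀ hy (sub_nonneg.2 hs1) hs.le (by ring)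
    convert this using 1
    rw [hy', hz]; module
  have hn : ‖y' - y₀‖ = s * ‖z‖ := by
    rw [hy', add_sub_cancel_left, norm_smul, Real.norm_of_nonneg hs.le]
  have hle : ‖y' - y₀‖ ≤ δ := by
    rw [hn]; nlinarith [norm_nonneg z]
  set A := fderiv ℝ f y₀ z
  have h1 : ‖f y - f y' - (1 - s) • A‖ ≤ l / 4 * ((1 - s) * ‖z‖) := by
    have := hlin y₀ hy₀ y hy y' hy'K hyy hle
    have hd : y - y' = (1 - s) • z := by rw [hy', hz]; module
    rwa [hd, map_smul, norm_smul, Real.norm_of_nonneg (sub_nonneg.2 hs1)] at this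
  have h2 : ‖f y' - f y₀ - s • A‖ ≤ l / 4 * (s * ‖z‖) := by
    have := hlin y₀ hy₀ y' hy'K y₀ hy₀ hle (by simp [hδ.le])
    have hd : y' - y₀ = s • z := by rw [hy']; module
    rwa [hd, map_smul, norm_smul, Real.norm_of_nonneg hs.le] at this
  have h3 : l * (s * ‖z‖) ≤ ‖f y' - f y₀‖ := by
    rw [← hn]; exact hanti _ hy'K _ hy₀
  set a := ‖f y' - f y₀‖
  set b := ‖f y - f y₀‖
  -- The two linearisation errors enter with weights `s` and `1 - s`, so together they are at most
  -- `(l / 2) s (1 - s) ‖z‖ ≤ (1 - s) a / 2` by the lower Lipschitz bound. Absorbing this gives `a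
  -- (1 + s) / 2 ≤ s b`.
  have h4 : a ≤ s * b + s * (l / 4 * ((1 - s) * ‖z‖)) + (1 - s) * (l / 4 * (s * ‖z‖)) := by
    have hid : f y' - f y₀ = s • (f y - f y₀) - s • (f y - f y' - (1 - s) • A)
        + (1 - s) • (f y' - f y₀ - s • A) := by module
    calc a ≤ ‖s • (f y - f y₀) - s • (f y - f y' - (1 - s) • A)‖
          + ‖(1 - s) • (f y' - f y₀ - s • A)‖ := by
            change ‖f y' - f y₀‖ ≤ _
            conv_lhs => rw [hid]
            exact norm_add_le _ _
      _ ≤ ‖s • (f y - f y₀)‖ + ‖s • (f y - f y' - (1 - s) • A)‖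
          + ‖(1 - s) • (f y' - f y₀ - s • A)‖ := by gcongr; exact norm_sub_le _ _
      _ ≤ _ := by
        rw [norm_smul, norm_smul, norm_smul, Real.norm_of_nonneg hs.le,
          Real.norm_of_nonneg (sub_nonneg.2 hs1)]
        have := sub_nonneg.2 hs1
        gcongr
  have h5 : a * ((1 + s) / 2) ≤ s * b := by nlinarith
  have ha : 0 ≤ a := norm_nonneg _
  have hb : 0 ≤ b := norm_nonneg _
  have h6 : (a * ((1 + s) / 2)) ^ 2 ≤ (s * b) ^ 2 := by gcongr
  -- This is `s ≤ ((1 + s) / 2) ^ 2`; it trades the exact quadratic growth for the weaker linear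
  -- factor `s`, which survives the linearisation error.
  have h7 : s * a ^ 2 ≤ (a * ((1 + s) / 2)) ^ 2 := by nlinarith [sq_nonneg (a * (1 - s))]
  have h8 : s * a ^ 2 ≤ s * (s * b ^ 2) := by nlinarith
  exact le_of_mul_le_mul_left h8 hs

/-! ### The kernel of an embedding, normalised to unit determinant. -/

/-- The Gram determinant of the Jacobian. -/
def gramDet (f : Euc d → Euc D) (y : Euc d) : ℝ :=
  ((jacobian f y)ᵀ * jacobian f y).det

lemma gram_posDef {y : Euc d} (himm : Function.Injective (fderiv ℝ f y)) :
    ((jacobian f y)ᵀ * jacobian f y).PosDef := by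
  have := Matrix.PosDef.conjTranspose_mul_self (jacobian f y) (jacobian_mulVec_injective himm)
  rwa [conjTranspose_eq_transpose_of_trivial] at this

lemma continuousOn_jacobian (hV : IsOpen V) (hK : closedBall c R ⊆ V)
    (hf : ContDiffOn ℝ (⊤ : ℕ∞) f V) : ContinuousOn (jacobian f) (closedBall c R) := by
  refine continuousOn_pi.2 fun a => continuousOn_pi.2 fun b => ?_
  have h := continuousOn_fderiv_closedBall hV hK hf
  have h2 : ContinuousOn (fun y => fderiv ℝ f y (EuclideanSpace.single b 1)) (closedBall c R) :=
    h.clm_apply continuousOn_const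
  exact (PiLp.continuous_apply 2 (fun _ : Fin D => ℝ) a).comp_continuousOn h2

lemma continuousOn_gram (hV : IsOpen V) (hK : closedBall c R ⊆ V)
    (hf : ContDiffOn ℝ (⊤ : ℕ∞) f V) :
    ContinuousOn (fun y => (jacobian f y)ᵀ * jacobian f y) (closedBall c R) := by
  have hJ := continuousOn_jacobian hV hK hf
  have hc : Continuous fun A : Matrix (Fin D) (Fin d) ℝ => Aᵀ * A := by fun_prop
  exact hc.comp_continuousOn hJ

lemma continuousOn_gramDet (hV : IsOpen V) (hK : closedBall c R ⊆ V)
    (hf : ContDiffOn ℝ (⊤ : ℕ∞) f V) : ContinuousOn (gramDet f) (closedBall c R) :=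
  continuous_id.matrix_det.comp_continuousOn (continuousOn_gram hV hK hf)

lemma norm_fderiv_sq {y : Euc d} {B : Matrix (Fin d) (Fin d) ℝ}
    (hB : (jacobian f y)ᵀ * jacobian f y = Bᵀ * B) (z : Euc d) :
    ‖fderiv ℝ f y z‖ ^ 2 = ‖toEuclideanLin B z‖ ^ 2 := by
  rw [← jacobian_toEuclideanLin, ← dotProduct_mulVec_transpose_mul_self B, ← hB, ← mulVec_mulVec,
    dotProduct_mulVec, vecMul_transpose, EuclideanSpace.norm_sq_eq]
  simp only [dotProduct, toLpLin_apply, Real.norm_eq_abs, sq, abs_mul_abs_self]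

/-- The normalising factor `det(JᵀJ)^(-1/d)`. -/
def conformalFactor (f : Euc d → Euc D) (y : Euc d) : ℝ := gramDet f y ^ (-(1 / (d : ℝ)))

lemma conformalFactor_pos {y : Euc d} (himm : Function.Injective (fderiv ℝ f y)) :
    0 < conformalFactor f y := Real.rpow_pos_of_pos (gram_posDef himm).det_pos _

lemma continuousOn_conformalFactor (hV : IsOpen V) (hK : closedBall c R ⊆ V)
    (hf : ContDiffOn ℝ (⊤ : ℕ∞) f V)
    (himm : ∀ y ∈ closedBall c R, Function.Injective (fderiv ℝ f y)) :
    ContinuousOn (conformalFactor f) (closedBall c R) :=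
  (continuousOn_gramDet hV hK hf).rpow_const fun y hy => Or.inl (gram_posDef (himm y hy)).det_pos.ne'

/-- The kernel `det(JᵀJ)^(-1/d) ‖f y - f y₀‖² / 2` of an embedding. -/
lemma exists_embeddingKernel (hd : 0 < d) (hV : IsOpen V)
    (hK : closedBall c R ⊆ V) (hf : ContDiffOn ℝ (⊤ : ℕ∞) f V)
    (hinj : Set.InjOn f (closedBall c R))
    (himm : ∀ y ∈ closedBall c R, Function.Injective (fderiv ℝ f y)) :
    ∃ κ : MetricKernel c R, ∀ y₀ ∈ closedBall c R, ∀ y ∈ closedBall c R,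
      κ.toFun y₀ y = conformalFactor f y₀ * (‖f y₀ - f y‖ ^ 2 / 2) := by
  obtain ⟨l, hl, hanti⟩ := exists_antilipschitz hV hK hf hinj himm
  obtain ⟨L, hL, hlip⟩ := exists_lipschitz hV hK hf
  obtain ⟨δ, hδ, hrad⟩ := exists_radial_growth hV hK hf hinj himm
  have hτc := continuousOn_conformalFactor hV hK hf himm
  obtain ⟨a, ha, hτlo⟩ := (isCompact_closedBall c R).exists_forall_le' hτc
    (a := 0) fun y hy => conformalFactor_pos (himm y hy)
  obtain ⟨b, hτhi⟩ := (isCompact_closedBall c R).exists_bound_of_continuousOn hτc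
  have hτhi' : ∀ y ∈ closedBall c R, conformalFactor f y ≤ max b 1 := fun y hy =>
    (le_abs_self _).trans ((hτhi y hy).trans (le_max_left _ _))
  have hmeas : MeasurableSet (closedBall c R) := isClosed_closedBall.measurableSet
  -- Extension by zero makes the kernel measurable on the whole space, although `f` is controlled
  -- only near the ball.
  set g : Euc d → Euc D := (closedBall c R).indicator f with hg
  set τ : Euc d → ℝ := (closedBall c R).indicator (conformalFactor f) with hτ
  have hgm : Measurable g := by
    exact measurable_indicator_of_continuousOn (hf.continuousOn.mono hK) hmeas
  have hτm : Measurable τ := by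
    exact measurable_indicator_of_continuousOn hτc hmeas
  have hval : ∀ y₀ ∈ closedBall c R, ∀ y ∈ closedBall c R,
      τ y₀ * (‖g y₀ - g y‖ ^ 2 / 2) = conformalFactor f y₀ * (‖f y₀ - f y‖ ^ 2 / 2) := by
    intro y₀ h0 y hy
    simp only [hg, hτ, Set.indicator_of_mem h0, Set.indicator_of_mem hy]
  refine ⟨{
    toFun := fun y₀ y => τ y₀ * (‖g y₀ - g y‖ ^ 2 / 2)
    measurable := by fun_prop
    lo := a * (l ^ 2 / 2)
    hi := max b 1 * (L ^ 2 / 2)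
    rad := δ
    lo_pos := by positivity
    hi_pos := by positivity
    rad_pos := hδ
    lower := ?_
    upper := ?_
    radial := ?_
    tangent := ?_ }, hval⟩
  · intro y₀ h0 y hy
    rw [hval y₀ h0 y hy, norm_sub_rev (f y₀)]
    have h1 := hanti y hy y₀ h0
    have h2 : (l * ‖y - y₀‖) ^ 2 ≤ ‖f y - f y₀‖ ^ 2 := by gcongr
    have h3 := hτlo y₀ h0
    have h4 := ha.trans_le h3
    calc a * (l ^ 2 / 2) * ‖y - y₀‖ ^ 2 = a * ((l * ‖y - y₀‖) ^ 2 / 2) := by ring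
      _ ≤ _ := by gcongr
  · intro y₀ h0 y hy
    rw [hval y₀ h0 y hy, norm_sub_rev (f y₀)]
    have h1 := hlip y hy y₀ h0
    have h2 : ‖f y - f y₀‖ ^ 2 ≤ (L * ‖y - y₀‖) ^ 2 := by gcongr
    have h3 := hτhi' y₀ h0
    have h4 := conformalFactor_pos (himm y₀ h0)
    calc _ ≤ max b 1 * ((L * ‖y - y₀‖) ^ 2 / 2) := by gcongr
      _ = _ := by ring
  · intro y₀ h0 y hy hyy s hs hs1
    have hy' : y₀ + s • (y - y₀) ∈ closedBall c R := by
      have := (convex_closedBall c R) h0 hy (sub_nonneg.2 hs1) hs.le (by ring)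
      convert this using 1
      module
    rw [hval y₀ h0 y hy, hval y₀ h0 _ hy', norm_sub_rev (f y₀), norm_sub_rev (f y₀)]
    have h1 := hrad y₀ h0 y hy hyy s hs hs1
    have h4 := conformalFactor_pos (himm y₀ h0)
    calc _ ≤ conformalFactor f y₀ * (s * ‖f y - f y₀‖ ^ 2 / 2) := by gcongr
      _ = _ := by ring
  · intro y₀ hy₀
    have h0 := ball_subset_closedBall hy₀
    have h4 := conformalFactor_pos (himm y₀ h0)
    have hpd := gram_posDef (himm y₀ h0)
    obtain ⟨B, hAB, hB⟩ := exists_transpose_mul_self_of_posDef hpd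
    have hdet : gramDet f y₀ = B.det ^ 2 := by rw [gramDet, hAB, det_mul, det_transpose, sq]
    -- The exponent `-1/d` is chosen for this: `√τ ^ d = det(JᵀJ)^(-1/2) = |det B|⁻¹`, so the
    -- tangent form has determinant of modulus one.
    refine ⟨√(conformalFactor f y₀) • B, ?_, fun z => ?_⟩
    · rw [det_smul, Fintype.card_fin, abs_mul, abs_pow, abs_of_nonneg (Real.sqrt_nonneg _)]
      have h5 : √(conformalFactor f y₀) ^ d = |B.det|⁻¹ := by
        have h6 : 0 < gramDet f y₀ := hpd.det_pos
        rw [Real.sqrt_eq_rpow, conformalFactor, ← Real.rpow_mul h6.le, ← Real.rpow_natCast,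
          ← Real.rpow_mul h6.le]
        have hd' : (d : ℝ) ≠ 0 := by positivity
        have h7 : -(1 / (d : ℝ)) * (1 / 2) * d = -(1 / 2) := by field_simp
        rw [h7, Real.rpow_neg h6.le, ← Real.sqrt_eq_rpow, hdet, Real.sqrt_sq_eq_abs]
      rw [h5, inv_mul_cancel₀ (abs_ne_zero.2 hB)]
    · have hder := hasFDerivAt_of_mem_closedBall hV hK hf h0
      have hline : HasDerivAt (fun t : ℝ => f (y₀ + t • z)) (fderiv ℝ f y₀ z) 0 := by
        have h8 : HasDerivAt (fun t : ℝ => y₀ + t • z) z 0 := by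
          simpa using ((hasDerivAt_id (0 : ℝ)).smul_const z).const_add y₀
        have h9 : HasFDerivAt f (fderiv ℝ f y₀) (y₀ + (0 : ℝ) • z) := by simpa using hder
        exact h9.comp_hasDerivAt 0 h8
      have hslope := hline.tendsto_slope_zero_right
      simp only [zero_add, zero_smul, add_zero] at hslope
      have hlim := ((hslope.norm.pow 2).div_const 2).const_mul (conformalFactor f y₀)
      have heq : conformalFactor f y₀ * (‖fderiv ℝ f y₀ z‖ ^ 2 / 2) =
          ‖toEuclideanLin (√(conformalFactor f y₀) • B) z‖ ^ 2 / 2 := by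
        rw [norm_fderiv_sq hAB, map_smul, LinearMap.smul_apply, norm_smul, mul_pow,
          Real.norm_of_nonneg (Real.sqrt_nonneg _), Real.sq_sqrt h4.le]
        ring
      rw [← heq]
      refine hlim.congr' ?_
      have hball : ∀ᶠ t in 𝓝[>] (0 : ℝ), y₀ + t • z ∈ ball c R := by
        have : Tendsto (fun t : ℝ => y₀ + t • z) (𝓝[>] 0) (𝓝 y₀) := by
          have h10 : Continuous fun t : ℝ => y₀ + t • z := by fun_prop
          have := (h10.tendsto 0).mono_left (nhdsWithin_le_nhds (s := Set.Ioi 0))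
          simpa using this
        exact this.eventually (isOpen_ball.mem_nhds hy₀)
      filter_upwards [hball, self_mem_nhdsWithin] with t ht ht0
      have ht0 : 0 < t := ht0
      rw [hval y₀ h0 _ (ball_subset_closedBall ht), norm_smul, norm_sub_rev (f y₀), mul_pow,
        Real.norm_of_nonneg (inv_nonneg.2 ht0.le), inv_pow]
      ring

end Embedding

end NeighbourEmbedding
end

noncomputable section
namespace NeighbourEmbedding
open MeasureTheory Matrix Filter Topology Metric

/-! ### The uniform distribution on a ball -/

section Ball

variable {d : ℕ} {c : Euc d} {R : ℝ}

lemma volume_closedBall_ne_zero (hR : 0 < R) : volume (closedBall c R) ≠ 0 :=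
  (measure_closedBall_pos volume c hR).ne'

lemma isProbabilityMeasure_uniformBall (hR : 0 < R) : IsProbabilityMeasure (uniformBall c R) :=
  ProbabilityTheory.cond_isProbabilityMeasure_of_finite (volume_closedBall_ne_zero hR)
    measure_closedBall_lt_top.ne

lemma uniformBall_eq : uniformBall c R =
    (volume (closedBall c R))⁻¹ • volume.restrict (closedBall c R) := rfl

lemma ae_mem_uniformBall : ∀ᵐ y ∂uniformBall c R, y ∈ closedBall c R := by
  rw [uniformBall_eq]
  exact Measure.ae_smul_measure (ae_restrict_mem isClosed_closedBall.measurableSet) _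

lemma uniformBall_absolutelyContinuous : uniformBall c R ≪ (volume : Measure (Euc d)) := by
  rw [uniformBall_eq]
  exact Measure.smul_absolutelyContinuous.trans Measure.restrict_le_self.absolutelyContinuous

lemma ae_mem_ball_uniformBall (hd : 0 < d) : ∀ᵐ y ∂uniformBall c R, y ∈ ball c R := by
  have : Nonempty (Fin d) := ⟨⟨0, hd⟩⟩
  have h1 : ∀ᵐ y ∂uniformBall c R, y ∉ sphere c R := by
    have h2 : ∀ᵐ y ∂(volume : Measure (Euc d)), y ∉ sphere c R := by
      rw [ae_iff]
      simp only [not_not]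
      exact Measure.addHaar_sphere volume c R
    exact uniformBall_absolutelyContinuous.ae_le h2
  filter_upwards [h1, ae_mem_uniformBall] with y hy hy2
  rw [mem_ball]
  exact lt_of_le_of_ne hy2 hy

lemma uniformBall_singleton (hd : 0 < d) (y : Euc d) : uniformBall c R {y} = 0 := by
  have : Nonempty (Fin d) := ⟨⟨0, hd⟩⟩
  exact uniformBall_absolutelyContinuous (measure_singleton y)

lemma volume_real_closedBall (y : Euc d) {s : ℝ} (hs : 0 ≤ s) :
    volume.real (closedBall y s) = s ^ d * volume.real (ball (0 : Euc d) 1) := by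
  rw [Measure.addHaar_real_closedBall _ _ hs, finrank_euclideanSpace, Fintype.card_fin]

lemma volume_real_unitBall_pos : 0 < volume.real (ball (0 : Euc d) 1) :=
  ENNReal.toReal_pos (measure_ball_pos volume _ one_pos).ne' measure_ball_lt_top.ne

lemma uniformBall_real (s : Set (Euc d)) : (uniformBall c R).real s =
    (volume.real (closedBall c R))⁻¹ * volume.real (closedBall c R ∩ s) := by
  rw [measureReal_def, uniformBall, ProbabilityTheory.cond_apply isClosed_closedBall.measurableSet,
    ENNReal.toReal_mul, ENNReal.toReal_inv]
  rfl

lemma uniformBall_real_le (hR : 0 < R) {s : Set (Euc d)} {v : ℝ}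
    (h : volume.real (closedBall c R ∩ s) ≤ v * volume.real (ball (0 : Euc d) 1)) :
    (uniformBall c R).real s ≤ v / R ^ d := by
  have h1 := volume_real_unitBall_pos (d := d)
  rw [uniformBall_real, volume_real_closedBall _ hR.le, inv_mul_le_iff₀ (by positivity)]
  calc _ ≤ _ := h
    _ = _ := by field_simp

lemma uniformBall_real_closedBall_le (hR : 0 < R) (y : Euc d) {s : ℝ} (hs : 0 ≤ s) :
    (uniformBall c R).real (closedBall y s) ≤ s ^ d / R ^ d := by
  refine uniformBall_real_le hR ?_
  rw [← volume_real_closedBall y hs]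
  exact measureReal_mono Set.inter_subset_right measure_closedBall_lt_top.ne

/-- Near the boundary part of the ball about `y` is lost. Moving its centre towards `c` by at most
`s / 2` gives a ball of radius `s / 2` that lies both in the domain and in the original ball. -/
lemma le_uniformBall_real_closedBall (hR : 0 < R) {y : Euc d} (hy : y ∈ closedBall c R) {s : ℝ}
    (hs : 0 ≤ s) (hsR : s ≤ R) :
    (s / 2) ^ d / R ^ d ≤ (uniformBall c R).real (closedBall y s) := by
  have h1 := volume_real_unitBall_pos (d := d)
  set t := s / (2 * R) with ht
  have ht0 : 0 ≤ t := by positivity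
  have ht1 : t ≤ 1 := by rw [ht, div_le_one (by positivity)]; linarith
  have htR : t * R = s / 2 := by rw [ht]; field_simp
  have hyc : ‖y - c‖ ≤ R := by simpa [dist_eq_norm] using hy
  have hsub : closedBall (y + t • (c - y)) (s / 2) ⊆ closedBall c R ∩ closedBall y s := by
    refine Set.subset_inter (closedBall_subset_closedBall' ?_) (closedBall_subset_closedBall' ?_)
    · have : y + t • (c - y) - c = (1 - t) • (y - c) := by module
      rw [dist_eq_norm, this, norm_smul, Real.norm_of_nonneg (by linarith)]
      nlinarith
    · rw [dist_eq_norm, add_sub_cancel_left, norm_smul, Real.norm_of_nonneg ht0, norm_sub_rev]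
      nlinarith
  have h2 := measureReal_mono hsub
    (measure_lt_top_of_subset (μ := volume) Set.inter_subset_right
      (measure_closedBall_lt_top (x := y)).ne).ne
  rw [volume_real_closedBall _ (by positivity)] at h2
  rw [uniformBall_real, volume_real_closedBall _ hR.le, le_inv_mul_iff₀ (by positivity)]
  calc _ = (s / 2) ^ d * volume.real (ball (0 : Euc d) 1) := by field_simp
    _ ≤ _ := h2

/-- Blow-up at `y₀`: the scale `t` with `n tᵈ = 1` cancels the factor `n`. -/
lemma natCast_smul_integral_uniformBall {F : Type*} [NormedAddCommGroup F] [NormedSpace ℝ F]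
    (y₀ : Euc d) {n t : ℝ} (ht : 0 < t) (hnt : n * t ^ d = 1) (g : Euc d → F) :
    n • ∫ y, g y ∂uniformBall c R = (volume.real (closedBall c R))⁻¹ •
      ∫ z, (closedBall c R).indicator g (y₀ + t • z) := by
  have h1 : ∫ y, g y ∂uniformBall c R = (volume.real (closedBall c R))⁻¹ •
      ∫ y, (closedBall c R).indicator g y := by
    rw [uniformBall_eq, integral_smul_measure, integral_indicator isClosed_closedBall.measurableSet,
      ENNReal.toReal_inv]
    rfl
  have h2 : ∫ z, (closedBall c R).indicator g (y₀ + t • z) =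
      (t ^ d)⁻¹ • ∫ y, (closedBall c R).indicator g y := by
    rw [Measure.integral_comp_smul volume (fun z => (closedBall c R).indicator g (y₀ + z)) t,
      integral_add_left_eq_self (fun z => (closedBall c R).indicator g z) y₀,
      finrank_euclideanSpace, Fintype.card_fin, abs_of_pos (by positivity)]
  rw [h1, h2, smul_smul, smul_smul]
  congr 1
  have : (t ^ d)⁻¹ = n := by rw [inv_eq_iff_eq_inv, eq_inv_of_mul_eq_one_right hnt]
  rw [this, mul_comm]

end Ball

/-! ### Blow-up of a metric kernel -/

/-- The spatial scale `n ^ (-1 / d)`. -/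
def spaceScale (d n : ℕ) : ℝ := (n : ℝ) ^ (-(1 / (d : ℝ)))

/-- The precision scale `n ^ (2 / d)`. -/
def precScale (d n : ℕ) : ℝ := (n : ℝ) ^ (2 / (d : ℝ))

lemma spaceScale_pos (d : ℕ) {n : ℕ} (hn : 0 < n) : 0 < spaceScale d n :=
  Real.rpow_pos_of_pos (by exact_mod_cast hn) _

lemma precScale_pos (d : ℕ) {n : ℕ} (hn : 0 < n) : 0 < precScale d n :=
  Real.rpow_pos_of_pos (by exact_mod_cast hn) _

lemma precScale_nonneg (d n : ℕ) : 0 ≤ precScale d n := Real.rpow_nonneg (by positivity) _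

lemma precScale_eq (d : ℕ) {n : ℕ} (hn : 0 < n) : precScale d n = (spaceScale d n ^ 2)⁻¹ := by
  have : (0 : ℝ) < n := by exact_mod_cast hn
  rw [precScale, spaceScale, ← Real.rpow_natCast, ← Real.rpow_mul this.le,
    ← Real.rpow_neg this.le]
  congr 1; push_cast; ring

lemma natCast_mul_spaceScale_pow {d n : ℕ} (hd : 0 < d) (hn : 0 < n) :
    (n : ℝ) * spaceScale d n ^ d = 1 := by
  have h1 : (0 : ℝ) < n := by exact_mod_cast hn
  have h2 : (d : ℝ) ≠ 0 := by positivity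
  rw [spaceScale, ← Real.rpow_natCast, ← Real.rpow_mul h1.le]
  have : -(1 / (d : ℝ)) * d = -1 := by field_simp
  rw [this, Real.rpow_neg_one, mul_inv_cancel₀ h1.ne']

lemma tendsto_spaceScale {d : ℕ} (hd : 0 < d) :
    Tendsto (spaceScale d) atTop (𝓝[>] 0) := by
  refine tendsto_nhdsWithin_iff.2 ⟨?_, ?_⟩
  · exact (tendsto_rpow_neg_atTop (y := 1 / (d : ℝ)) (by positivity)).comp
      tendsto_natCast_atTop_atTop
  · filter_upwards [eventually_gt_atTop 0] with n hn using spaceScale_pos d hn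

lemma tendsto_precScale {d : ℕ} (hd : 0 < d) : Tendsto (precScale d) atTop atTop :=
  (tendsto_rpow_atTop (y := 2 / (d : ℝ)) (by positivity)).comp tendsto_natCast_atTop_atTop

lemma integrable_exp_neg_mul_sq_norm (d : ℕ) {b : ℝ} (hb : 0 < b) :
    Integrable fun v : Euc d => Real.exp (-(b * ‖v‖ ^ 2)) := by
  have := (GaussianFourier.integrable_cexp_neg_mul_sq_norm_add (V := Euc d)
    (b := (b : ℂ)) (by simpa using hb) 0 0).norm
  refine this.congr (Filter.Eventually.of_forall fun v => ?_)
  simp only [Complex.norm_exp]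
  simp only [zero_mul, add_zero]
  norm_cast
  simp

namespace MetricKernel

variable {d : ℕ} {c : Euc d} {R : ℝ} (κ : MetricKernel c R)

lemma nonneg {y₀ y : Euc d} (h0 : y₀ ∈ closedBall c R) (hy : y ∈ closedBall c R) :
    0 ≤ κ.toFun y₀ y :=
  (mul_nonneg κ.lo_pos.le (sq_nonneg _)).trans (κ.lower y₀ h0 y hy)

lemma measurable_right (y₀ : Euc d) : Measurable (κ.toFun y₀) :=
  κ.measurable.comp (measurable_const.prodMk measurable_id)

lemma lower_scaled {n : ℕ} (hn : 0 < n) {y₀ z : Euc d} (h0 : y₀ ∈ closedBall c R)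
    (hz : y₀ + spaceScale d n • z ∈ closedBall c R) :
    κ.lo * ‖z‖ ^ 2 ≤ precScale d n * κ.toFun y₀ (y₀ + spaceScale d n • z) := by
  have hs := spaceScale_pos d hn
  have h := κ.lower y₀ h0 _ hz
  rw [add_sub_cancel_left, norm_smul, Real.norm_of_nonneg hs.le] at h
  rw [precScale_eq d hn, ← div_eq_inv_mul, le_div_iff₀ (by positivity)]
  calc _ = _ := by ring
    _ ≤ _ := h

/-- The constant in the uniform bound for blown-up exponential integrals. -/
def expConst (β : ℝ) : ℝ :=
  (volume.real (closedBall c R))⁻¹ * ∫ z : Euc d, Real.exp (-(β * κ.lo * ‖z‖ ^ 2))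

lemma expConst_nonneg (β : ℝ) : 0 ≤ κ.expConst β :=
  mul_nonneg (inv_nonneg.2 measureReal_nonneg) (integral_nonneg fun _ => (Real.exp_pos _).le)

/-- After blow-up the factor `n` cancels and the integrand lies below a fixed Gaussian, by the lower
quadratic bound on the kernel. The resulting bound is uniform in `n` and in `y₀`. -/
lemma integral_exp_le (hd : 0 < d) {β : ℝ} (hβ : 0 < β) {n : ℕ} (hn : 0 < n) {y₀ : Euc d}
    (h0 : y₀ ∈ closedBall c R) :
    n * ∫ y, Real.exp (-(β * (precScale d n * κ.toFun y₀ y))) ∂uniformBall c R ≤ κ.expConst β := by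
  have h1 := natCast_smul_integral_uniformBall (c := c) (R := R) y₀ (spaceScale_pos d hn)
    (natCast_mul_spaceScale_pow hd hn)
    (fun y => Real.exp (-(β * (precScale d n * κ.toFun y₀ y))))
  rw [smul_eq_mul] at h1
  rw [h1, smul_eq_mul]
  refine mul_le_mul_of_nonneg_left ?_ (inv_nonneg.2 measureReal_nonneg)
  refine integral_mono_of_nonneg (Eventually.of_forall fun z => ?_)
    (integrable_exp_neg_mul_sq_norm d (mul_pos hβ κ.lo_pos)) (Eventually.of_forall fun z => ?_)
  · exact Set.indicator_nonneg (fun _ _ => (Real.exp_pos _).le) _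
  · by_cases hz : y₀ + spaceScale d n • z ∈ closedBall c R
    · simp only [Set.indicator_of_mem hz]
      rw [Real.exp_le_exp, neg_le_neg_iff, mul_assoc]
      exact mul_le_mul_of_nonneg_left (κ.lower_scaled hn h0 hz) hβ.le
    · simp only [Set.indicator_of_notMem hz]
      exact (Real.exp_pos _).le

/-- The blown-up integrals of a rapidly decaying function converge to a universal integral. -/
lemma tendsto_integral (hd : 0 < d) {G : ℝ → ℂ} (hG : Continuous G) {C β : ℝ} (hβ : 0 < β)
    (hGb : ∀ e, 0 ≤ e → ‖G e‖ ≤ C * Real.exp (-(β * e))) {y₀ : Euc d} (h0 : y₀ ∈ ball c R) :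
    Tendsto (fun n : ℕ => n * ∫ y, G (precScale d n * κ.toFun y₀ y) ∂uniformBall c R) atTop
      (𝓝 ((volume.real (closedBall c R))⁻¹ • ∫ z : Euc d, G (‖z‖ ^ 2 / 2))) := by
  have h0' := ball_subset_closedBall h0
  obtain ⟨B, hB, htan⟩ := κ.tangent y₀ h0
  have hBdet : B.det ≠ 0 := by rw [← abs_pos, hB]; exact one_pos
  have hC : 0 ≤ C := by
    have := (norm_nonneg _).trans (hGb 0 le_rfl)
    simpa using this
  -- Universality enters here: the tangent form is `‖B z‖² / 2` with `|det B| = 1`, so the limit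
  -- integral depends on neither the kernel nor the point.
  have hlim : ∫ z : Euc d, G (‖z‖ ^ 2 / 2) = ∫ z : Euc d, G (‖toEuclideanLin B z‖ ^ 2 / 2) := by
    rw [integral_comp_toEuclideanLin hBdet (fun z => G (‖z‖ ^ 2 / 2)), hB]; simp
  rw [hlim]
  have hrw : ∀ᶠ n : ℕ in atTop, (volume.real (closedBall c R))⁻¹ • ∫ z : Euc d,
      (closedBall c R).indicator (fun y => G (precScale d n * κ.toFun y₀ y))
        (y₀ + spaceScale d n • z) =
      n * ∫ y, G (precScale d n * κ.toFun y₀ y) ∂uniformBall c R := by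
    filter_upwards [eventually_gt_atTop 0] with n hn
    have h1 := natCast_smul_integral_uniformBall (c := c) (R := R) y₀ (spaceScale_pos d hn)
      (natCast_mul_spaceScale_pow hd hn) (fun y => G (precScale d n * κ.toFun y₀ y))
    rw [← h1]; simp
  refine Tendsto.congr' hrw (Tendsto.const_smul ?_ _)
  refine tendsto_integral_filter_of_dominated_convergence
    (fun z => C * Real.exp (-(β * κ.lo * ‖z‖ ^ 2))) ?_ ?_
    ((integrable_exp_neg_mul_sq_norm d (mul_pos hβ κ.lo_pos)).const_mul C) ?_
  · refine Eventually.of_forall fun n => ?_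
    have hm : Measurable fun y => G (precScale d n * κ.toFun y₀ y) :=
      hG.measurable.comp ((κ.measurable_right y₀).const_mul _)
    exact ((hm.indicator isClosed_closedBall.measurableSet).comp
      (by fun_prop : Measurable fun z : Euc d => y₀ + spaceScale d n • z)).aestronglyMeasurable
  · filter_upwards [eventually_gt_atTop 0] with n hn
    refine Eventually.of_forall fun z => ?_
    by_cases hz : y₀ + spaceScale d n • z ∈ closedBall c R
    · rw [Set.indicator_of_mem hz]
      have h1 := κ.lower_scaled hn h0' hz
      have h2 : 0 ≤ κ.lo * ‖z‖ ^ 2 := mul_nonneg κ.lo_pos.le (sq_nonneg _)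
      refine (hGb _ (h2.trans h1)).trans ?_
      refine mul_le_mul_of_nonneg_left ?_ hC
      rw [Real.exp_le_exp, neg_le_neg_iff, mul_assoc]
      exact mul_le_mul_of_nonneg_left h1 hβ.le
    · rw [Set.indicator_of_notMem hz, norm_zero]
      positivity
  · refine Eventually.of_forall fun z => ?_
    have h1 := (htan z).comp (tendsto_spaceScale hd)
    have h2 := (hG.tendsto _).comp h1
    refine h2.congr' ?_
    -- An interior base point is needed: the blown-up domain then exhausts the space and the
    -- indicator tends to one.
    have hball : ∀ᶠ n : ℕ in atTop, y₀ + spaceScale d n • z ∈ ball c R := by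
      have h10 : Continuous fun t : ℝ => y₀ + t • z := by fun_prop
      have h11 := (h10.tendsto 0).comp ((tendsto_spaceScale hd).mono_right nhdsWithin_le_nhds)
      simp only [zero_smul, add_zero] at h11
      exact h11.eventually (isOpen_ball.mem_nhds h0)
    filter_upwards [hball, eventually_gt_atTop 0] with n hn hn0
    rw [Set.indicator_of_mem (ball_subset_closedBall hn)]
    simp only [Function.comp, precScale_eq d hn0]

/-- Blown-up exponentials at two different points do not interact. -/
lemma tendsto_integral_mul (hd : 0 < d) (hR : 0 < R) {β : ℝ} (hβ : 0 < β) {y₀ y₁ : Euc d}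
    (h0 : y₀ ∈ closedBall c R) (h1 : y₁ ∈ closedBall c R) (hne : y₀ ≠ y₁) :
    Tendsto (fun n : ℕ => n * ∫ y, Real.exp (-(β * (precScale d n * κ.toFun y₀ y))) *
      Real.exp (-(β * (precScale d n * κ.toFun y₁ y))) ∂uniformBall c R) atTop (𝓝 0) := by
  have := isProbabilityMeasure_uniformBall (c := c) hR
  set r := ‖y₀ - y₁‖ / 2 with hr
  have hr0 : 0 < r := by
    have := norm_pos_iff.2 (sub_ne_zero.2 hne)
    positivity
  have hE : ∀ (n : ℕ) (a : Euc d), a ∈ closedBall c R → Integrable (fun y =>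
      Real.exp (-(β * (precScale d n * κ.toFun a y)))) (uniformBall c R) := by
    intro n a ha
    refine Integrable.of_bound (C := 1) ?_ ?_
    · exact (Real.measurable_exp.comp
        (((κ.measurable_right a).const_mul _).const_mul _).neg).aestronglyMeasurable
    · filter_upwards [ae_mem_uniformBall] with y hy
      rw [Real.norm_of_nonneg (Real.exp_pos _).le, Real.exp_le_one_iff, neg_nonpos]
      exact mul_nonneg hβ.le (mul_nonneg (precScale_nonneg d n) (κ.nonneg ha hy))
  have hb : ∀ n : ℕ, 0 < n → n * ∫ y, Real.exp (-(β * (precScale d n * κ.toFun y₀ y))) *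
      Real.exp (-(β * (precScale d n * κ.toFun y₁ y))) ∂uniformBall c R ≤
      Real.exp (-(β * (κ.lo * r ^ 2) * precScale d n)) * (κ.expConst β + κ.expConst β) := by
    intro n hn
    set ε := Real.exp (-(β * (κ.lo * r ^ 2) * precScale d n)) with hε
    have hps := precScale_pos d hn
    have hpt : ∀ᵐ y ∂uniformBall c R, Real.exp (-(β * (precScale d n * κ.toFun y₀ y))) *
        Real.exp (-(β * (precScale d n * κ.toFun y₁ y))) ≤
        ε * (Real.exp (-(β * (precScale d n * κ.toFun y₀ y))) +
          Real.exp (-(β * (precScale d n * κ.toFun y₁ y)))) := by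
      filter_upwards [ae_mem_uniformBall] with y hy
      have key : ∀ a ∈ closedBall c R, r ≤ ‖y - a‖ →
          Real.exp (-(β * (precScale d n * κ.toFun a y))) ≤ ε := by
        intro a ha hra
        rw [hε, Real.exp_le_exp, neg_le_neg_iff]
        have h3 := κ.lower a ha y hy
        have h4 : r ^ 2 ≤ ‖y - a‖ ^ 2 := by gcongr
        have h5 : κ.lo * r ^ 2 ≤ κ.toFun a y :=
          (mul_le_mul_of_nonneg_left h4 κ.lo_pos.le).trans h3
        calc β * (κ.lo * r ^ 2) * precScale d n = β * (precScale d n * (κ.lo * r ^ 2)) := by ring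
          _ ≤ _ := by gcongr
      have htri : ‖y₀ - y₁‖ ≤ ‖y - y₀‖ + ‖y - y₁‖ := by
        have h6 : y₀ - y₁ = (y - y₁) - (y - y₀) := by abel
        rw [h6, add_comm]; exact norm_sub_le _ _
      have p0 := Real.exp_pos (-(β * (precScale d n * κ.toFun y₀ y)))
      have p1 := Real.exp_pos (-(β * (precScale d n * κ.toFun y₁ y)))
      have pε : 0 < ε := Real.exp_pos _
      rcases le_total r ‖y - y₀‖ with h | h
      · have := key y₀ h0 h
        nlinarith
      · have := key y₁ h1 (by linarith)
        nlinarith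
    have h3 := integral_mono_of_nonneg (Eventually.of_forall fun y => by positivity)
      (((hE n y₀ h0).add (hE n y₁ h1)).const_mul ε) hpt
    simp only [Pi.add_apply] at h3
    rw [integral_const_mul, integral_add (hE n y₀ h0) (hE n y₁ h1)] at h3
    have h4 := κ.integral_exp_le hd hβ hn h0
    have h5 := κ.integral_exp_le hd hβ hn h1
    have pε : 0 < ε := Real.exp_pos _
    have hn' : (0 : ℝ) ≤ n := by positivity
    calc _ ≤ n * (ε * (∫ y, Real.exp (-(β * (precScale d n * κ.toFun y₀ y))) ∂uniformBall c R +
          ∫ y, Real.exp (-(β * (precScale d n * κ.toFun y₁ y))) ∂uniformBall c R)) :=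
          mul_le_mul_of_nonneg_left h3 hn'
      _ = ε * (n * ∫ y, Real.exp (-(β * (precScale d n * κ.toFun y₀ y))) ∂uniformBall c R +
          n * ∫ y, Real.exp (-(β * (precScale d n * κ.toFun y₁ y))) ∂uniformBall c R) := by ring
      _ ≤ _ := mul_le_mul_of_nonneg_left (add_le_add h4 h5) pε.le
  have hz : Tendsto (fun n : ℕ => Real.exp (-(β * (κ.lo * r ^ 2) * precScale d n)) *
      (κ.expConst β + κ.expConst β)) atTop (𝓝 0) := by
    rw [show (0 : ℝ) = 0 * (κ.expConst β + κ.expConst β) by ring]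
    refine Tendsto.mul_const _ (Real.tendsto_exp_neg_atTop_nhds_zero.comp ?_)
    exact (tendsto_precScale hd).const_mul_atTop
      (mul_pos hβ (mul_pos κ.lo_pos (by positivity)))
  refine squeeze_zero' (Eventually.of_forall fun n => ?_)
    ((eventually_gt_atTop 0).mono fun n hn => hb n hn) hz
  exact mul_nonneg (by positivity) (integral_nonneg fun y => by positivity)

end MetricKernel

end NeighbourEmbedding
end

noncomputable section
namespace NeighbourEmbedding
open MeasureTheory Matrix Filter Topology Metric

/-! ### The measure of the shells of a metric kernel -/

lemma volume_real_preimage_homothety {d : ℕ} (y₀ : Euc d) {a : ℝ} (ha : 0 < a)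
    (A : Set (Euc d)) :
    volume.real ((fun y => y₀ + a⁻¹ • (y - y₀)) ⁻¹' A) = a ^ d * volume.real A := by
  have h1 : (fun y => y₀ + a⁻¹ • (y - y₀)) ⁻¹' A =
      (fun y => y - y₀) ⁻¹' ((a⁻¹ • ·) ⁻¹' ((y₀ + ·) ⁻¹' A)) := rfl
  rw [h1, measureReal_def]
  have h2 : ∀ s : Set (Euc d), volume ((fun y => y - y₀) ⁻¹' s) = volume s := by
    intro s
    simp only [sub_eq_add_neg]
    exact measure_preimage_add_right volume (-y₀) s
  rw [h2, Measure.addHaar_preimage_smul volume (inv_ne_zero ha.ne'), measure_preimage_add,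
    ENNReal.toReal_mul, ENNReal.toReal_ofReal (abs_nonneg _), finrank_euclideanSpace,
    Fintype.card_fin, inv_pow, inv_inv, abs_of_pos (by positivity)]
  rfl

namespace MetricKernel

variable {d : ℕ} {c : Euc d} {R : ℝ} (κ : MetricKernel c R)

/-- The part near `y₀` of the shell `r ≤ κ(y₀, ·) < s`. -/
def shell (y₀ : Euc d) (r s : ℝ) : Set (Euc d) :=
  closedBall c R ∩ {y | ‖y - y₀‖ ≤ κ.rad ∧ r ≤ κ.toFun y₀ y ∧ κ.toFun y₀ y < s}

lemma measurableSet_shell (y₀ : Euc d) (r s : ℝ) : MeasurableSet (κ.shell y₀ r s) := by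
  have hm := κ.measurable_right y₀
  refine isClosed_closedBall.measurableSet.inter ?_
  refine (measurableSet_le (f := fun y => ‖y - y₀‖) (by fun_prop) measurable_const).inter ?_
  exact (measurableSet_le measurable_const hm).inter (measurableSet_lt hm measurable_const)

lemma mem_closedBall_of_lt {y₀ y : Euc d} (h0 : y₀ ∈ closedBall c R) (hy : y ∈ closedBall c R)
    {s : ℝ} (h : κ.toFun y₀ y < s) : y ∈ closedBall y₀ √(s / κ.lo) := by
  have h1 := κ.lower y₀ h0 y hy
  have h2 : ‖y - y₀‖ ^ 2 ≤ s / κ.lo := by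
    rw [le_div_iff₀ κ.lo_pos]; linarith
  rw [mem_closedBall, dist_eq_norm]
  exact Real.le_sqrt_of_sq_le h2

/-- Contractions of a thin shell are disjoint. -/
lemma natCast_mul_volume_shell_le {y₀ : Euc d} (h0 : y₀ ∈ closedBall c R) {r h : ℝ} (hr : 0 < r)
    (hh : 0 < h) {m : ℕ} (hm : m * h ≤ r) :
    m * volume.real (κ.shell y₀ r (r + h)) ≤
      Real.exp d * (√((r + h) / κ.lo) ^ d * volume.real (ball (0 : Euc d) 1)) := by
  -- By radial growth, contracting by `s` takes energies below `r + h` to energies below `r`. Hence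
  -- the contractions of the shell by distinct powers of `s` are disjoint, and all lie in one ball.
  set s := r / (r + h) with hs
  have hs0 : 0 < s := by positivity
  have hs1 : s ≤ 1 := by rw [hs, div_le_one (by positivity)]; linarith
  have hsr : s * (r + h) = r := by rw [hs]; field_simp
  set A := κ.shell y₀ r (r + h) with hA
  set T : ℕ → Set (Euc d) := fun i => (fun y => y₀ + (s ^ i)⁻¹ • (y - y₀)) ⁻¹' A with hT
  have hmeas : ∀ i, MeasurableSet (T i) := fun i =>
    (κ.measurableSet_shell y₀ r (r + h)).preimage (by fun_prop)
  have hvol : ∀ i, volume.real (T i) = (s ^ i) ^ d * volume.real A := fun i =>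
    volume_real_preimage_homothety y₀ (pow_pos hs0 i) A
  have hdisj : ∀ i j, i < j → Disjoint (T i) (T j) := by
    intro i j hij
    rw [Set.disjoint_left]
    intro y hyi hyj
    set u := y₀ + (s ^ i)⁻¹ • (y - y₀) with hu
    set w := y₀ + (s ^ j)⁻¹ • (y - y₀) with hw
    have hu' : u ∈ A := hyi
    have hw' : w ∈ A := hyj
    have huw : u = y₀ + s ^ (j - i) • (w - y₀) := by
      rw [hw, add_sub_cancel_left, smul_smul, hu]
      congr 2
      have : s ^ j = s ^ (j - i) * s ^ i := by rw [← pow_add]; congr 1; omega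
      rw [this]
      field_simp
    have h1 := κ.radial y₀ h0 w hw'.1 hw'.2.1 (s ^ (j - i)) (pow_pos hs0 _)
      (pow_le_one₀ hs0.le hs1)
    rw [← huw] at h1
    have h2 : s ^ (j - i) ≤ s := by
      calc s ^ (j - i) ≤ s ^ 1 := pow_le_pow_of_le_one hs0.le hs1 (by omega)
        _ = s := pow_one s
    have h3 := hw'.2.2.1
    have h4 := hw'.2.2.2
    have h5 := hu'.2.2.1
    have h6 : s * κ.toFun y₀ w < s * (r + h) := mul_lt_mul_of_pos_left h4 hs0
    nlinarith
  have hsub : ∀ i, T i ⊆ closedBall y₀ √((r + h) / κ.lo) := by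
    intro i y hy
    have hy' : y₀ + (s ^ i)⁻¹ • (y - y₀) ∈ A := hy
    have h1 := κ.mem_closedBall_of_lt h0 hy'.1 hy'.2.2.2
    rw [mem_closedBall, dist_eq_norm, add_sub_cancel_left, norm_smul, norm_inv,
      Real.norm_of_nonneg (pow_pos hs0 i).le] at h1
    rw [mem_closedBall, dist_eq_norm]
    refine le_trans ?_ h1
    have h2 : 1 ≤ (s ^ i)⁻¹ := (one_le_inv₀ (pow_pos hs0 i)).2 (pow_le_one₀ hs0.le hs1)
    nlinarith [norm_nonneg (y - y₀)]
  have hfin : ∀ i, volume (T i) ≠ ⊤ := fun i =>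
    (measure_lt_top_of_subset (hsub i) measure_closedBall_lt_top.ne).ne
  have hsum : ∑ i ∈ Finset.range m, volume.real (T i) ≤
      √((r + h) / κ.lo) ^ d * volume.real (ball (0 : Euc d) 1) := by
    rw [← volume_real_closedBall y₀ (Real.sqrt_nonneg _), ← measureReal_biUnion_finset
      (fun i _ j _ hij => ?_) (fun i _ => hmeas i) (fun i _ => hfin i)]
    · exact measureReal_mono (Set.iUnion₂_subset fun i _ => hsub i) measure_closedBall_lt_top.ne
    · rcases lt_or_gt_of_ne hij with h | h
      · exact hdisj i j h
      · exact (hdisj j i h).symm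
  -- The first `m` contractions keep at least the fraction `exp (-d)` of the volume, since `s⁻¹ ≤
  -- exp (h / r)` and `m h ≤ r`.
  have hlow : ∀ i ∈ Finset.range m, Real.exp (-d) * volume.real A ≤ volume.real (T i) := by
    intro i hi
    rw [hvol]
    refine mul_le_mul_of_nonneg_right ?_ measureReal_nonneg
    have him : i ≤ m := (Finset.mem_range.1 hi).le
    have h1 : Real.exp (-1) ≤ s ^ i := by
      have h2 : (s⁻¹) ^ i ≤ Real.exp 1 := by
        have h3 : s⁻¹ = h / r + 1 := by rw [hs]; field_simp; ring
        have h4 : s⁻¹ ≤ Real.exp (h / r) := by rw [h3]; exact Real.add_one_le_exp _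
        calc (s⁻¹) ^ i ≤ Real.exp (h / r) ^ i := by gcongr
          _ = Real.exp (i * (h / r)) := by rw [← Real.exp_nat_mul]
          _ ≤ _ := by
            rw [Real.exp_le_exp, ← mul_div_assoc, div_le_one hr]
            have : (i : ℝ) ≤ m := by exact_mod_cast him
            nlinarith
      rw [Real.exp_neg, inv_le_comm₀ (Real.exp_pos _) (pow_pos hs0 i), ← inv_pow]
      exact h2
    calc Real.exp (-d) = Real.exp (-1) ^ d := by rw [← Real.exp_nat_mul]; ring_nf
      _ ≤ _ := by gcongr
  have h1 := Finset.sum_le_sum hlow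
  simp only [Finset.sum_const, Finset.card_range, nsmul_eq_mul] at h1
  have h2 := h1.trans hsum
  rw [Real.exp_neg] at h2
  have h3 := mul_le_mul_of_nonneg_left h2 (Real.exp_pos (d : ℝ)).le
  calc _ = _ := by field_simp
    _ ≤ _ := h3

lemma natCast_mul_uniformBall_shell_le (hR : 0 < R) {y₀ : Euc d} (h0 : y₀ ∈ closedBall c R)
    {r h : ℝ} (hr : 0 < r) (hh : 0 < h) {m : ℕ} (hm : m * h ≤ r) :
    m * (uniformBall c R).real (κ.shell y₀ r (r + h)) ≤
      Real.exp d * √((r + h) / κ.lo) ^ d / R ^ d := by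
  rcases Nat.eq_zero_or_pos m with rfl | hm0
  · simp; positivity
  have h1 := κ.natCast_mul_volume_shell_le h0 hr hh hm
  have hm' : (0 : ℝ) < m := by exact_mod_cast hm0
  have h2 : (uniformBall c R).real (κ.shell y₀ r (r + h)) ≤
      (Real.exp d * √((r + h) / κ.lo) ^ d / m) / R ^ d := by
    refine uniformBall_real_le hR ?_
    have h3 : volume.real (closedBall c R ∩ κ.shell y₀ r (r + h)) ≤
        volume.real (κ.shell y₀ r (r + h)) :=
      measureReal_mono Set.inter_subset_right (measure_lt_top_of_subset Set.inter_subset_left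
        measure_closedBall_lt_top.ne).ne
    refine h3.trans ?_
    rw [div_mul_eq_mul_div, le_div_iff₀ hm']
    linarith
  calc _ ≤ m * ((Real.exp d * √((r + h) / κ.lo) ^ d / m) / R ^ d) := by gcongr
    _ = _ := by field_simp

/-- Level sets of a metric kernel are null near the base point. -/
lemma uniformBall_level_eq_zero (hd : 0 < d) (hR : 0 < R) {y₀ : Euc d} (h0 : y₀ ∈ closedBall c R)
    (v : ℝ) : uniformBall c R
      (closedBall c R ∩ {y | ‖y - y₀‖ ≤ κ.rad ∧ κ.toFun y₀ y = v}) = 0 := by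
  have := isProbabilityMeasure_uniformBall (c := c) hR
  rcases le_or_gt v 0 with hv | hv
  · refine measure_mono_null ?_ (uniformBall_singleton hd y₀)
    rintro y ⟨hy, -, hyv⟩
    have h1 := κ.lower y₀ h0 y hy
    have h2 : ‖y - y₀‖ ^ 2 ≤ 0 := by
      have := κ.lo_pos
      by_contra! hc
      have := mul_pos this hc
      linarith
    have h3 : ‖y - y₀‖ = 0 := by nlinarith [norm_nonneg (y - y₀)]
    rw [Set.mem_singleton_iff, ← sub_eq_zero, ← norm_eq_zero, h3]
  · set s := closedBall c R ∩ {y | ‖y - y₀‖ ≤ κ.rad ∧ κ.toFun y₀ y = v}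
    set K := Real.exp d * √((v + v) / κ.lo) ^ d / R ^ d
    -- The level set lies in a shell of thickness `v / m` for every `m`, so its measure is at most
    -- `K / m`.
    have hb : ∀ m : ℕ, 0 < m → m * (uniformBall c R).real s ≤ K := by
      intro m hm
      have hm' : (0 : ℝ) < m := by exact_mod_cast hm
      have hm1 : (1 : ℝ) ≤ m := by exact_mod_cast hm
      have h1 := κ.natCast_mul_uniformBall_shell_le hR h0 hv (h := v / m) (by positivity) (m := m)
        (by rw [mul_div_cancel₀ _ hm'.ne'])
      have h2 : (uniformBall c R).real s ≤ (uniformBall c R).real (κ.shell y₀ v (v + v / m)) := by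
        refine measureReal_mono ?_
        rintro y ⟨hy, h3, h4⟩
        refine ⟨hy, h3, h4.ge, ?_⟩
        rw [h4]
        have : 0 < v / m := by positivity
        linarith
      have h3 : v / m ≤ v := div_le_self hv.le hm1
      have := κ.lo_pos
      calc _ ≤ _ := mul_le_mul_of_nonneg_left h2 hm'.le
        _ ≤ _ := h1
        _ ≤ K := by simp only [K]; gcongr
    have hz : (uniformBall c R).real s ≤ 0 := by
      by_contra! hc
      obtain ⟨m, hm⟩ := exists_nat_gt (K / (uniformBall c R).real s)
      have hK : 0 ≤ K := by positivity
      have hm0 : 0 < m := by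
        have : (0 : ℝ) < m := lt_of_le_of_lt (by positivity) hm
        exact_mod_cast this
      rw [div_lt_iff₀ hc] at hm
      linarith [hb m hm0]
    have hz' := le_antisymm hz measureReal_nonneg
    rwa [measureReal_eq_zero_iff] at hz'

lemma sqrt_div_precScale {n : ℕ} (hn : 0 < n) (v : ℝ) :
    √(v / precScale d n) = spaceScale d n * √v := by
  have hs := spaceScale_pos d hn
  rw [precScale_eq d hn, div_inv_eq_mul, Real.sqrt_mul' _ (by positivity), Real.sqrt_sq hs.le,
    mul_comm]

lemma natCast_mul_uniformBall_sublevel_le (hd : 0 < d) (hR : 0 < R) {n : ℕ} (hn : 0 < n)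
    {y₀ : Euc d} (h0 : y₀ ∈ closedBall c R) (v : ℝ) :
    n * (uniformBall c R).real (closedBall c R ∩ {y | precScale d n * κ.toFun y₀ y < v}) ≤
      √(v / κ.lo) ^ d / R ^ d := by
  have := isProbabilityMeasure_uniformBall (c := c) hR
  have hp := precScale_pos d hn
  have h1 : closedBall c R ∩ {y | precScale d n * κ.toFun y₀ y < v} ⊆
      closedBall y₀ √(v / precScale d n / κ.lo) := by
    rintro y ⟨hy, hy2⟩
    refine κ.mem_closedBall_of_lt h0 hy ?_
    rw [lt_div_iff₀ hp, mul_comm]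
    exact hy2
  have h2 := (measureReal_mono (μ := uniformBall c R) h1).trans
    (uniformBall_real_closedBall_le hR y₀ (Real.sqrt_nonneg _))
  rw [div_right_comm, sqrt_div_precScale hn, mul_pow] at h2
  calc _ ≤ n * (spaceScale d n ^ d * √(v / κ.lo) ^ d / R ^ d) := by gcongr
    _ = (n * spaceScale d n ^ d) * √(v / κ.lo) ^ d / R ^ d := by ring
    _ = _ := by rw [natCast_mul_spaceScale_pow hd hn, one_mul]

/-- The constant in the shell estimate. -/
def shellConst : ℝ := (2 * Real.exp d * (√κ.lo)⁻¹ ^ d + √(2 / κ.lo) ^ d) / R ^ d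

/-- The shell bound gives a factor of order `h / r`, useful only for `r ≥ √h`. For smaller `r` the
whole shell lies below the level `2 √h`, and the measure of that sublevel set supplies a power of
`h`. Both cases fit under `h^(1/4)`. -/
lemma natCast_mul_uniformBall_scaled_shell_le (hd : 0 < d) (hR : 0 < R) {n : ℕ} (hn : 0 < n)
    {y₀ : Euc d} (h0 : y₀ ∈ closedBall c R) {r h : ℝ} (hr : 0 ≤ r) (hh : 0 < h) (hh1 : h ≤ 1) :
    n * (uniformBall c R).real (κ.shell y₀ (r / precScale d n) ((r + h) / precScale d n)) ≤
      κ.shellConst * ((r + 1) ^ d * √√h) := by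
  have := isProbabilityMeasure_uniformBall (c := c) hR
  have hp := precScale_pos d hn
  have hlo := κ.lo_pos
  have hn' : (0 : ℝ) < n := by exact_mod_cast hn
  have hsh : 0 < √h := Real.sqrt_pos.2 hh
  have hsh1 : √h ≤ 1 := Real.sqrt_le_one.2 hh1
  have hssh : √h ≤ √√h := by
    have h1 : √√h ≤ 1 := Real.sqrt_le_one.2 hsh1
    nlinarith [Real.sq_sqrt hsh.le, Real.sqrt_nonneg √h]
  have hhsq : h ≤ √h := by nlinarith [Real.sq_sqrt hh.le]
  have hr1 : (1 : ℝ) ≤ (r + 1) ^ d := one_le_pow₀ (by linarith)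
  rcases le_or_gt (√h) r with hc | hc
  · have hr0 : 0 < r := hsh.trans_le hc
    have hhr : h ≤ r := hhsq.trans hc
    set m := ⌊r / h⌋₊ with hm
    have h1m : (1 : ℝ) ≤ r / h := by rwa [le_div_iff₀ hh, one_mul]
    have hmle : (m : ℝ) ≤ r / h := Nat.floor_le (by positivity)
    have hmlt : r / h < m + 1 := Nat.lt_floor_add_one _
    have hm1 : (1 : ℝ) ≤ m := by
      have : 1 ≤ m := Nat.le_floor (by simpa using h1m)
      exact_mod_cast this
    have h1 := κ.natCast_mul_uniformBall_shell_le hR h0 (r := r / precScale d n)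
      (h := h / precScale d n) (by positivity) (by positivity) (m := m) (by
        rw [← mul_div_assoc]; gcongr; rwa [le_div_iff₀ hh] at hmle)
    rw [← add_div, div_right_comm (r + h), sqrt_div_precScale hn, mul_pow] at h1
    set q := (uniformBall c R).real (κ.shell y₀ (r / precScale d n) ((r + h) / precScale d n))
    have h2 : √((r + h) / κ.lo) ≤ (√κ.lo)⁻¹ * (r + 1) := by
      rw [Real.sqrt_div (by positivity), div_eq_inv_mul]
      gcongr
      rw [Real.sqrt_le_left (by positivity)]
      nlinarith
    have h3 : r / (2 * h) ≤ m := by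
      have : r / h ≤ 2 * m := by linarith
      rw [mul_comm, ← div_div, div_le_iff₀ two_pos]; linarith
    have h4 : n * q * (r / (2 * h)) ≤ Real.exp d * ((√κ.lo)⁻¹ ^ d * (r + 1) ^ d) / R ^ d := by
      calc n * q * (r / (2 * h)) ≤ n * q * m := by gcongr
        _ = n * (m * q) := by ring
        _ ≤ n * (Real.exp d * (spaceScale d n ^ d * √((r + h) / κ.lo) ^ d) / R ^ d) := by gcongr
        _ = (n * spaceScale d n ^ d) * (Real.exp d * √((r + h) / κ.lo) ^ d / R ^ d) := by ring
        _ = Real.exp d * √((r + h) / κ.lo) ^ d / R ^ d := by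
          rw [natCast_mul_spaceScale_pow hd hn, one_mul]
        _ ≤ Real.exp d * ((√κ.lo)⁻¹ * (r + 1)) ^ d / R ^ d := by gcongr
        _ = _ := by rw [mul_pow]
    have h5 : 2 * h / r ≤ 2 * √√h := by
      rw [div_le_iff₀ hr0]
      have h6 : h = √h * √h := (Real.mul_self_sqrt hh.le).symm
      nlinarith [Real.sqrt_nonneg √h]
    have hq0 : 0 ≤ n * q := mul_nonneg hn'.le measureReal_nonneg
    calc n * q = n * q * (r / (2 * h)) * (2 * h / r) := by field_simp
      _ ≤ Real.exp d * ((√κ.lo)⁻¹ ^ d * (r + 1) ^ d) / R ^ d * (2 * √√h) := by gcongr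
      _ = 2 * Real.exp d * (√κ.lo)⁻¹ ^ d / R ^ d * ((r + 1) ^ d * √√h) := by ring
      _ ≤ _ := by
        unfold shellConst
        gcongr
        exact le_add_of_nonneg_right (by positivity)
  · have h1 := κ.natCast_mul_uniformBall_sublevel_le hd hR hn h0 (2 * √h)
    have h2 : κ.shell y₀ (r / precScale d n) ((r + h) / precScale d n) ⊆
        closedBall c R ∩ {y | precScale d n * κ.toFun y₀ y < 2 * √h} := by
      rintro y ⟨hy, -, -, hy2⟩
      refine ⟨hy, ?_⟩
      rw [lt_div_iff₀ hp] at hy2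
      have : precScale d n * κ.toFun y₀ y < 2 * √h := by linarith
      exact this
    have h3 : √(2 * √h / κ.lo) ^ d ≤ √(2 / κ.lo) ^ d * √√h := by
      rw [mul_div_right_comm, Real.sqrt_mul (by positivity), mul_pow]
      gcongr
      calc √√h ^ d ≤ √√h ^ 1 :=
            pow_le_pow_of_le_one (Real.sqrt_nonneg _) (Real.sqrt_le_one.2 hsh1) hd
        _ = _ := pow_one _
    have h6 := measureReal_mono (μ := uniformBall c R) h2
    calc _ ≤ n * (uniformBall c R).real
          (closedBall c R ∩ {y | precScale d n * κ.toFun y₀ y < 2 * √h}) := by gcongr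
      _ ≤ _ := h1
      _ ≤ √(2 / κ.lo) ^ d * √√h / R ^ d := by gcongr
      _ = √(2 / κ.lo) ^ d / R ^ d * (1 * √√h) := by ring
      _ ≤ _ := by
        unfold shellConst
        gcongr
        exact le_add_of_nonneg_left (by positivity)

end MetricKernel

end NeighbourEmbedding
end

noncomputable section
namespace NeighbourEmbedding
open MeasureTheory ProbabilityTheory Matrix Filter Topology Metric
open scoped RealInnerProductSpace BoundedContinuousFunction

/-! ### The limit law of the partition and energy sums -/

/-- `Y` is a sequence of independent points with the uniform distribution on a ball. -/
structure IsUniformSample {d : ℕ} {Ω : Type*} [MeasurableSpace Ω] (c : Euc d) (R : ℝ)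
    (P : Measure Ω) (Y : ℕ → Ω → Euc d) : Prop where
  measurable : ∀ i, Measurable (Y i)
  indep : iIndepFun Y P
  law : ∀ i, P.map (Y i) = uniformBall c R

lemma IsUniformSample.integral_prod {d : ℕ} {Ω : Type*} [MeasurableSpace Ω] {c : Euc d} {R : ℝ}
    {P : Measure Ω} {Y : ℕ → Ω → Euc d} (hY : IsUniformSample c R P Y) {𝕜 : Type*} [RCLike 𝕜]
    (n : ℕ) {g : Euc d → 𝕜} (hg : Measurable g) :
    ∫ ω, ∏ j ∈ Finset.range n, g (Y j ω) ∂P = (∫ y, g y ∂uniformBall c R) ^ n := by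
  have h1 : iIndepFun (fun j : Fin n => Y j) P := hY.indep.precomp Fin.val_injective
  have h2 := h1.integral_fun_prod_comp (f := fun _ => g)
    (fun i => (hY.measurable i).aemeasurable) (fun i => hg.aestronglyMeasurable)
  simp_rw [← Fin.prod_univ_eq_prod_range]
  rw [h2]
  have h3 : ∀ i : Fin n, ∫ ω, g (Y i ω) ∂P = ∫ y, g y ∂uniformBall c R := by
    intro i
    rw [← hY.law i, integral_map (hY.measurable i).aemeasurable hg.aestronglyMeasurable]
  simp [h3]

/-- By independence the characteristic function of the sum is `(1 + z_n / n)^n`, where `z_n` is the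
sequence assumed to tend to `ψ`. -/
lemma IsUniformSample.tendsto_charFun_sum {d : ℕ} {Ω : Type*} [MeasurableSpace Ω] {c : Euc d}
    {R : ℝ} (hR : 0 < R)
    {P : Measure Ω} {Y : ℕ → Ω → Euc d} (hY : IsUniformSample c R P Y) {E : Type*}
    [NormedAddCommGroup E] [InnerProductSpace ℝ E] [MeasurableSpace E] [BorelSpace E]
    [SecondCountableTopology E] {F : ℕ → Euc d → E} (hF : ∀ n, Measurable (F n)) {ξ : E} {ψ : ℂ}
    (h : Tendsto (fun n : ℕ => n * ∫ y, (Complex.exp (⟪F n y, ξ⟫ * Complex.I) - 1)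
      ∂uniformBall c R) atTop (𝓝 ψ)) :
    Tendsto (fun n : ℕ => charFun (P.map fun ω => ∑ j ∈ Finset.range n, F n (Y j ω)) ξ) atTop
      (𝓝 (Complex.exp ψ)) := by
  have := isProbabilityMeasure_uniformBall (c := c) hR
  refine (Complex.tendsto_one_add_pow_exp_of_tendsto h).congr fun n => ?_
  have hm : Measurable fun ω => ∑ j ∈ Finset.range n, F n (Y j ω) :=
    Finset.measurable_sum _ fun j _ => (hF n).comp (hY.measurable j)
  have hme : Measurable fun y => Complex.exp (⟪F n y, ξ⟫ * Complex.I) := by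
    have := hF n
    fun_prop
  rw [charFun_apply, integral_map hm.aemeasurable (by fun_prop)]
  have h1 : ∀ ω, Complex.exp (⟪∑ j ∈ Finset.range n, F n (Y j ω), ξ⟫ * Complex.I) =
      ∏ j ∈ Finset.range n, Complex.exp (⟪F n (Y j ω), ξ⟫ * Complex.I) := by
    intro ω
    rw [← Complex.exp_sum, sum_inner, ← Finset.sum_mul]
    push_cast
    rfl
  simp_rw [h1]
  rw [hY.integral_prod n hme]
  have hintegr : Integrable (fun y => Complex.exp (⟪F n y, ξ⟫ * Complex.I)) (uniformBall c R) := by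
    refine Integrable.of_bound hme.aestronglyMeasurable 1 (Eventually.of_forall fun y => ?_)
    rw [Complex.norm_exp_ofReal_mul_I]
  rw [integral_sub hintegr (integrable_const _)]
  simp

/-- The contribution of a neighbour of energy `e` to the partition and energy sums. -/
def feature (α e : ℝ) : Euc 2 := !₂[Real.exp (-(α * e)), e * Real.exp (-(α * e))]

lemma continuous_feature (α : ℝ) : Continuous (feature α) := by
  unfold feature
  refine (PiLp.continuous_toLp 2 _).comp ?_
  refine continuous_pi fun i => ?_
  fin_cases i <;> simp <;> fun_prop

/-- Half of the exponent pays for the factor `e` in the second coordinate. -/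
lemma norm_feature_le {α e : ℝ} (hα : 0 < α) (he : 0 ≤ e) :
    ‖feature α e‖ ≤ (1 + 2 / α) * Real.exp (-(α / 2 * e)) := by
  have h1 : ‖feature α e‖ ≤ Real.exp (-(α * e)) + e * Real.exp (-(α * e)) := by
    rw [feature, EuclideanSpace.norm_eq, Fin.sum_univ_two]
    refine Real.sqrt_le_iff.2 ⟨by positivity, ?_⟩
    have ha : 0 ≤ Real.exp (-(α * e)) := (Real.exp_pos _).le
    have hb : 0 ≤ e * Real.exp (-(α * e)) := by positivity
    simp only [Real.norm_eq_abs, sq_abs]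
    show Real.exp (-(α * e)) ^ 2 + (e * Real.exp (-(α * e))) ^ 2 ≤ _
    nlinarith [mul_nonneg ha hb]
  have h2 : Real.exp (-(α * e)) = Real.exp (-(α / 2 * e)) * Real.exp (-(α / 2 * e)) := by
    rw [← Real.exp_add]; congr 1; ring
  have h3 : Real.exp (-(α / 2 * e)) ≤ 1 := Real.exp_le_one_iff.2 (by
    have : 0 ≤ α / 2 * e := by positivity
    linarith)
  have h4 : e * Real.exp (-(α / 2 * e)) ≤ 2 / α := by
    have h5 := Real.add_one_le_exp (α / 2 * e)
    rw [Real.exp_neg, ← div_eq_mul_inv, div_le_iff₀ (Real.exp_pos _)]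
    calc e = 2 / α * (α / 2 * e) := by field_simp
      _ ≤ _ := mul_le_mul_of_nonneg_left (by linarith) (by positivity)
  have h6 := Real.exp_pos (-(α / 2 * e))
  rw [h2] at h1
  nlinarith

/-- The integrand of the characteristic exponent of the limit law. -/
def phase (α : ℝ) (ξ : Euc 2) (e : ℝ) : ℂ := Complex.exp (⟪feature α e, ξ⟫ * Complex.I) - 1

lemma continuous_phase (α : ℝ) (ξ : Euc 2) : Continuous (phase α ξ) := by
  have := continuous_feature α
  unfold phase
  fun_prop

lemma norm_phase_le {α e : ℝ} (hα : 0 < α) (ξ : Euc 2) (he : 0 ≤ e) :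
    ‖phase α ξ e‖ ≤ (1 + 2 / α) * ‖ξ‖ * Real.exp (-(α / 2 * e)) := by
  have h1 : ‖phase α ξ e‖ ≤ ‖⟪feature α e, ξ⟫‖ := by
    unfold phase
    rw [mul_comm]
    exact Real.norm_exp_I_mul_ofReal_sub_one_le
  calc _ ≤ _ := h1
    _ ≤ ‖feature α e‖ * ‖ξ‖ := norm_inner_le_norm _ _
    _ ≤ (1 + 2 / α) * Real.exp (-(α / 2 * e)) * ‖ξ‖ :=
      mul_le_mul_of_nonneg_right (norm_feature_le hα he) (norm_nonneg _)
    _ = _ := by ring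

/-- The characteristic exponent of the limit law. -/
def phaseExponent {d : ℕ} (c : Euc d) (R α : ℝ) (ξ : Euc 2) : ℂ :=
  (volume.real (closedBall c R))⁻¹ • ∫ z : Euc d, phase α ξ (‖z‖ ^ 2 / 2)

/-- Continuity at the origin of the limiting characteristic function is what yields tightness of the
laws. -/
lemma continuousAt_phaseExponent {d : ℕ} (c : Euc d) (R : ℝ) {α : ℝ} (hα : 0 < α) :
    ContinuousAt (phaseExponent c R α) 0 := by
  suffices h : ContinuousAt (fun ξ => ∫ z : Euc d, phase α ξ (‖z‖ ^ 2 / 2)) 0 from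
    h.const_smul (volume.real (closedBall c R))⁻¹
  refine continuousAt_of_dominated (bound := fun z : Euc d =>
    (1 + 2 / α) * Real.exp (-(α / 4 * ‖z‖ ^ 2))) ?_ ?_ ?_ ?_
  · refine Eventually.of_forall fun ξ => ?_
    have := continuous_phase α ξ
    exact Continuous.aestronglyMeasurable (by fun_prop)
  · filter_upwards [ball_mem_nhds (0 : Euc 2) one_pos] with ξ hξ
    refine Eventually.of_forall fun z => ?_
    refine (norm_phase_le hα ξ (by positivity)).trans ?_
    have h1 : ‖ξ‖ ≤ 1 := by simpa using (mem_ball_zero_iff.1 hξ).le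
    have h2 : α / 2 * (‖z‖ ^ 2 / 2) = α / 4 * ‖z‖ ^ 2 := by ring
    rw [h2]
    refine mul_le_mul_of_nonneg_right ?_ (Real.exp_pos _).le
    exact mul_le_of_le_one_right (by positivity) h1
  · exact (integrable_exp_neg_mul_sq_norm d (by positivity)).const_mul _
  · refine Eventually.of_forall fun z => ?_
    unfold phase
    fun_prop

namespace MetricKernel
variable {d : ℕ} {c : Euc d} {R : ℝ} (κ : MetricKernel c R)

/-- The pair of the partition sum and the energy sum at precision `α`, seen from `y₀`, of the first
`n` points of `y`, in the scale at which it has a limit law. -/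
def scaledSums (α : ℝ) (n : ℕ) (y₀ : Euc d) (y : ℕ → Euc d) : Euc 2 :=
  ∑ j ∈ Finset.range n, feature α (precScale d n * κ.toFun y₀ (y j))

lemma measurable_feature_toFun (α : ℝ) (n : ℕ) (y₀ : Euc d) :
    Measurable fun y => feature α (precScale d n * κ.toFun y₀ y) :=
  (continuous_feature α).measurable.comp ((κ.measurable_right y₀).const_mul _)

lemma scaledSums_zero (α : ℝ) (n : ℕ) (y₀ : Euc d) (y : ℕ → Euc d) :
    κ.scaledSums α n y₀ y 0 =
      partitionSum (Finset.range n) (fun j => precScale d n * κ.toFun y₀ (y j)) α := by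
  simp [scaledSums, feature, partitionSum]

lemma scaledSums_one (α : ℝ) (n : ℕ) (y₀ : Euc d) (y : ℕ → Euc d) :
    κ.scaledSums α n y₀ y 1 =
      energySum (Finset.range n) (fun j => precScale d n * κ.toFun y₀ (y j)) α := by
  simp [scaledSums, feature, energySum]

variable {Ω : Type*} [MeasurableSpace Ω] {P : Measure Ω}
  {Y : ℕ → Ω → Euc d}

lemma measurable_scaledSums_uncurry (hY : IsUniformSample c R P Y) (α : ℝ) (n : ℕ) :
    Measurable fun p : Euc d × Ω => κ.scaledSums α n p.1 fun j => Y j p.2 := by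
  unfold scaledSums
  refine Finset.measurable_sum _ fun j _ => (continuous_feature α).measurable.comp ?_
  exact (κ.measurable.comp (measurable_fst.prodMk
    ((hY.measurable j).comp measurable_snd))).const_mul _

lemma measurable_scaledSums (hY : IsUniformSample c R P Y) (α : ℝ) (n : ℕ) (y₀ : Euc d) :
    Measurable fun ω => κ.scaledSums α n y₀ fun j => Y j ω := by
  unfold scaledSums
  exact Finset.measurable_sum _ fun j _ =>
    (κ.measurable_feature_toFun α n y₀).comp (hY.measurable j)

lemma tendsto_integral_phase (hd : 0 < d) {α : ℝ} (hα : 0 < α) (ξ : Euc 2) {y₀ : Euc d}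
    (h0 : y₀ ∈ ball c R) :
    Tendsto (fun n : ℕ => n * ∫ y, phase α ξ (precScale d n * κ.toFun y₀ y) ∂uniformBall c R) atTop
      (𝓝 (phaseExponent c R α ξ)) :=
  κ.tendsto_integral hd (continuous_phase α ξ) (half_pos hα)
    (fun _ he => norm_phase_le hα ξ he) h0

lemma tendsto_charFun_scaledSums (hd : 0 < d) (hR : 0 < R) (hY : IsUniformSample c R P Y) {α : ℝ}
    (hα : 0 < α) (ξ : Euc 2) {y₀ : Euc d} (h0 : y₀ ∈ ball c R) :
    Tendsto (fun n : ℕ => charFun (P.map fun ω => κ.scaledSums α n y₀ fun j => Y j ω) ξ) atTop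
      (𝓝 (Complex.exp (phaseExponent c R α ξ))) :=
  hY.tendsto_charFun_sum hR (F := fun n y => feature α (precScale d n * κ.toFun y₀ y))
    (κ.measurable_feature_toFun α · y₀) (κ.tendsto_integral_phase hd hα ξ h0)

lemma integrable_phase (hR : 0 < R) (α : ℝ) (n : ℕ) (ξ : Euc 2) (y₀ : Euc d) :
    Integrable (fun y => phase α ξ (precScale d n * κ.toFun y₀ y)) (uniformBall c R) := by
  have := isProbabilityMeasure_uniformBall (c := c) hR
  refine Integrable.of_bound ((continuous_phase α ξ).measurable.comp
    ((κ.measurable_right y₀).const_mul _)).aestronglyMeasurable 2 (Eventually.of_forall fun y => ?_)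
  refine (norm_sub_le _ _).trans ?_
  rw [Complex.norm_exp_ofReal_mul_I, norm_one]
  norm_num

/-- Each phase is dominated by a decaying exponential of its energy, and such exponentials centred
at distinct points do not interact. -/
lemma tendsto_integral_phase_mul (hd : 0 < d) (hR : 0 < R) {α : ℝ} (hα : 0 < α) (ξ ζ : Euc 2)
    {y₀ y₁ : Euc d} (h0 : y₀ ∈ ball c R) (h1 : y₁ ∈ ball c R) (hne : y₀ ≠ y₁) :
    Tendsto (fun n : ℕ => n * ∫ y, phase α ξ (precScale d n * κ.toFun y₀ y) *
      phase α ζ (precScale d n * κ.toFun y₁ y) ∂uniformBall c R) atTop (𝓝 0) := by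
  have := isProbabilityMeasure_uniformBall (c := c) hR
  have h0' := ball_subset_closedBall h0
  have h1' := ball_subset_closedBall h1
  set K : ℝ := (1 + 2 / α) * ‖ξ‖ * ((1 + 2 / α) * ‖ζ‖) with hK
  have h := (κ.tendsto_integral_mul hd hR (half_pos hα) h0' h1' hne).const_mul K
  rw [mul_zero] at h
  refine squeeze_zero_norm (fun n => ?_) h
  rw [norm_mul, Complex.norm_natCast, mul_left_comm, ← integral_const_mul]
  refine mul_le_mul_of_nonneg_left ?_ (by positivity)
  refine norm_integral_le_of_norm_le ?_ ?_
  · refine Integrable.const_mul ?_ _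
    refine Integrable.of_bound (C := 1) ?_ ?_
    · have := κ.measurable_right y₀
      have := κ.measurable_right y₁
      exact Measurable.aestronglyMeasurable (by fun_prop)
    · filter_upwards [ae_mem_uniformBall (c := c) (R := R)] with y hy
      have e0 := mul_nonneg (precScale_nonneg d n) (κ.nonneg h0' hy)
      have e1 := mul_nonneg (precScale_nonneg d n) (κ.nonneg h1' hy)
      rw [← Real.exp_add, Real.norm_of_nonneg (Real.exp_pos _).le, Real.exp_le_one_iff]
      have := mul_nonneg (half_pos hα).le e0
      have := mul_nonneg (half_pos hα).le e1
      linarith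
  · filter_upwards [ae_mem_uniformBall (c := c) (R := R)] with y hy
    have e0 := mul_nonneg (precScale_nonneg d n) (κ.nonneg h0' hy)
    have e1 := mul_nonneg (precScale_nonneg d n) (κ.nonneg h1' hy)
    rw [norm_mul]
    calc _ ≤ _ := mul_le_mul (norm_phase_le hα ξ e0) (norm_phase_le hα ζ e1) (norm_nonneg _)
          (by positivity)
      _ = _ := by rw [hK]; ring

/-- From `exp (u + v) - 1 = (exp u - 1) + (exp v - 1) + (exp u - 1)(exp v - 1)` with negligible
cross term, the exponents add in the limit: the sums at distinct points are asymptotically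
independent. -/
lemma tendsto_charFun_scaledSums_prod (hd : 0 < d) (hR : 0 < R) (hY : IsUniformSample c R P Y)
    {α : ℝ} (hα : 0 < α) (ξ : WithLp 2 (Euc 2 × Euc 2)) {y₀ y₁ : Euc d} (h0 : y₀ ∈ ball c R)
    (h1 : y₁ ∈ ball c R) (hne : y₀ ≠ y₁) :
    Tendsto (fun n : ℕ => charFun (P.map fun ω => WithLp.toLp 2
        (κ.scaledSums α n y₀ (fun j => Y j ω), κ.scaledSums α n y₁ fun j => Y j ω)) ξ) atTop
      (𝓝 (Complex.exp (phaseExponent c R α ξ.fst) * Complex.exp (phaseExponent c R α ξ.snd))) := by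
  rw [← Complex.exp_add]
  have := isProbabilityMeasure_uniformBall (c := c) hR
  have hF : ∀ n : ℕ, Measurable fun y => WithLp.toLp 2 (feature α (precScale d n * κ.toFun y₀ y),
      feature α (precScale d n * κ.toFun y₁ y)) := fun n =>
    (WithLp.measurable_toLp 2 _).comp
      ((κ.measurable_feature_toFun α n y₀).prodMk (κ.measurable_feature_toFun α n y₁))
  have key := hY.tendsto_charFun_sum hR hF (ξ := ξ)
    (ψ := phaseExponent c R α ξ.fst + phaseExponent c R α ξ.snd) ?_
  · refine key.congr fun n => ?_
    congr 2
    ext1 ω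
    rw [← WithLp.toLp_sum]
    congr 1
    ext1 <;> simp [scaledSums, Prod.fst_sum, Prod.snd_sum]
  · have h := ((κ.tendsto_integral_phase hd hα ξ.fst h0).add
      (κ.tendsto_integral_phase hd hα ξ.snd h1)).add
      (κ.tendsto_integral_phase_mul hd hR hα ξ.fst ξ.snd h0 h1 hne)
    rw [add_zero] at h
    refine h.congr fun n => ?_
    have i0 := κ.integrable_phase hR α n ξ.fst y₀
    have i1 := κ.integrable_phase hR α n ξ.snd y₁
    have i2 : Integrable (fun y => phase α ξ.fst (precScale d n * κ.toFun y₀ y) *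
        phase α ξ.snd (precScale d n * κ.toFun y₁ y)) (uniformBall c R) := by
      refine i1.bdd_mul (c := 2) i0.aestronglyMeasurable (Eventually.of_forall fun y => ?_)
      refine (norm_sub_le _ _).trans ?_
      rw [Complex.norm_exp_ofReal_mul_I, norm_one]
      norm_num
    rw [← mul_add, ← mul_add, ← integral_add i0 i1]
    erw [← integral_add (i0.add i1) i2]
    congr 1
    refine integral_congr_ae (Eventually.of_forall fun y => ?_)
    simp only [phase, WithLp.prod_inner_apply, Pi.add_apply, WithLp.fst, WithLp.snd]
    push_cast
    rw [add_mul, Complex.exp_add]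
    ring

end MetricKernel

/-- There is a limit law of the scaled partition and energy sums. -/
lemma exists_limitLaw {d : ℕ} (hd : 0 < d) (c : Euc d) {R : ℝ} (hR : 0 < R) {α : ℝ} (hα : 0 < α) :
    ∃ ν : ProbabilityMeasure (Euc 2), ∀ ξ,
      charFun (ν : Measure (Euc 2)) ξ = Complex.exp (phaseExponent c R α ξ) := by
  have := isProbabilityMeasure_uniformBall (c := c) hR
  obtain ⟨Ω, _, P, Y, hm, hl, hi, _⟩ := exists_iid ℕ (uniformBall c R)
  have hY : IsUniformSample c R P Y := ⟨hm, hi, fun i => (hl i).map_eq⟩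
  -- Any kernel and any interior point would serve, as `phaseExponent` mentions neither. Tightness
  -- makes the closure of the laws compact, and the limit along an ultrafilter has the required
  -- characteristic function.
  set κ := euclideanKernel c R
  let μ : ℕ → ProbabilityMeasure (Euc 2) := fun n =>
    ⟨P.map fun ω => κ.scaledSums α n c fun j => Y j ω,
      Measure.isProbabilityMeasure_map (κ.measurable_scaledSums hY α n c).aemeasurable⟩
  have hlim : ∀ ξ, Tendsto (fun n => charFun (μ n : Measure (Euc 2)) ξ) atTop
      (𝓝 (Complex.exp (phaseExponent c R α ξ))) := fun ξ =>
    κ.tendsto_charFun_scaledSums hd hR hY hα ξ (mem_ball_self hR)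
  have htight : IsTightMeasureSet {((μ n : ProbabilityMeasure (Euc 2)) : Measure (Euc 2)) | n} :=
    isTightMeasureSet_of_tendsto_charFun
      (Complex.continuous_exp.continuousAt.comp (continuousAt_phaseExponent c R hα)) hlim
  have hcomp : IsCompact (closure {μ n | n}) :=
    isCompact_closure_of_isTightMeasureSet (by simpa using htight)
  obtain ⟨U, hU⟩ := Ultrafilter.exists_le (atTop : Filter ℕ)
  obtain ⟨ν, -, hν : Tendsto _ _ _⟩ := hcomp.ultrafilter_le_nhds (U.map μ)
    (.trans (by simp) (monotone_principal subset_closure))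
  refine ⟨ν, fun ξ => tendsto_nhds_unique ?_ ((hlim ξ).mono_left hU)⟩
  rw [ProbabilityMeasure.tendsto_iff_forall_integral_rclike_tendsto ℂ] at hν
  simp_rw [charFun_eq_integral_innerProbChar]
  exact hν _

/-- The limit law of the scaled partition and energy sums. -/
def limitLaw {d : ℕ} (hd : 0 < d) (c : Euc d) {R : ℝ} (hR : 0 < R) {α : ℝ} (hα : 0 < α) :
    ProbabilityMeasure (Euc 2) := (exists_limitLaw hd c hR hα).choose

lemma charFun_limitLaw {d : ℕ} (hd : 0 < d) (c : Euc d) {R : ℝ} (hR : 0 < R) {α : ℝ} (hα : 0 < α)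
    (ξ : Euc 2) :
    charFun (limitLaw hd c hR hα : Measure (Euc 2)) ξ = Complex.exp (phaseExponent c R α ξ) :=
  (exists_limitLaw hd c hR hα).choose_spec ξ

namespace MetricKernel
variable {d : ℕ} {c : Euc d} {R : ℝ} (κ : MetricKernel c R)
  {Ω : Type*} [MeasurableSpace Ω] {P : Measure Ω} [IsProbabilityMeasure P] {Y : ℕ → Ω → Euc d}

/-- The pair converges in law to the product of two copies of the limit law, and `g ⊗ g` is a
bounded continuous test function. -/
lemma tendsto_integral_scaledSums_mul (hd : 0 < d) (hR : 0 < R) (hY : IsUniformSample c R P Y)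
    {α : ℝ} (hα : 0 < α) (g : Euc 2 →ᵇ ℝ) {y₀ y₁ : Euc d} (h0 : y₀ ∈ ball c R)
    (h1 : y₁ ∈ ball c R) (hne : y₀ ≠ y₁) :
    Tendsto (fun n : ℕ => ∫ ω, g (κ.scaledSums α n y₀ fun j => Y j ω) *
        g (κ.scaledSums α n y₁ fun j => Y j ω) ∂P) atTop
      (𝓝 ((∫ x, g x ∂(limitLaw hd c hR hα : Measure (Euc 2))) ^ 2)) := by
  have hm : ∀ n, Measurable fun ω => WithLp.toLp 2
      (κ.scaledSums α n y₀ (fun j => Y j ω), κ.scaledSums α n y₁ fun j => Y j ω) := fun n =>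
    (WithLp.measurable_toLp 2 _).comp ((κ.measurable_scaledSums hY α n y₀).prodMk
      (κ.measurable_scaledSums hY α n y₁))
  let μ : ℕ → ProbabilityMeasure (WithLp 2 (Euc 2 × Euc 2)) := fun n =>
    ⟨P.map fun ω => WithLp.toLp 2
      (κ.scaledSums α n y₀ (fun j => Y j ω), κ.scaledSums α n y₁ fun j => Y j ω),
      Measure.isProbabilityMeasure_map (hm n).aemeasurable⟩
  set ν := limitLaw hd c hR hα with hν
  have hmL : Measurable (WithLp.toLp 2 : Euc 2 × Euc 2 → WithLp 2 (Euc 2 × Euc 2)) :=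
    WithLp.measurable_toLp 2 _
  let π : ProbabilityMeasure (WithLp 2 (Euc 2 × Euc 2)) :=
    ⟨((ν : Measure (Euc 2)).prod (ν : Measure (Euc 2))).map (WithLp.toLp 2),
      Measure.isProbabilityMeasure_map hmL.aemeasurable⟩
  have h : Tendsto μ atTop (𝓝 π) := by
    refine ProbabilityMeasure.tendsto_of_tendsto_charFun fun ξ => ?_
    have e : charFun (π : Measure (WithLp 2 (Euc 2 × Euc 2))) ξ = _ :=
      charFun_prod (μ := (ν : Measure (Euc 2))) (ν := (ν : Measure (Euc 2))) ξ
    rw [e, hν, charFun_limitLaw, charFun_limitLaw]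
    exact κ.tendsto_charFun_scaledSums_prod hd hR hY hα ξ h0 h1 hne
  rw [ProbabilityMeasure.tendsto_iff_forall_integral_tendsto] at h
  have hc1 : Continuous fun x : WithLp 2 (Euc 2 × Euc 2) => x.fst := by fun_prop
  have hc2 : Continuous fun x : WithLp 2 (Euc 2 × Euc 2) => x.snd := by fun_prop
  let G : WithLp 2 (Euc 2 × Euc 2) →ᵇ ℝ :=
    (g.compContinuous ⟨_, hc1⟩) * (g.compContinuous ⟨_, hc2⟩)
  have h2 := h G
  have e2 : ∫ x, G x ∂(π : Measure (WithLp 2 (Euc 2 × Euc 2))) =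
      (∫ x, g x ∂(ν : Measure (Euc 2))) ^ 2 := by
    show ∫ x, G x ∂(((ν : Measure (Euc 2)).prod (ν : Measure (Euc 2))).map (WithLp.toLp 2)) = _
    rw [integral_map hmL.aemeasurable G.continuous.aestronglyMeasurable, sq, ← integral_prod_mul]
    rfl
  rw [e2] at h2
  refine h2.congr fun n => ?_
  exact integral_map (hm n).aemeasurable G.continuous.aestronglyMeasurable

end MetricKernel
end NeighbourEmbedding
end

noncomputable section
namespace NeighbourEmbedding
open MeasureTheory ProbabilityTheory Matrix Filter Topology Metric
open scoped RealInnerProductSpace BoundedContinuousFunction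

/-! ### Elementary estimates for samples -/

namespace IsUniformSample
variable {d : ℕ} {Ω : Type*} [MeasurableSpace Ω] {c : Euc d} {R : ℝ}
    {P : Measure Ω} {Y : ℕ → Ω → Euc d}

lemma ae_mem (hY : IsUniformSample c R P Y) : ∀ᵐ ω ∂P, ∀ j, Y j ω ∈ closedBall c R := by
  refine ae_all_iff.2 fun j => ?_
  have h : ∀ᵐ y ∂P.map (Y j), y ∈ closedBall c R := by
    rw [hY.law j]
    exact ae_mem_uniformBall
  exact ae_of_ae_map (hY.measurable j).aemeasurable h

lemma integral_comp (hY : IsUniformSample c R P Y) (j : ℕ) {g : Euc d → ℝ} (hg : Measurable g) :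
    ∫ ω, g (Y j ω) ∂P = ∫ y, g y ∂uniformBall c R := by
  rw [← hY.law j, integral_map (hY.measurable j).aemeasurable hg.aestronglyMeasurable]

lemma measureReal_forall_notMem_le (hY : IsUniformSample c R P Y) (hR : 0 < R) (n : ℕ)
    {s : Set (Euc d)} (hs : MeasurableSet s) :
    P.real {ω | ∀ j < n, Y j ω ∉ s} ≤ Real.exp (-(n * (uniformBall c R).real s)) := by
  have := isProbabilityMeasure_uniformBall (c := c) hR
  have h1 := hY.integral_prod n (g := sᶜ.indicator (1 : Euc d → ℝ))
    (measurable_one.indicator hs.compl)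
  rw [integral_indicator_one hs.compl, measureReal_compl hs] at h1
  have h2 : ∀ ω, ∏ j ∈ Finset.range n, sᶜ.indicator (1 : Euc d → ℝ) (Y j ω) =
      {ω | ∀ j < n, Y j ω ∉ s}.indicator (1 : Ω → ℝ) ω := by
    intro ω
    by_cases h : ∀ j < n, Y j ω ∉ s
    · rw [Set.indicator_of_mem (by exact h)]
      refine Finset.prod_eq_one fun j hj => ?_
      rw [Set.indicator_of_mem (by exact h j (Finset.mem_range.1 hj))]
      rfl
    · rw [Set.indicator_of_notMem (by exact h)]
      push Not at h
      obtain ⟨j, hj, hjs⟩ := h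
      exact Finset.prod_eq_zero (Finset.mem_range.2 hj)
        (Set.indicator_of_notMem (by simpa using hjs) _)
  simp_rw [h2] at h1
  have hms : MeasurableSet {ω | ∀ j < n, Y j ω ∉ s} := by
    have : {ω | ∀ j < n, Y j ω ∉ s} = ⋂ j, ⋂ _ : j < n, (Y j ⁻¹' s)ᶜ := by ext; simp
    rw [this]
    exact MeasurableSet.iInter fun j => MeasurableSet.iInter fun _ =>
      (hY.measurable j hs).compl
  rw [integral_indicator_one hms] at h1
  rw [h1, ← mul_neg, mul_comm, Real.exp_mul, Real.rpow_natCast]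
  have h3 : (uniformBall c R).real Set.univ = 1 := by simp
  rw [h3]
  refine pow_le_pow_left₀ ?_ ?_ n
  · have := measureReal_le_one (μ := uniformBall c R) (s := s)
    linarith
  · have := Real.add_one_le_exp (-(uniformBall c R).real s)
    linarith

variable [IsProbabilityMeasure P]

lemma map_prod (hY : IsUniformSample c R P Y) {i j : ℕ} (hij : i ≠ j) :
    P.map (fun ω => (Y i ω, Y j ω)) = (uniformBall c R).prod (uniformBall c R) := by
  rw [(indepFun_iff_map_prod_eq_prod_map_map (hY.measurable i).aemeasurable
    (hY.measurable j).aemeasurable).1 (hY.indep.indepFun hij), hY.law, hY.law]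

/-- Chernoff's bound for the lower tail, with exponential parameter one. -/
lemma measureReal_sum_lt_le (hY : IsUniformSample c R P Y) (n : ℕ) {g : Euc d → ℝ}
    (hg : Measurable g) (hg0 : ∀ y, 0 ≤ g y)
    (a : ℝ) : P.real {ω | ∑ j ∈ Finset.range n, g (Y j ω) < a} ≤
      Real.exp a * (∫ y, Real.exp (-g y) ∂uniformBall c R) ^ n := by
  have hm : Measurable fun ω => ∑ j ∈ Finset.range n, g (Y j ω) :=
    Finset.measurable_sum _ fun j _ => hg.comp (hY.measurable j)
  have h0 : ∀ ω, 0 ≤ ∑ j ∈ Finset.range n, g (Y j ω) := fun ω =>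
    Finset.sum_nonneg fun j _ => hg0 _
  have h1 : Real.exp (-a) * P.real {ω | Real.exp (-a) ≤
      Real.exp (-∑ j ∈ Finset.range n, g (Y j ω))} ≤
      ∫ ω, Real.exp (-∑ j ∈ Finset.range n, g (Y j ω)) ∂P := by
    refine mul_meas_ge_le_integral_of_nonneg (Eventually.of_forall fun ω => (Real.exp_pos _).le)
      ?_ _
    refine Integrable.of_bound hm.neg.exp.aestronglyMeasurable 1 (Eventually.of_forall fun ω => ?_)
    rw [Real.norm_of_nonneg (Real.exp_pos _).le, Real.exp_le_one_iff]
    linarith [h0 ω]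
  have h2 : ∫ ω, Real.exp (-∑ j ∈ Finset.range n, g (Y j ω)) ∂P =
      (∫ y, Real.exp (-g y) ∂uniformBall c R) ^ n := by
    rw [← hY.integral_prod n (g := fun y => Real.exp (-g y)) hg.neg.exp]
    refine integral_congr_ae (Eventually.of_forall fun ω => ?_)
    simp only [← Finset.sum_neg_distrib, Real.exp_sum]
  rw [h2] at h1
  have h3 : P.real {ω | ∑ j ∈ Finset.range n, g (Y j ω) < a} ≤ P.real {ω | Real.exp (-a) ≤
      Real.exp (-∑ j ∈ Finset.range n, g (Y j ω))} := by
    refine measureReal_mono fun ω hω => ?_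
    simp only [Set.mem_ofPred_eq] at hω ⊢
    exact Real.exp_le_exp.2 (by linarith)
  calc _ ≤ _ := h3
    _ = Real.exp a * (Real.exp (-a) * P.real {ω | Real.exp (-a) ≤
      Real.exp (-∑ j ∈ Finset.range n, g (Y j ω))}) := by
        rw [← mul_assoc, ← Real.exp_add]; simp
    _ ≤ _ := mul_le_mul_of_nonneg_left h1 (Real.exp_pos _).le

lemma measureReal_le_sum_le (hY : IsUniformSample c R P Y) (n : ℕ) {g : Euc d → ℝ}
    (hg : Measurable g) {b : ℝ}
    (hg0 : ∀ y ∈ closedBall c R, 0 ≤ g y) (hgb : ∀ y ∈ closedBall c R, g y ≤ b) {a : ℝ}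
    (ha : 0 < a) : P.real {ω | a ≤ ∑ j ∈ Finset.range n, g (Y j ω)} ≤
      n * (∫ y, g y ∂uniformBall c R) / a := by
  have hintegr : ∀ j, Integrable (fun ω => g (Y j ω)) P := by
    intro j
    refine Integrable.of_bound (hg.comp (hY.measurable j)).aestronglyMeasurable b ?_
    filter_upwards [hY.ae_mem] with ω hω
    rw [Real.norm_of_nonneg (hg0 _ (hω j))]
    exact hgb _ (hω j)
  have h1 : a * P.real {ω | a ≤ ∑ j ∈ Finset.range n, g (Y j ω)} ≤
      ∫ ω, ∑ j ∈ Finset.range n, g (Y j ω) ∂P := by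
    refine mul_meas_ge_le_integral_of_nonneg ?_ (integrable_finsetSum _ fun j _ => hintegr j) _
    filter_upwards [hY.ae_mem] with ω hω
    exact Finset.sum_nonneg fun j _ => hg0 _ (hω j)
  rw [integral_finsetSum _ fun j _ => hintegr j] at h1
  simp_rw [hY.integral_comp _ hg] at h1
  rw [Finset.sum_const, Finset.card_range, nsmul_eq_mul] at h1
  rwa [le_div_iff₀ ha, mul_comm]

end IsUniformSample

/-- The linear ramp from `0` at `0` to `1` at `η`. -/
def ramp (η t : ℝ) : ℝ := max 0 (min 1 (t / η))

lemma continuous_ramp (η : ℝ) : Continuous (ramp η) := by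
  unfold ramp
  fun_prop

lemma ramp_nonneg (η t : ℝ) : 0 ≤ ramp η t := le_max_left _ _

lemma ramp_le_one (η t : ℝ) : ramp η t ≤ 1 := max_le zero_le_one (min_le_left _ _)

lemma ramp_eq_zero {η t : ℝ} (hη : 0 < η) (ht : t ≤ 0) : ramp η t = 0 := by
  refine max_eq_left ((min_le_right _ _).trans ?_)
  exact div_nonpos_of_nonpos_of_nonneg ht hη.le

lemma ramp_eq_one {η t : ℝ} (hη : 0 < η) (ht : η ≤ t) : ramp η t = 1 := by
  rw [ramp, min_eq_left ((one_le_div hη).2 ht)]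
  exact max_eq_right zero_le_one

/-- The excess entropy as a function of the partition and energy sums, cut off by a ramp. -/
def rampExcess (ρ α η : ℝ) : Euc 2 →ᵇ ℝ :=
  BoundedContinuousFunction.ofNormedAddCommGroup
    (fun x => ramp η (x 0 * Real.log (x 0) + α * x 1 - x 0 * Real.log ρ))
    (by
      refine (continuous_ramp η).comp ?_
      have h0 : Continuous fun x : Euc 2 => x 0 := by fun_prop
      have := Real.continuous_mul_log.comp h0
      simp only [Function.comp_def] at this
      fun_prop) 1
    (fun x => by rw [Real.norm_of_nonneg (ramp_nonneg _ _)]; exact ramp_le_one _ _)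

lemma MetricKernel.rampExcess_scaledSums {d : ℕ} {c : Euc d} {R : ℝ} (κ : MetricKernel c R)
    (ρ α η : ℝ) (n : ℕ) (y₀ : Euc d) (y : ℕ → Euc d) :
    rampExcess ρ α η (κ.scaledSums α n y₀ y) = ramp η (entropyExcess ρ (Finset.range n)
      (fun j => precScale d n * κ.toFun y₀ (y j)) α) := by
  show ramp η _ = _
  rw [κ.scaledSums_zero, κ.scaledSums_one]
  rfl

lemma measurable_mul_pair {X Ω : Type*} [MeasurableSpace X] [MeasurableSpace Ω] {Φ : X × Ω → ℝ}
    (hm : Measurable Φ) :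
    Measurable fun q : (X × X) × Ω => Φ (q.1.1, q.2) * Φ (q.1.2, q.2) :=
  (hm.comp ((measurable_fst.comp measurable_fst).prodMk measurable_snd)).mul
    (hm.comp ((measurable_snd.comp measurable_fst).prodMk measurable_snd))

/-- The second moment of a spatial average is an average over pairs of points of a mixed moment, to
which asymptotic independence applies. -/
lemma integral_sq_integral_eq {X Ω : Type*} [MeasurableSpace X] [MeasurableSpace Ω]
    {μ : Measure X} {P : Measure Ω} [IsProbabilityMeasure μ] [IsProbabilityMeasure P]
    {Φ : X × Ω → ℝ} (hm : Measurable Φ) {C : ℝ} (hC : ∀ q, ‖Φ q‖ ≤ C) :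
    ∫ ω, (∫ x, Φ (x, ω) ∂μ) ^ 2 ∂P = ∫ z, ∫ ω, Φ (z.1, ω) * Φ (z.2, ω) ∂P ∂(μ.prod μ) := by
  rw [integral_integral_swap]
  · refine integral_congr_ae (Eventually.of_forall fun ω => ?_)
    simp only
    rw [integral_prod_mul (fun x => Φ (x, ω)) (fun x => Φ (x, ω)), ← sq]
  · refine Integrable.of_bound (C := C * C) (measurable_mul_pair hm).aestronglyMeasurable
      (Eventually.of_forall fun z => ?_)
    rw [Function.uncurry, norm_mul]
    exact mul_le_mul (hC _) (hC _) (norm_nonneg _) ((norm_nonneg _).trans (hC (z.1.1, z.2)))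

/-- Asymptotic independence holds only off the diagonal, which is therefore discarded as a null set.
-/
lemma prod_uniformBall_diagonal {d : ℕ} (hd : 0 < d) (c : Euc d) {R : ℝ} (hR : 0 < R) :
    ∀ᵐ z ∂(uniformBall c R).prod (uniformBall c R), z.1 ≠ z.2 := by
  have := isProbabilityMeasure_uniformBall (c := c) hR
  have hm : MeasurableSet {z : Euc d × Euc d | z.1 ≠ z.2} :=
    (measurableSet_eq_fun measurable_fst measurable_snd).compl
  refine (Measure.ae_prod_iff_ae_ae hm).2 (Eventually.of_forall fun x => ?_)
  have h : uniformBall c R {x} = 0 := uniformBall_singleton hd x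
  rw [ae_iff]
  convert h using 2
  ext y
  simp [eq_comm]

/-! ### Concentration of spatial averages by the second moment method. -/

namespace MetricKernel
variable {d : ℕ} {c : Euc d} {R : ℝ} (κ : MetricKernel c R)
  {Ω : Type*} [MeasurableSpace Ω] {P : Measure Ω} [IsProbabilityMeasure P] {Y : ℕ → Ω → Euc d}

/-- Spatial averages of functions of the scaled sums concentrate. -/
lemma tendsto_integral_sq_average (hd : 0 < d) (hR : 0 < R) (hY : IsUniformSample c R P Y) {α : ℝ}
    (hα : 0 < α) (g : Euc 2 →ᵇ ℝ) :
    Tendsto (fun n : ℕ => ∫ ω, (∫ y₀, g (κ.scaledSums α n y₀ fun j => Y j ω) ∂uniformBall c R -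
      ∫ x, g x ∂(limitLaw hd c hR hα : Measure (Euc 2))) ^ 2 ∂P) atTop (𝓝 0) := by
  have := isProbabilityMeasure_uniformBall (c := c) hR
  set p := ∫ x, g x ∂(limitLaw hd c hR hα : Measure (Euc 2)) with hp
  -- After centring `g` under the limit law, the mixed moments at distinct interior points tend to
  -- zero, and dominated convergence over pairs finishes the argument.
  obtain ⟨g', hg'e⟩ : ∃ g' : Euc 2 →ᵇ ℝ, ∀ x, g' x = g x - p :=
    ⟨g - BoundedContinuousFunction.const _ p, fun x => rfl⟩
  have hg'0 : ∫ x, g' x ∂(limitLaw hd c hR hα : Measure (Euc 2)) = 0 := by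
    simp_rw [hg'e]
    rw [integral_sub (g.integrable _) (integrable_const _)]
    simp [hp]
  have hmg : ∀ n, Measurable fun p : Euc d × Ω => g (κ.scaledSums α n p.1 fun j => Y j p.2) :=
    fun n => g.continuous.measurable.comp (κ.measurable_scaledSums_uncurry hY α n)
  have hmg' : ∀ n, Measurable fun p : Euc d × Ω => g' (κ.scaledSums α n p.1 fun j => Y j p.2) :=
    fun n => g'.continuous.measurable.comp (κ.measurable_scaledSums_uncurry hY α n)
  have key : ∀ n : ℕ, ∫ z, ∫ ω, g' (κ.scaledSums α n z.1 fun j => Y j ω) *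
        g' (κ.scaledSums α n z.2 fun j => Y j ω) ∂P ∂((uniformBall c R).prod (uniformBall c R)) =
      ∫ ω, (∫ y₀, g (κ.scaledSums α n y₀ fun j => Y j ω) ∂uniformBall c R - p) ^ 2 ∂P := by
    intro n
    rw [← integral_sq_integral_eq (μ := uniformBall c R) (hmg' n)
      (fun q => g'.norm_coe_le_norm _)]
    refine integral_congr_ae (Eventually.of_forall fun ω => ?_)
    simp only
    congr 1
    simp_rw [hg'e]
    rw [integral_sub _ (integrable_const _)]
    · simp
    · exact Integrable.of_bound (C := ‖g‖) ((hmg n).comp measurable_prodMk_right).aestronglyMeasurable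
        (Eventually.of_forall fun y => g.norm_coe_le_norm _)
  simp_rw [← key]
  have h0 : ∫ _, (0 : ℝ) ∂((uniformBall c R).prod (uniformBall c R)) = 0 := by simp
  rw [← h0]
  refine tendsto_integral_of_dominated_convergence (fun _ => ‖g'‖ * ‖g'‖) ?_ (integrable_const _)
    ?_ ?_
  · intro n
    refine (StronglyMeasurable.integral_prod_right ?_).aestronglyMeasurable
    exact (measurable_mul_pair (hmg' n)).stronglyMeasurable
  · intro n
    refine Eventually.of_forall fun z => ?_
    refine (norm_integral_le_of_norm_le_const (C := ‖g'‖ * ‖g'‖)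
      (Eventually.of_forall fun ω => ?_)).trans (by simp)
    rw [norm_mul]
    exact mul_le_mul (g'.norm_coe_le_norm _) (g'.norm_coe_le_norm _) (norm_nonneg _)
      (norm_nonneg _)
  · have h1 : ∀ᵐ z ∂(uniformBall c R).prod (uniformBall c R), z.1 ∈ ball c R :=
      Measure.quasiMeasurePreserving_fst.ae (ae_mem_ball_uniformBall hd)
    have h2 : ∀ᵐ z ∂(uniformBall c R).prod (uniformBall c R), z.2 ∈ ball c R :=
      Measure.quasiMeasurePreserving_snd.ae (ae_mem_ball_uniformBall hd)
    filter_upwards [h1, h2, prod_uniformBall_diagonal hd c hR] with z hz1 hz2 hne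
    have h := κ.tendsto_integral_scaledSums_mul hd hR hY hα g' hz1 hz2 hne
    rw [hg'0] at h
    simpa using h

lemma tendsto_measureReal_average (hd : 0 < d) (hR : 0 < R) (hY : IsUniformSample c R P Y) {α : ℝ}
    (hα : 0 < α) (g : Euc 2 →ᵇ ℝ) {ε : ℝ} (hε : 0 < ε) :
    Tendsto (fun n : ℕ => P.real {ω | ε ≤
      |∫ y₀, g (κ.scaledSums α n y₀ fun j => Y j ω) ∂uniformBall c R -
      ∫ x, g x ∂(limitLaw hd c hR hα : Measure (Euc 2))|}) atTop (𝓝 0) := by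
  have := isProbabilityMeasure_uniformBall (c := c) hR
  have h := (κ.tendsto_integral_sq_average hd hR hY hα g).const_mul (ε ^ 2)⁻¹
  rw [mul_zero] at h
  refine squeeze_zero (fun _ => measureReal_nonneg) (fun n => ?_) h
  set p := ∫ x, g x ∂(limitLaw hd c hR hα : Measure (Euc 2)) with hp
  have hm : Measurable fun ω =>
      ∫ y₀, g (κ.scaledSums α n y₀ fun j => Y j ω) ∂uniformBall c R := by
    refine (StronglyMeasurable.integral_prod_left'
      (f := fun q : Euc d × Ω => g (κ.scaledSums α n q.1 fun j => Y j q.2)) ?_).measurable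
    exact (g.continuous.measurable.comp
      (κ.measurable_scaledSums_uncurry hY α n)).stronglyMeasurable
  have h1 := mul_meas_ge_le_integral_of_nonneg (μ := P)
    (f := fun ω => (∫ y₀, g (κ.scaledSums α n y₀ fun j => Y j ω) ∂uniformBall c R - p) ^ 2)
    (Eventually.of_forall fun ω => sq_nonneg _) ?_ (ε ^ 2)
  · rw [← div_eq_inv_mul, le_div_iff₀ (by positivity), mul_comm]
    refine le_trans (mul_le_mul_of_nonneg_left (measureReal_mono fun ω hω => ?_)
      (sq_nonneg _)) h1
    simp only [Set.mem_ofPred_eq] at hω ⊢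
    rw [← sq_abs (_ - p)]
    exact pow_le_pow_left₀ hε.le hω 2
  · refine Integrable.of_bound (C := (‖g‖ + |p|) ^ 2)
      ((hm.sub_const p).pow_const 2).aestronglyMeasurable (Eventually.of_forall fun ω => ?_)
    rw [norm_pow]
    refine pow_le_pow_left₀ (norm_nonneg _) ((norm_sub_le _ _).trans (add_le_add ?_ le_rfl)) 2
    refine (norm_integral_le_of_norm_le_const (C := ‖g‖)
      (Eventually.of_forall fun y => g.norm_coe_le_norm _)).trans (by simp)

end MetricKernel
end NeighbourEmbedding
end

noncomputable section
namespace NeighbourEmbedding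
open MeasureTheory ProbabilityTheory Matrix Filter Topology Metric

/-! ### Nondegeneracy and tails of the scaled precision -/

lemma measureReal_le_of_ae {Ω : Type*} [MeasurableSpace Ω] {P : Measure Ω} [IsFiniteMeasure P]
    {s t : Set Ω} (h : ∀ᵐ ω ∂P, ω ∈ s → ω ∈ t) : P.real s ≤ P.real t :=
  ENNReal.toReal_mono (measure_ne_top _ _) (measure_mono_ae h)

namespace MetricKernel
variable {d : ℕ} {c : Euc d} {R : ℝ} (κ : MetricKernel c R)

/-- The energies, seen from `y₀`, of the points `y`, in the scale of the typical distance between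
neighbours among `n` points. -/
abbrev energy (n : ℕ) (y₀ : Euc d) (y : ℕ → Euc d) (j : ℕ) : ℝ := precScale d n * κ.toFun y₀ (y j)

/-- The calibrated precision for the energies of the first `n` points. -/
def precision (ρ : ℝ) (n : ℕ) (y₀ : Euc d) (y : ℕ → Euc d) : ℝ :=
  gibbsPrecision ρ (Finset.range n) (κ.energy n y₀ y)

lemma precScale_mul_le {n : ℕ} (hn : 0 < n) {y₀ y : Euc d} (h0 : y₀ ∈ closedBall c R)
    (hy : y ∈ closedBall c R) {s : ℝ} (h : ‖y - y₀‖ ≤ s * spaceScale d n) :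
    precScale d n * κ.toFun y₀ y ≤ κ.hi * s ^ 2 := by
  have hs := spaceScale_pos d hn
  have h1 := κ.upper y₀ h0 y hy
  have hhi := κ.hi_pos
  rw [precScale_eq d hn, inv_mul_le_iff₀ (by positivity)]
  calc _ ≤ _ := h1
    _ ≤ κ.hi * (s * spaceScale d n) ^ 2 := by gcongr
    _ = _ := by ring

lemma le_precScale_mul {n : ℕ} (hn : 0 < n) {y₀ y : Euc d} (h0 : y₀ ∈ closedBall c R)
    (hy : y ∈ closedBall c R) {s : ℝ} (hs0 : 0 ≤ s) (h : s * spaceScale d n ≤ ‖y - y₀‖) :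
    κ.lo * s ^ 2 ≤ precScale d n * κ.toFun y₀ y := by
  have hs := spaceScale_pos d hn
  have h1 := κ.lower y₀ h0 y hy
  have hlo := κ.lo_pos
  rw [precScale_eq d hn, ← div_eq_inv_mul, le_div_iff₀ (by positivity)]
  calc _ = κ.lo * (s * spaceScale d n) ^ 2 := by ring
    _ ≤ κ.lo * ‖y - y₀‖ ^ 2 := by gcongr
    _ ≤ _ := h1

/-- The boundary may halve the effective radius of the outer ball, so the inner radius is taken four
times smaller; the difference of the bounds is a multiple of `(s / 2)^d - (s / 4)^d`, which grows at
least linearly in `s`. -/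
lemma le_natCast_mul_annulus (hd : 0 < d) (hR : 0 < R) {n : ℕ} (hn : 0 < n) {y₀ : Euc d}
    (h0 : y₀ ∈ closedBall c R) {s : ℝ} (hs : 1 ≤ s) (hsR : s * spaceScale d n ≤ R) :
    ((4 * R) ^ d)⁻¹ * s ≤ n * (uniformBall c R).real
      (closedBall y₀ (s * spaceScale d n) \ closedBall y₀ (s / 4 * spaceScale d n)) := by
  have := isProbabilityMeasure_uniformBall (c := c) hR
  have hss := spaceScale_pos d hn
  have hpow := natCast_mul_spaceScale_pow hd hn
  have h1 := le_uniformBall_real_closedBall hR h0 (s := s * spaceScale d n) (by positivity) hsR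
  have h2 := uniformBall_real_closedBall_le (c := c) hR y₀ (s := s / 4 * spaceScale d n)
    (by positivity)
  rw [measureReal_sdiff (closedBall_subset_closedBall
    (mul_le_mul_of_nonneg_right (by linarith) hss.le)) measurableSet_closedBall]
  have hn' : (0 : ℝ) < n := by exact_mod_cast hn
  calc ((4 * R) ^ d)⁻¹ * s ≤ ((4 * R) ^ d)⁻¹ * (s ^ d * (2 ^ d - 1)) := by
        refine mul_le_mul_of_nonneg_left ?_ (by positivity)
        have h3 : s ≤ s ^ d := le_self_pow₀ hs hd.ne'
        have h4 : (2 : ℝ) ≤ 2 ^ d := le_self_pow₀ (by norm_num) hd.ne'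
        nlinarith
    _ = (s / 2) ^ d / R ^ d - (s / 4) ^ d / R ^ d := by
        rw [mul_pow, div_pow, div_pow, show (4 : ℝ) = 2 * 2 by norm_num, mul_pow]
        field_simp
    _ = n * ((s * spaceScale d n / 2) ^ d / R ^ d - (s / 4 * spaceScale d n) ^ d / R ^ d) := by
        have e1 : (s * spaceScale d n / 2) ^ d = (s / 2) ^ d * spaceScale d n ^ d := by
          rw [← mul_pow]; congr 1; ring
        rw [e1, mul_pow]
        calc _ = (n * spaceScale d n ^ d) * ((s / 2) ^ d / R ^ d - (s / 4) ^ d / R ^ d) := by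
              rw [hpow, one_mul]
          _ = _ := by ring
    _ ≤ _ := mul_le_mul_of_nonneg_left (by linarith) hn'.le

variable {Ω : Type*} [MeasurableSpace Ω] {P : Measure Ω} [IsProbabilityMeasure P]
  {Y : ℕ → Ω → Euc d}

lemma measureReal_annulus_empty_le (hd : 0 < d) (hR : 0 < R) (hY : IsUniformSample c R P Y)
    {n : ℕ} (hn : 0 < n) {y₀ : Euc d} (h0 : y₀ ∈ closedBall c R) {s : ℝ} (hs : 1 ≤ s)
    (hsR : s * spaceScale d n ≤ R) :
    P.real {ω | ∀ j < n, Y j ω ∉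
      closedBall y₀ (s * spaceScale d n) \ closedBall y₀ (s / 4 * spaceScale d n)} ≤
      Real.exp (-(((4 * R) ^ d)⁻¹ * s)) := by
  refine (hY.measureReal_forall_notMem_le hR n
    (measurableSet_closedBall.diff measurableSet_closedBall)).trans ?_
  exact Real.exp_le_exp.2 (neg_le_neg (le_natCast_mul_annulus hd hR hn h0 hs hsR))

lemma measureReal_le_partitionSum_le (hd : 0 < d) (hY : IsUniformSample c R P Y)
    {α : ℝ} (hα : 0 < α) {n : ℕ} (hn : 0 < n) {y₀ : Euc d} (h0 : y₀ ∈ closedBall c R) {M : ℝ}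
    (hM : 0 < M) :
    P.real {ω | M ≤ partitionSum (Finset.range n) (κ.energy n y₀ fun j => Y j ω) α} ≤
      κ.expConst α / M := by
  have hm := κ.measurable_right y₀
  refine (hY.measureReal_le_sum_le n
    (g := fun y => Real.exp (-(α * (precScale d n * κ.toFun y₀ y)))) (b := 1) (by fun_prop)
    (fun y _ => (Real.exp_pos _).le) (fun y hy => ?_) hM).trans ?_
  · rw [Real.exp_le_one_iff]
    have := mul_nonneg hα.le (mul_nonneg (precScale_nonneg d n) (κ.nonneg h0 hy))
    linarith
  · exact div_le_div_of_nonneg_right (κ.integral_exp_le hd hα hn h0) hM.le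

/-- The entropy decreases by a definite amount between two precisions if there is a pair of points
with well separated energies. -/
lemma le_entropyExcess_of_pair {ι : Type*} {ρ : ℝ} {N : Finset ι} {e : ι → ℝ} {α β M E F : ℝ}
    (hα : 0 < α) (hαβ : α < β) (he : ∀ j ∈ N, 0 ≤ e j) (hE : 0 < E) {j k : ι} (hj : j ∈ N)
    (hk : k ∈ N) (hjE : e j ≤ E) (hEk : 2 * E ≤ e k) (hkF : e k ≤ F)
    (hM : partitionSum N e α ≤ M) (hβ : 0 < entropyExcess ρ N e β) :
    Real.exp (-(α * E)) * (α * (Real.exp (-(α * E)) * Real.exp (-(α * F)) *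
      (E * (Real.exp (-((β - α) * E)) - Real.exp (-((β - α) * (2 * E))))) / 2 / (M * M))) ≤
      entropyExcess ρ N e α := by
  have hN : N.Nonempty := ⟨j, hj⟩
  have hWa := partitionSum_pos hN e α
  have hWb := partitionSum_pos hN e β
  have hM0 := hWa.trans_le hM
  have hδ : 0 < β - α := sub_pos.2 hαβ
  rw [entropyExcess_pos_iff hN] at hβ
  rw [entropyExcess_eq hN]
  have hWba : partitionSum N e β ≤ partitionSum N e α := by
    refine Finset.sum_le_sum fun i hi => Real.exp_le_exp.2 (neg_le_neg ?_)
    exact mul_le_mul_of_nonneg_right hαβ.le (he i hi)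
  have hpair := gibbsEntropy_sub_ge_pair (e := e) hα.le hαβ.le hj hk
  have h1 : Real.exp (-(α * E)) ≤ partitionSum N e α := by
    calc _ ≤ Real.exp (-(α * e j)) :=
          Real.exp_le_exp.2 (neg_le_neg (mul_le_mul_of_nonneg_left hjE hα.le))
      _ ≤ _ := Finset.single_le_sum (f := fun i => Real.exp (-(α * e i)))
          (fun _ _ => (Real.exp_pos _).le) hj
  have hg : 0 ≤ Real.exp (-((β - α) * E)) - Real.exp (-((β - α) * (2 * E))) := by
    rw [sub_nonneg, Real.exp_le_exp]
    nlinarith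
  refine mul_le_mul h1 ?_ (by positivity) hWa.le
  refine le_trans ?_ (hpair.trans (by linarith))
  refine mul_le_mul_of_nonneg_left ?_ hα.le
  refine div_le_div₀ ?_ ?_ (by positivity)
    (mul_le_mul hM (hWba.trans hM) hWb.le hM0.le)
  · have : (e j - e k) * (Real.exp (-((β - α) * e k)) - Real.exp (-((β - α) * e j))) =
      (e k - e j) * (Real.exp (-((β - α) * e j)) - Real.exp (-((β - α) * e k))) := by ring
    rw [this]
    have hg' : Real.exp (-((β - α) * e k)) ≤ Real.exp (-((β - α) * e j)) := by
      rw [Real.exp_le_exp]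
      nlinarith
    have := mul_nonneg (show 0 ≤ e k - e j by linarith) (sub_nonneg.2 hg')
    positivity
  · refine div_le_div_of_nonneg_right ?_ zero_le_two
    refine mul_le_mul ?_ ?_ (by positivity) (by positivity)
    · refine mul_le_mul (Real.exp_le_exp.2 ?_) (Real.exp_le_exp.2 ?_) (by positivity)
        (by positivity) <;> nlinarith
    · have : (e j - e k) * (Real.exp (-((β - α) * e k)) - Real.exp (-((β - α) * e j))) =
        (e k - e j) * (Real.exp (-((β - α) * e j)) - Real.exp (-((β - α) * e k))) := by ring
      rw [this]
      refine mul_le_mul (by linarith) (sub_le_sub ?_ ?_) hg (by linarith)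
      · exact Real.exp_le_exp.2 (by nlinarith)
      · exact Real.exp_le_exp.2 (by nlinarith)

/-- Outside an event of probability `θ`, one sample point has energy at most `E`, another has energy
between `2 E` and `F`, and the partition sum is at most `M`. The entropy then drops by a definite
amount from `α` to `β`, so a positive excess at `β` forces an excess of at least `η₀` at `α`. The
constants depend neither on `n` nor on `y₀`. -/
lemma exists_forall_measureReal_excess_le (hd : 0 < d) (hR : 0 < R) (hY : IsUniformSample c R P Y)
    (ρ : ℝ) {α β : ℝ} (hα : 0 < α) (hαβ : α < β) {θ : ℝ} (hθ : 0 < θ) :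
    ∃ η₀ > 0, ∀ᶠ n : ℕ in atTop, ∀ y₀ ∈ closedBall c R,
      P.real {ω | entropyExcess ρ (Finset.range n) (κ.energy n y₀ fun j => Y j ω) α < η₀ ∧
        0 < entropyExcess ρ (Finset.range n) (κ.energy n y₀ fun j => Y j ω) β} ≤ θ := by
  have hlo := κ.lo_pos
  have hhi := κ.hi_pos
  set q := ((4 * R) ^ d)⁻¹ with hq
  have hq0 : 0 < q := by positivity
  obtain ⟨s, hs1, hsθ⟩ : ∃ s : ℝ, 1 ≤ s ∧ Real.exp (-(q * s)) ≤ θ / 3 := by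
    have h : Tendsto (fun s : ℝ => Real.exp (-(q * s))) atTop (𝓝 0) :=
      Real.tendsto_exp_neg_atTop_nhds_zero.comp (tendsto_id.const_mul_atTop hq0)
    have := ((h.eventually_le_const (show 0 < θ / 3 by positivity)).and (eventually_ge_atTop 1)).exists
    obtain ⟨s, h1, h2⟩ := this
    exact ⟨s, h2, h1⟩
  -- With `lo A² ≥ 32 hi`, energies in the annulus of inner radius `A s / 4` are at least `lo (A s /
  -- 4)² ≥ 2 hi s² = 2 E`.
  set A := √(32 * κ.hi / κ.lo) + 1 with hA
  have hA1 : 1 ≤ A := by rw [hA]; linarith [Real.sqrt_nonneg (32 * κ.hi / κ.lo)]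
  have hA2 : 32 * κ.hi ≤ κ.lo * A ^ 2 := by
    have h1 : 32 * κ.hi / κ.lo ≤ A ^ 2 := by
      calc _ = √(32 * κ.hi / κ.lo) ^ 2 := (Real.sq_sqrt (by positivity)).symm
        _ ≤ _ := pow_le_pow_left₀ (Real.sqrt_nonneg _) (by rw [hA]; linarith) 2
    rw [div_le_iff₀ hlo] at h1
    linarith
  -- Chosen so that Markov's inequality for the partition sum costs at most `θ / 3`.
  set M := 3 * (κ.expConst α + 1) / θ with hM
  have hEC := κ.expConst_nonneg α
  have hM0 : 0 < M := by positivity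
  have hMθ : κ.expConst α / M ≤ θ / 3 := by
    rw [hM, div_div_eq_mul_div, div_le_div_iff₀ (by positivity) (by positivity)]
    nlinarith
  set E := κ.hi * s ^ 2 with hE
  set F := κ.hi * (A * s) ^ 2 with hF
  have hs0 : 0 < s := by linarith
  have hE0 : 0 < E := by positivity
  have hAs : 1 ≤ A * s := by nlinarith
  have hg : 0 < Real.exp (-((β - α) * E)) - Real.exp (-((β - α) * (2 * E))) := by
    rw [sub_pos, Real.exp_lt_exp]
    nlinarith [mul_pos (sub_pos.2 hαβ) hE0]
  refine ⟨Real.exp (-(α * E)) * (α * (Real.exp (-(α * E)) * Real.exp (-(α * F)) *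
      (E * (Real.exp (-((β - α) * E)) - Real.exp (-((β - α) * (2 * E))))) / 2 / (M * M))),
      by positivity, ?_⟩
  have hev : ∀ᶠ n : ℕ in atTop, A * s * spaceScale d n ≤ R := by
    have h := ((tendsto_spaceScale hd).mono_right nhdsWithin_le_nhds).const_mul (A * s)
    rw [mul_zero] at h
    exact h.eventually_le_const hR
  filter_upwards [hev, eventually_gt_atTop 0] with n hnR hn y₀ h0
  have hss := spaceScale_pos d hn
  have hnR' : s * spaceScale d n ≤ R := by
    refine le_trans ?_ hnR
    refine mul_le_mul_of_nonneg_right ?_ hss.le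
    nlinarith
  have b1 := measureReal_annulus_empty_le hd hR hY hn h0 hs1 hnR'
  have b2 := measureReal_annulus_empty_le hd hR hY hn h0 hAs hnR
  have b3 := κ.measureReal_le_partitionSum_le hd hY hα hn h0 hM0
  have b2' : Real.exp (-(q * (A * s))) ≤ θ / 3 := by
    refine le_trans (Real.exp_le_exp.2 (neg_le_neg ?_)) hsθ
    exact mul_le_mul_of_nonneg_left (by nlinarith) hq0.le
  refine le_trans (measureReal_le_of_ae (t := _ ∪ (_ ∪ _)) ?_) ((measureReal_union_le _ _).trans
    (add_le_add b1 ((measureReal_union_le _ _).trans (add_le_add b2 b3)))) |>.trans (by linarith)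
  filter_upwards [hY.ae_mem] with ω hω hbad
  by_contra hcon
  simp only [Set.mem_union, not_or, Set.mem_ofPred_eq] at hcon hbad
  obtain ⟨c1, c2, c3⟩ := hcon
  push Not at c1 c2 c3
  obtain ⟨j, hj, hj1, hj2⟩ := c1
  obtain ⟨k, hk, hk1, hk2⟩ := c2
  refine absurd hbad.1 (not_lt.2 (le_entropyExcess_of_pair hα hαβ ?_ hE0 (Finset.mem_range.2 hj)
    (Finset.mem_range.2 hk) ?_ ?_ ?_ c3.le hbad.2))
  · exact fun i _ => mul_nonneg (precScale_nonneg d n) (κ.nonneg h0 (hω i))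
  · rw [mem_closedBall, dist_eq_norm] at hj1
    exact κ.precScale_mul_le hn h0 (hω j) hj1
  · rw [mem_closedBall, not_le, dist_eq_norm] at hk2
    refine le_trans ?_ (κ.le_precScale_mul hn h0 (hω k) (by positivity) hk2.le)
    rw [hE]
    nlinarith [sq_nonneg s]
  · rw [mem_closedBall, dist_eq_norm] at hk1
    exact κ.precScale_mul_le hn h0 (hω k) hk1

/-- The sublevel sets of the scaled energy contain large balls, or everything. -/
lemma sublevel_alternative (hd : 0 < d) (hR : 0 < R) {n : ℕ} (hn : 0 < n) {y₀ : Euc d}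
    (h0 : y₀ ∈ closedBall c R) {v : ℝ} (hv : 0 < v) :
    (∃ B : Set (Euc d), MeasurableSet B ∧
      (∀ y ∈ B, y ∈ closedBall c R → precScale d n * κ.toFun y₀ y ≤ v) ∧
      (√v / (4 * R * √κ.hi)) ^ d ≤ n * (uniformBall c R).real B) ∨
    ∀ y ∈ closedBall c R, precScale d n * κ.toFun y₀ y ≤ v := by
  have hhi := κ.hi_pos
  have hss := spaceScale_pos d hn
  -- The scaled energy is at most `v` up to distance `2 r` in blown-up units. The spare factor two
  -- makes the failing case, where `r` exceeds the blown-up radius, cover the diameter of the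
  -- domain.
  set r := √(v / κ.hi) / 2 with hr
  have hr2 : κ.hi * (2 * r) ^ 2 = v := by
    rw [hr, mul_div_cancel₀ _ two_ne_zero, Real.sq_sqrt (by positivity)]
    field_simp
  have hr0 : 0 < r := by positivity
  rcases le_or_gt (r * spaceScale d n) R with h | h
  · left
    refine ⟨closedBall y₀ (r * spaceScale d n), measurableSet_closedBall, fun y hy hyc => ?_, ?_⟩
    · rw [mem_closedBall, dist_eq_norm] at hy
      refine (κ.precScale_mul_le hn h0 hyc hy).trans ?_
      rw [← hr2]
      nlinarith [mul_pos hhi (sq_pos_of_pos hr0)]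
    · have h1 := le_uniformBall_real_closedBall hR h0 (s := r * spaceScale d n) (by positivity) h
      have hn' : (0 : ℝ) < n := by exact_mod_cast hn
      refine le_trans (le_of_eq ?_) (mul_le_mul_of_nonneg_left h1 hn'.le)
      have e : (r * spaceScale d n / 2) ^ d / R ^ d = (r / (2 * R)) ^ d * spaceScale d n ^ d := by
        rw [← div_pow, ← mul_pow]; congr 1; field_simp
      rw [e, mul_left_comm, natCast_mul_spaceScale_pow hd hn, mul_one, hr, Real.sqrt_div hv.le]
      congr 1
      field_simp
      norm_num
  · right
    intro y hy
    rw [← hr2]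
    refine κ.precScale_mul_le hn h0 hy ?_
    have h1 : ‖y - y₀‖ ≤ 2 * R := by
      rw [← dist_eq_norm]
      have := dist_triangle_right y y₀ c
      have := mem_closedBall.1 hy
      have := mem_closedBall.1 h0
      linarith
    nlinarith

end MetricKernel
end NeighbourEmbedding
end

/-! ### Tail bounds for the scaled precision near zero and near infinity. -/

noncomputable section
namespace NeighbourEmbedding
open MeasureTheory ProbabilityTheory Matrix Filter Topology Metric

namespace MetricKernel
variable {d : ℕ} {c : Euc d} {R : ℝ} (κ : MetricKernel c R)
variable {Ω : Type*} [MeasurableSpace Ω] {P : Measure Ω} [IsProbabilityMeasure P]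
  {Y : ℕ → Ω → Euc d}

/-- The rate of exponential decay of the law of the scaled precision near `0`. -/
def lowerRate : ℝ := (1 - Real.exp (-Real.exp (-1))) * (1 / (4 * R * √κ.hi)) ^ d / 2

lemma lowerRate_pos (hR : 0 < R) : 0 < κ.lowerRate := by
  have hhi := κ.hi_pos
  have : Real.exp (-Real.exp (-1)) < 1 := by
    rw [Real.exp_lt_one_iff, neg_lt_zero]; exact Real.exp_pos _
  have : 0 < 1 - Real.exp (-Real.exp (-1)) := by linarith
  unfold lowerRate
  positivity

/-- A precision below `exp (-k)` forces the partition sum at `exp (-k)` below `ρ`, although every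
point of energy at most `exp k` contributes at least `exp (-1)`; Chernoff's bound makes this
unlikely. If instead all energies are at most `exp k`, then `n ≥ e ρ` gives a precision of at least
`exp (-k)`, and the event is null. -/
lemma measureReal_precision_lt_le (hd : 0 < d) (hR : 0 < R) (hY : IsUniformSample c R P Y)
    {ρ : ℝ} (hρ : 1 < ρ) {n : ℕ} (hn : Real.exp 1 * ρ ≤ n) {y₀ : Euc d}
    (h0 : y₀ ∈ closedBall c R) (k : ℕ) :
    P.real {ω | 0 < κ.precision ρ n y₀ (fun j => Y j ω) ∧
      κ.precision ρ n y₀ (fun j => Y j ω) < Real.exp (-k)} ≤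
      Real.exp ρ * Real.exp (-(κ.lowerRate * k)) := by
  have := isProbabilityMeasure_uniformBall (c := c) hR
  have hhi := κ.hi_pos
  have hρ0 : 0 < ρ := by linarith
  have hn0' : (0 : ℝ) < n := lt_of_lt_of_le (by positivity) hn
  have hn0 : 0 < n := by exact_mod_cast hn0'
  have hener : ∀ ω, (∀ j, Y j ω ∈ closedBall c R) → ∀ j ∈ Finset.range n,
      0 ≤ κ.energy n y₀ (fun j => Y j ω) j := fun ω hω j _ =>
    mul_nonneg (precScale_nonneg d n) (κ.nonneg h0 (hω j))
  rcases κ.sublevel_alternative hd hR hn0 h0 (Real.exp_pos k) with ⟨B, hBm, hB, hμB⟩ | hall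
  · set g : Euc d → ℝ := B.indicator fun _ => Real.exp (-1) with hg
    have hgm : Measurable g := measurable_const.indicator hBm
    have hg0 : ∀ y, 0 ≤ g y := fun y => Set.indicator_nonneg (fun _ _ => (Real.exp_pos _).le) y
    have h1 : P.real {ω | 0 < κ.precision ρ n y₀ (fun j => Y j ω) ∧
        κ.precision ρ n y₀ (fun j => Y j ω) < Real.exp (-k)} ≤
        P.real {ω | ∑ j ∈ Finset.range n, g (Y j ω) < ρ} := by
      refine measureReal_le_of_ae ?_
      filter_upwards [hY.ae_mem] with ω hω hbad
      have h2 := gibbsEntropy_lt_log_of_lt hρ hbad.1 hbad.2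
      have h3 := log_partitionSum_le_gibbsEntropy (hener ω hω) (Real.exp_pos (-(k : ℝ))).le
      have hN : (Finset.range n).Nonempty := Finset.nonempty_range_iff.2 hn0.ne'
      have h4 := (Real.log_lt_log_iff (partitionSum_pos hN _ _) hρ0).1 (h3.trans_lt h2)
      refine lt_of_le_of_lt ?_ h4
      refine Finset.sum_le_sum fun j _ => ?_
      by_cases hj : Y j ω ∈ B
      · rw [hg, Set.indicator_of_mem hj]
        refine Real.exp_le_exp.2 (neg_le_neg ?_)
        have h5 := mul_le_mul_of_nonneg_left (hB _ hj (hω j)) (Real.exp_pos (-(k : ℝ))).le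
        rwa [← Real.exp_add, neg_add_cancel, Real.exp_zero] at h5
      · rw [hg, Set.indicator_of_notMem hj]
        exact (Real.exp_pos _).le
    refine h1.trans ((hY.measureReal_sum_lt_le n hgm hg0 ρ).trans ?_)
    refine mul_le_mul_of_nonneg_left ?_ (Real.exp_pos _).le
    set a := 1 - Real.exp (-Real.exp (-1)) with ha
    have ha0 : 0 < a := by
      have : Real.exp (-Real.exp (-1)) < 1 := by
        rw [Real.exp_lt_one_iff, neg_lt_zero]; exact Real.exp_pos _
      linarith
    have h2 : ∫ y, Real.exp (-g y) ∂uniformBall c R = 1 - (uniformBall c R).real B * a := by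
      have e : ∀ y, Real.exp (-g y) = 1 - B.indicator (fun _ => a) y := by
        intro y
        by_cases hy : y ∈ B
        · rw [hg, Set.indicator_of_mem hy, Set.indicator_of_mem hy, ha]; ring
        · rw [hg, Set.indicator_of_notMem hy, Set.indicator_of_notMem hy]; simp
      simp_rw [e]
      rw [integral_sub (integrable_const _) ((integrable_const a).indicator hBm),
        integral_indicator_const a hBm]
      simp
    have h3 : 0 ≤ ∫ y, Real.exp (-g y) ∂uniformBall c R :=
      integral_nonneg fun y => (Real.exp_pos _).le
    have h4 : ∫ y, Real.exp (-g y) ∂uniformBall c R ≤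
        Real.exp (-((uniformBall c R).real B * a)) := by
      rw [h2]
      have := Real.add_one_le_exp (-((uniformBall c R).real B * a))
      linarith
    refine (pow_le_pow_left₀ h3 h4 n).trans ?_
    rw [← Real.exp_nat_mul]
    refine Real.exp_le_exp.2 ?_
    rw [mul_neg, neg_le_neg_iff]
    -- The true bound is exponential in `k`; keeping only the linear part `exp (k / 2) ≥ k / 2`
    -- still gives a summable tail.
    have h5 : (1 / (4 * R * √κ.hi)) ^ d * (k / 2) ≤ n * (uniformBall c R).real B := by
      refine le_trans ?_ hμB
      have e : √(Real.exp k) / (4 * R * √κ.hi) = 1 / (4 * R * √κ.hi) * Real.exp (k / 2) := by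
        rw [Real.exp_half]; ring
      rw [e, mul_pow]
      refine mul_le_mul_of_nonneg_left ?_ (by positivity)
      have h6 := Real.add_one_le_exp ((k : ℝ) / 2)
      have h7 : Real.exp ((k : ℝ) / 2) ≤ Real.exp ((k : ℝ) / 2) ^ d :=
        le_self_pow₀ (Real.one_le_exp (by positivity)) hd.ne'
      linarith
    calc κ.lowerRate * k = a * ((1 / (4 * R * √κ.hi)) ^ d * (k / 2)) := by
          rw [lowerRate, ha]; ring
      _ ≤ a * (n * (uniformBall c R).real B) := mul_le_mul_of_nonneg_left h5 ha0.le
      _ = _ := by ring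
  · have h1 : P.real {ω | 0 < κ.precision ρ n y₀ (fun j => Y j ω) ∧
        κ.precision ρ n y₀ (fun j => Y j ω) < Real.exp (-k)} ≤ P.real ∅ := by
      refine measureReal_le_of_ae ?_
      filter_upwards [hY.ae_mem] with ω hω hbad
      exfalso
      have h2 := log_card_div_le_gibbsPrecision_mul hρ (hener ω hω)
        (fun j _ => hall _ (hω j)) hbad.1
      have h3 : 1 ≤ Real.log (n / ρ) := by
        rw [Real.le_log_iff_exp_le (by positivity), le_div_iff₀ hρ0]; exact hn
      rw [Finset.card_range] at h2
      have h4 := mul_lt_mul_of_pos_right hbad.2 (Real.exp_pos (k : ℝ))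
      rw [← Real.exp_add, neg_add_cancel, Real.exp_zero] at h4
      have h5 : gibbsPrecision ρ (Finset.range n) (κ.energy n y₀ fun j => Y j ω) * Real.exp k < 1 :=
        h4
      linarith
    rw [measureReal_empty] at h1
    exact h1.trans (by positivity)

lemma measureReal_forall_lt_energy_le (hd : 0 < d) (hR : 0 < R) (hY : IsUniformSample c R P Y)
    {n : ℕ} (hn : 0 < n) {y₀ : Euc d} (h0 : y₀ ∈ closedBall c R) {v : ℝ} (hv : 1 ≤ v) :
    P.real {ω | ∀ j < n, v < κ.energy n y₀ (fun j => Y j ω) j} ≤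
      Real.exp (-((1 / (4 * R * √κ.hi)) ^ d * √v)) := by
  have hhi := κ.hi_pos
  rcases κ.sublevel_alternative hd hR hn h0 (zero_lt_one.trans_le hv) with
    ⟨B, hBm, hB, hμB⟩ | hall
  · refine (measureReal_le_of_ae ?_).trans ((hY.measureReal_forall_notMem_le hR n hBm).trans ?_)
    · filter_upwards [hY.ae_mem] with ω hω hbad
      exact fun j hj hjB => absurd (hB _ hjB (hω j)) (not_le.2 (hbad j hj))
    · refine Real.exp_le_exp.2 (neg_le_neg (le_trans ?_ hμB))
      have e : √v / (4 * R * √κ.hi) = 1 / (4 * R * √κ.hi) * √v := by ring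
      rw [e, mul_pow]
      exact mul_le_mul_of_nonneg_left (le_self_pow₀ (Real.one_le_sqrt.2 hv) hd.ne') (by positivity)
  · have h1 : P.real {ω | ∀ j < n, v < κ.energy n y₀ (fun j => Y j ω) j} ≤ P.real ∅ := by
      refine measureReal_le_of_ae ?_
      filter_upwards [hY.ae_mem] with ω hω hbad
      exact absurd (hbad 0 hn) (not_lt.2 (hall _ (hω 0)))
    rw [measureReal_empty] at h1
    exact h1.trans (Real.exp_pos _).le

/-- The level below which the energies grow at least linearly along rays. -/
def localLevel : ℝ := κ.lo * κ.rad ^ 2 / 2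

lemma localLevel_pos : 0 < κ.localLevel := by
  have := κ.lo_pos
  have := κ.rad_pos
  unfold localLevel
  positivity

/-- The factor two leaves room for a shell that starts at a level up to `localLevel` and has
thickness up to `localLevel`. -/
lemma norm_le_rad {y₀ y : Euc d} (h0 : y₀ ∈ closedBall c R) (hy : y ∈ closedBall c R)
    (h : κ.toFun y₀ y ≤ 2 * κ.localLevel) : ‖y - y₀‖ ≤ κ.rad := by
  have h1 := κ.lower y₀ h0 y hy
  have hlo := κ.lo_pos
  rw [localLevel, mul_div_cancel₀ _ two_ne_zero] at h
  exact (pow_le_pow_iff_left₀ (norm_nonneg _) κ.rad_pos.le two_ne_zero).1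
    (le_of_mul_le_mul_left (h1.trans h) hlo)

/-- The interaction of a pair of points in the bound for the entropy at precision `a`. -/
def pairWeight (n : ℕ) (y₀ : Euc d) (a b : ℝ) (z : Euc d × Euc d) : ℝ :=
  {z : Euc d × Euc d | precScale d n * κ.toFun y₀ z.1 ≤ b ∧ κ.toFun y₀ z.1 ≤ κ.localLevel ∧
    κ.toFun y₀ z.1 ≤ κ.toFun y₀ z.2}.indicator (fun z => 2 * Real.exp
      (-(a * (precScale d n * κ.toFun y₀ z.2 - precScale d n * κ.toFun y₀ z.1) / 2))) z

lemma measurable_pairWeight (n : ℕ) (y₀ : Euc d) (a b : ℝ) :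
    Measurable (κ.pairWeight n y₀ a b) := by
  have hm1 : Measurable fun z : Euc d × Euc d => κ.toFun y₀ z.1 :=
    (κ.measurable_right y₀).comp measurable_fst
  have hm2 : Measurable fun z : Euc d × Euc d => κ.toFun y₀ z.2 :=
    (κ.measurable_right y₀).comp measurable_snd
  refine Measurable.indicator (by fun_prop) ?_
  exact (measurableSet_le (hm1.const_mul _) measurable_const).inter
    ((measurableSet_le hm1 measurable_const).inter (measurableSet_le hm1 hm2))

lemma pairWeight_nonneg (n : ℕ) (y₀ : Euc d) (a b : ℝ) (z : Euc d × Euc d) :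
    0 ≤ κ.pairWeight n y₀ a b z :=
  Set.indicator_nonneg (fun _ _ => by positivity) z

lemma pairWeight_le_two (n : ℕ) (y₀ : Euc d) {a : ℝ} (ha : 0 ≤ a) (b : ℝ) (z : Euc d × Euc d) :
    κ.pairWeight n y₀ a b z ≤ 2 := by
  refine Set.indicator_apply_le' (fun hz => ?_) fun _ => zero_le_two
  have h1 := mul_le_mul_of_nonneg_left hz.2.2 (precScale_nonneg d n)
  have h2 : Real.exp (-(a * (precScale d n * κ.toFun y₀ z.2 -
      precScale d n * κ.toFun y₀ z.1) / 2)) ≤ 1 := by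
    rw [Real.exp_le_one_iff, neg_nonpos]
    have := mul_nonneg ha (sub_nonneg.2 h1)
    positivity
  linarith

/-- If the gap of energies is below `h`, the second point lies in a thin shell. Otherwise half of
`exp (-a gap / 2)` gives `exp (-a h / 4)`, and since `a ≥ 4` the other half is at most `exp (-gap)`,
which decays in the second energy up to the factor `exp b`. -/
lemma pairWeight_le {n : ℕ} (hn : 0 < n) {y₀ : Euc d} (h0 : y₀ ∈ closedBall c R) {a b h : ℝ}
    (ha : 4 ≤ a) (hhn : h ≤ precScale d n * κ.localLevel) {z : Euc d × Euc d}
    (hz : z.2 ∈ closedBall c R) :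
    κ.pairWeight n y₀ a b z ≤ {y | precScale d n * κ.toFun y₀ y ≤ b}.indicator
      (fun y => 2 * (κ.shell y₀ (precScale d n * κ.toFun y₀ y / precScale d n)
          ((precScale d n * κ.toFun y₀ y + h) / precScale d n)).indicator 1 z.2 +
        2 * (Real.exp (-(a * h / 4)) * Real.exp b) *
          Real.exp (-(1 * (precScale d n * κ.toFun y₀ z.2)))) z.1 := by
  have hp := precScale_pos d hn
  refine Set.indicator_apply_le' (fun hzm => ?_) fun _ => ?_
  · obtain ⟨hz1, hz2, hz3⟩ := hzm
    rw [Set.indicator_of_mem (by exact hz1)]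
    have hsh0 : (0 : ℝ) ≤ (κ.shell y₀ (precScale d n * κ.toFun y₀ z.1 / precScale d n)
          ((precScale d n * κ.toFun y₀ z.1 + h) / precScale d n)).indicator 1 z.2 :=
      Set.indicator_nonneg (fun _ _ => zero_le_one) _
    have h1 := mul_le_mul_of_nonneg_left hz3 hp.le
    rcases lt_or_ge (precScale d n * κ.toFun y₀ z.2) (precScale d n * κ.toFun y₀ z.1 + h)
      with hlt | hge
    · have hmem : z.2 ∈ κ.shell y₀ (precScale d n * κ.toFun y₀ z.1 / precScale d n)
          ((precScale d n * κ.toFun y₀ z.1 + h) / precScale d n) := by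
        refine ⟨hz, ?_, ?_, ?_⟩
        · refine κ.norm_le_rad h0 hz ?_
          have : precScale d n * κ.toFun y₀ z.2 ≤ precScale d n * (2 * κ.localLevel) := by
            have := mul_le_mul_of_nonneg_left hz2 hp.le
            linarith
          exact le_of_mul_le_mul_left this hp
        · rw [div_le_iff₀ hp]; linarith
        · rw [lt_div_iff₀ hp]; linarith
      rw [Set.indicator_of_mem hmem, Pi.one_apply]
      have h2 : Real.exp (-(a * (precScale d n * κ.toFun y₀ z.2 -
          precScale d n * κ.toFun y₀ z.1) / 2)) ≤ 1 := by
        rw [Real.exp_le_one_iff, neg_nonpos]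
        have := mul_nonneg (show 0 ≤ a by linarith) (sub_nonneg.2 h1)
        positivity
      have : 0 ≤ 2 * (Real.exp (-(a * h / 4)) * Real.exp b) *
          Real.exp (-(1 * (precScale d n * κ.toFun y₀ z.2))) := by positivity
      linarith
    · have h2 : Real.exp (-(a * (precScale d n * κ.toFun y₀ z.2 -
          precScale d n * κ.toFun y₀ z.1) / 2)) ≤ Real.exp (-(a * h / 4)) * Real.exp b *
          Real.exp (-(1 * (precScale d n * κ.toFun y₀ z.2))) := by
        rw [← Real.exp_add, ← Real.exp_add]
        refine Real.exp_le_exp.2 ?_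
        nlinarith
      linarith
  · refine Set.indicator_nonneg (fun y _ => ?_) _
    have : (0 : ℝ) ≤ (κ.shell y₀ (precScale d n * κ.toFun y₀ y / precScale d n)
          ((precScale d n * κ.toFun y₀ y + h) / precScale d n)).indicator 1 z.2 :=
      Set.indicator_nonneg (fun _ _ => zero_le_one) _
    positivity

/-- Each of the two factors `n` is absorbed by one integration: for the second point by the shell
and exponential estimates, for the first by the restriction to energy at most `b`, where `1 ≤ exp b
* exp (-energy)`. -/
lemma natCast_sq_mul_integral_pairWeight_le (hd : 0 < d) (hR : 0 < R) {n : ℕ} (hn : 0 < n)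
    {y₀ : Euc d} (h0 : y₀ ∈ closedBall c R) {a b h : ℝ} (ha : 4 ≤ a) (hh : 0 < h) (hh1 : h ≤ 1)
    (hhn : h ≤ precScale d n * κ.localLevel) (hb : 0 ≤ b) :
    (n : ℝ) * (n * ∫ z, κ.pairWeight n y₀ a b z ∂(uniformBall c R).prod (uniformBall c R)) ≤
      κ.expConst 1 * Real.exp b * (2 * (κ.shellConst * ((b + 1) ^ d * √√h)) +
        2 * (Real.exp (-(a * h / 4)) * Real.exp b) * κ.expConst 1) := by
  have := isProbabilityMeasure_uniformBall (c := c) hR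
  have hp := precScale_pos d hn
  have hn' : (0 : ℝ) < n := by exact_mod_cast hn
  have hEC := κ.expConst_nonneg 1
  have hSC : 0 ≤ κ.shellConst := by
    have := κ.lo_pos
    unfold shellConst
    positivity
  set K := 2 * (κ.shellConst * ((b + 1) ^ d * √√h)) +
        2 * (Real.exp (-(a * h / 4)) * Real.exp b) * κ.expConst 1 with hK
  have hK0 : 0 ≤ K := by positivity
  have ha0 : 0 ≤ a := by linarith
  have hm := κ.measurable_right y₀
  have hintegr : Integrable (κ.pairWeight n y₀ a b) ((uniformBall c R).prod (uniformBall c R)) :=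
    Integrable.of_bound (κ.measurable_pairWeight n y₀ a b).aestronglyMeasurable 2
      (Eventually.of_forall fun z => by
        rw [Real.norm_of_nonneg (κ.pairWeight_nonneg _ _ _ _ _)]
        exact κ.pairWeight_le_two n y₀ ha0 b z)
  have hexpint : ∀ t : ℝ, Integrable (fun y => t * Real.exp (-(1 * (precScale d n * κ.toFun y₀ y))))
      (uniformBall c R) := by
    intro t
    refine Integrable.const_mul (Integrable.of_bound (C := 1) ?_ ?_) t
    · exact Measurable.aestronglyMeasurable (by fun_prop)
    · filter_upwards [ae_mem_uniformBall (c := c) (R := R)] with y hy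
      rw [Real.norm_of_nonneg (Real.exp_pos _).le, Real.exp_le_one_iff]
      have := mul_nonneg hp.le (κ.nonneg h0 hy)
      linarith
  rw [integral_prod _ hintegr]
  have hinner : ∀ y ∈ closedBall c R, n * ∫ y', κ.pairWeight n y₀ a b (y, y') ∂uniformBall c R ≤
      K * Real.exp b * Real.exp (-(1 * (precScale d n * κ.toFun y₀ y))) := by
    intro y hy
    by_cases hyb : precScale d n * κ.toFun y₀ y ≤ b
    · have hshm := κ.measurableSet_shell y₀ (precScale d n * κ.toFun y₀ y / precScale d n)
          ((precScale d n * κ.toFun y₀ y + h) / precScale d n)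
      have hsi : Integrable (fun y' => 2 * (κ.shell y₀
          (precScale d n * κ.toFun y₀ y / precScale d n)
          ((precScale d n * κ.toFun y₀ y + h) / precScale d n)).indicator (1 : Euc d → ℝ) y')
          (uniformBall c R) := ((integrable_const (1 : ℝ)).indicator hshm).const_mul 2
      have h1 : ∫ y', κ.pairWeight n y₀ a b (y, y') ∂uniformBall c R ≤
          ∫ y', (2 * (κ.shell y₀ (precScale d n * κ.toFun y₀ y / precScale d n)
          ((precScale d n * κ.toFun y₀ y + h) / precScale d n)).indicator 1 y' +
        2 * (Real.exp (-(a * h / 4)) * Real.exp b) *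
          Real.exp (-(1 * (precScale d n * κ.toFun y₀ y')))) ∂uniformBall c R := by
        refine integral_mono_of_nonneg (Eventually.of_forall fun y' =>
          κ.pairWeight_nonneg _ _ _ _ _) ?_ ?_
        · exact hsi.add (hexpint _)
        · filter_upwards [ae_mem_uniformBall (c := c) (R := R)] with y' hy'
          refine (κ.pairWeight_le hn h0 ha hhn (z := (y, y')) hy').trans ?_
          rw [Set.indicator_of_mem (by exact hyb)]
      have h2 := κ.natCast_mul_uniformBall_scaled_shell_le hd hR hn h0
        (mul_nonneg hp.le (κ.nonneg h0 hy)) hh hh1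
      have h3 := κ.integral_exp_le hd one_pos hn h0
      have hKn : n * ∫ y', κ.pairWeight n y₀ a b (y, y') ∂uniformBall c R ≤ K := by
        refine (mul_le_mul_of_nonneg_left h1 hn'.le).trans ?_
        rw [integral_add hsi (hexpint _),
          integral_const_mul, integral_const_mul, integral_indicator_one hshm]
        have hb1 : (precScale d n * κ.toFun y₀ y + 1) ^ d ≤ (b + 1) ^ d :=
          pow_le_pow_left₀ (by
            have := mul_nonneg hp.le (κ.nonneg h0 hy)
            linarith) (by linarith) d
        have h4 : κ.shellConst * ((precScale d n * κ.toFun y₀ y + 1) ^ d * √√h) ≤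
            κ.shellConst * ((b + 1) ^ d * √√h) :=
          mul_le_mul_of_nonneg_left (mul_le_mul_of_nonneg_right hb1 (Real.sqrt_nonneg _)) hSC
        have h5 := mul_le_mul_of_nonneg_left h3
          (show 0 ≤ 2 * (Real.exp (-(a * h / 4)) * Real.exp b) by positivity)
        rw [hK]
        linarith
      refine hKn.trans ?_
      rw [mul_assoc, ← Real.exp_add]
      exact le_mul_of_one_le_right hK0 (Real.one_le_exp (by linarith))
    · have h1 : ∀ y', κ.pairWeight n y₀ a b (y, y') = 0 := fun y' =>
        Set.indicator_of_notMem (fun hz => hyb hz.1) _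
      simp_rw [h1]
      simp only [integral_zero, mul_zero]
      positivity
  have h6 : n * ∫ y, ∫ y', κ.pairWeight n y₀ a b (y, y') ∂uniformBall c R ∂uniformBall c R ≤
      ∫ y, K * Real.exp b * Real.exp (-(1 * (precScale d n * κ.toFun y₀ y))) ∂uniformBall c R := by
    rw [← integral_const_mul]
    refine integral_mono_of_nonneg (Eventually.of_forall fun y => ?_) (hexpint _) ?_
    · exact mul_nonneg hn'.le (integral_nonneg fun _ => κ.pairWeight_nonneg _ _ _ _ _)
    · filter_upwards [ae_mem_uniformBall (c := c) (R := R)] with y hy using hinner y hy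
  rw [integral_const_mul] at h6
  have h7 := κ.integral_exp_le hd one_pos hn h0
  calc _ ≤ _ := mul_le_mul_of_nonneg_left h6 hn'.le
    _ = K * Real.exp b * (n * ∫ y, Real.exp (-(1 * (precScale d n * κ.toFun y₀ y)))
        ∂uniformBall c R) := by ring
    _ ≤ K * Real.exp b * κ.expConst 1 := mul_le_mul_of_nonneg_left h7 (by positivity)
    _ = _ := by ring

/-- Some point among the first `n` is in the region where the energies grow along rays. -/
def HasLocal (n : ℕ) (y₀ : Euc d) (y : ℕ → Euc d) : Prop :=
  ∃ j < n, κ.toFun y₀ (y j) ≤ κ.localLevel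

/-- A precision above `a` means that the entropy at `a` still exceeds `log ρ`, hence so does the sum
of `2 exp (-a gap / 2)` over the gaps above the ground state. Apart from the rare event that all
energies exceed `b`, that sum is bounded by a sum of pair weights, to which Markov's inequality
applies. -/
lemma measureReal_lt_precision_le (hd : 0 < d) (hR : 0 < R) (hY : IsUniformSample c R P Y)
    {ρ : ℝ} (hρ : 1 < ρ) {n : ℕ} (hn : 0 < n) {y₀ : Euc d} (h0 : y₀ ∈ closedBall c R) {a b h : ℝ}
    (ha : 4 ≤ a) (hh : 0 < h) (hh1 : h ≤ 1)
    (hhn : h ≤ precScale d n * κ.localLevel) (hb : 1 ≤ b) :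
    P.real {ω | κ.HasLocal n y₀ (fun j => Y j ω) ∧ a < κ.precision ρ n y₀ (fun j => Y j ω)} ≤
      Real.exp (-((1 / (4 * R * √κ.hi)) ^ d * √b)) +
      κ.expConst 1 * Real.exp b * (2 * (κ.shellConst * ((b + 1) ^ d * √√h)) +
        2 * (Real.exp (-(a * h / 4)) * Real.exp b) * κ.expConst 1) / Real.log ρ := by
  have := isProbabilityMeasure_uniformBall (c := c) hR
  have hp := precScale_pos d hn
  have hn' : (0 : ℝ) < n := by exact_mod_cast hn
  have hlog := Real.log_pos hρ
  have ha0 : 0 ≤ a := by linarith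
  set Z : Ω → ℝ := fun ω => ∑ i ∈ Finset.range n, ∑ j ∈ (Finset.range n).erase i,
    κ.pairWeight n y₀ a b (Y i ω, Y j ω) with hZ
  have hZint : ∀ i j : ℕ, Integrable (fun ω => κ.pairWeight n y₀ a b (Y i ω, Y j ω)) P := by
    intro i j
    refine Integrable.of_bound (C := 2) ((κ.measurable_pairWeight n y₀ a b).comp
      ((hY.measurable i).prodMk (hY.measurable j))).aestronglyMeasurable
      (Eventually.of_forall fun ω => ?_)
    rw [Real.norm_of_nonneg (κ.pairWeight_nonneg _ _ _ _ _)]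
    exact κ.pairWeight_le_two n y₀ ha0 b _
  set I := ∫ z, κ.pairWeight n y₀ a b z ∂(uniformBall c R).prod (uniformBall c R) with hI
  have hI0 : 0 ≤ I := integral_nonneg fun z => κ.pairWeight_nonneg _ _ _ _ _
  have hEZ : ∫ ω, Z ω ∂P ≤ n * (n * I) := by
    rw [hZ, integral_finsetSum _ fun i _ => integrable_finsetSum _ fun j _ => hZint i j]
    have h1 : ∀ i ∈ Finset.range n, ∫ ω, ∑ j ∈ (Finset.range n).erase i,
        κ.pairWeight n y₀ a b (Y i ω, Y j ω) ∂P ≤ n * I := by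
      intro i hi
      rw [integral_finsetSum _ fun j _ => hZint i j]
      have h2 : ∀ j ∈ (Finset.range n).erase i,
          ∫ ω, κ.pairWeight n y₀ a b (Y i ω, Y j ω) ∂P = I := by
        intro j hj
        rw [hI, ← hY.map_prod (Finset.ne_of_mem_erase hj).symm, integral_map
          ((hY.measurable i).prodMk (hY.measurable j)).aemeasurable
          (κ.measurable_pairWeight n y₀ a b).aestronglyMeasurable]
      rw [Finset.sum_congr rfl h2, Finset.sum_const, nsmul_eq_mul]
      refine mul_le_mul_of_nonneg_right ?_ hI0
      have := Finset.card_erase_le (s := Finset.range n) (a := i)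
      rw [Finset.card_range] at this
      exact_mod_cast this
    refine (Finset.sum_le_sum h1).trans ?_
    rw [Finset.sum_const, Finset.card_range, nsmul_eq_mul]
  have hmark : P.real {ω | Real.log ρ ≤ Z ω} ≤
      κ.expConst 1 * Real.exp b * (2 * (κ.shellConst * ((b + 1) ^ d * √√h)) +
        2 * (Real.exp (-(a * h / 4)) * Real.exp b) * κ.expConst 1) / Real.log ρ := by
    rw [le_div_iff₀ hlog, mul_comm]
    refine (mul_meas_ge_le_integral_of_nonneg (Eventually.of_forall fun ω => ?_)
      (integrable_finsetSum _ fun i _ => integrable_finsetSum _ fun j _ => hZint i j) _).trans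
      (hEZ.trans (κ.natCast_sq_mul_integral_pairWeight_le hd hR hn h0 ha hh hh1 hhn
        (by linarith)))
    exact Finset.sum_nonneg fun i _ => Finset.sum_nonneg fun j _ => κ.pairWeight_nonneg _ _ _ _ _
  refine (measureReal_le_of_ae (t := _ ∪ _) ?_).trans ((measureReal_union_le _ _).trans
    (add_le_add (κ.measureReal_forall_lt_energy_le hd hR hY hn h0 hb) hmark))
  filter_upwards [hY.ae_mem] with ω hω hbad
  simp only [Set.mem_union, Set.mem_ofPred_eq] at hbad ⊢
  obtain ⟨⟨l, hl, hll⟩, hprec⟩ := hbad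
  by_contra! hcon
  obtain ⟨⟨m, hm, hmb⟩, hZρ⟩ := hcon
  obtain ⟨i, hi, hmin⟩ := Finset.exists_min_image (Finset.range n)
    (κ.energy n y₀ fun j => Y j ω) ⟨l, Finset.mem_range.2 hl⟩
  have h1 := log_lt_gibbsEntropy_of_lt hρ (by linarith : 0 < a) hprec
  have h2 := gibbsEntropy_le ha0 hi hmin
  have hmin' : ∀ j ∈ Finset.range n, κ.toFun y₀ (Y i ω) ≤ κ.toFun y₀ (Y j ω) := fun j hj =>
    le_of_mul_le_mul_left (hmin j hj) hp
  -- The index of the ground state depends on the sample, so `Z` sums over all first indices and the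
  -- row of the minimiser is singled out here.
  have h3 : ∑ j ∈ (Finset.range n).erase i, 2 * Real.exp (-(a *
      (κ.energy n y₀ (fun j => Y j ω) j - κ.energy n y₀ (fun j => Y j ω) i) / 2)) ≤ Z ω := by
    refine le_trans (Finset.sum_le_sum fun j hj => ?_) (Finset.single_le_sum
      (f := fun i => ∑ j ∈ (Finset.range n).erase i, κ.pairWeight n y₀ a b (Y i ω, Y j ω))
      (fun i _ => Finset.sum_nonneg fun j _ => κ.pairWeight_nonneg _ _ _ _ _) hi)
    rw [pairWeight, Set.indicator_of_mem]
    refine ⟨(hmin m (Finset.mem_range.2 hm)).trans hmb, (hmin' l (Finset.mem_range.2 hl)).trans hll,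
      hmin' j (Finset.mem_of_mem_erase hj)⟩
  linarith

end MetricKernel
end NeighbourEmbedding
end

noncomputable section
namespace NeighbourEmbedding
open MeasureTheory ProbabilityTheory Matrix Filter Topology Metric

/-! ### The scaled precision is positive and its logarithm is uniformly integrable -/

namespace MetricKernel
variable {d : ℕ} {c : Euc d} {R : ℝ} (κ : MetricKernel c R)
variable {Ω : Type*} [MeasurableSpace Ω] {P : Measure Ω} [IsProbabilityMeasure P]
  {Y : ℕ → Ω → Euc d}

/-- The parameters are `a = exp k`, `b = k / 32`, `h = exp (-k / 2)`. Then `h^(1/4) = exp (-k / 8)`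
beats the growth `exp (2 b) = exp (k / 16)`, leaving `exp (-k / 16)`; `k ≥ 32` ensures `b ≥ 1`. -/
lemma exists_summable_tail (hd : 0 < d) (hR : 0 < R) (hY : IsUniformSample c R P Y)
    {ρ : ℝ} (hρ : 1 < ρ) :
    ∃ b : ℕ → ℝ, Summable b ∧ (∀ k, 0 ≤ b k) ∧ ∀ᶠ n : ℕ in atTop, ∀ k : ℕ, 32 ≤ k →
      ∀ y₀ ∈ closedBall c R,
      P.real {ω | κ.HasLocal n y₀ (fun j => Y j ω) ∧
        Real.exp k < κ.precision ρ n y₀ (fun j => Y j ω)} ≤ b k ∧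
      P.real {ω | 0 < κ.precision ρ n y₀ (fun j => Y j ω) ∧
        κ.precision ρ n y₀ (fun j => Y j ω) < Real.exp (-k)} ≤ b k := by
  have hlog := Real.log_pos hρ
  have hhi := κ.hi_pos
  have hlo := κ.lo_pos
  have hEC := κ.expConst_nonneg 1
  have hSC : 0 ≤ κ.shellConst := by
    unfold shellConst
    positivity
  set x := (1 / (4 * R * √κ.hi)) ^ d with hx
  have hx0 : 0 < x := by positivity
  set C₁ := 24 * 1024 / x ^ 4 with hC₁
  set K := κ.expConst 1 * (2 * (κ.shellConst * (d.factorial * Real.exp 1)) + 2 * κ.expConst 1) /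
    Real.log ρ with hK
  have hK0 : 0 ≤ K := by positivity
  refine ⟨fun k => C₁ * (1 / (k : ℝ) ^ 2) + K * Real.exp (k * (-(1 / 16))) +
    Real.exp ρ * Real.exp (k * (-κ.lowerRate)), ?_, fun k => by positivity, ?_⟩
  · refine ((Summable.mul_left _ (Real.summable_one_div_nat_pow.2 one_lt_two)).add
      (Summable.mul_left _ (Real.summable_exp_nat_mul_iff.2 (by norm_num)))).add
      (Summable.mul_left _ (Real.summable_exp_nat_mul_iff.2 ?_))
    exact neg_lt_zero.2 (κ.lowerRate_pos hR)
  · have e1 : ∀ᶠ n : ℕ in atTop, Real.exp 1 * ρ ≤ n :=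
      tendsto_natCast_atTop_atTop.eventually_ge_atTop _
    have e2 : ∀ᶠ n : ℕ in atTop, 1 ≤ precScale d n * κ.localLevel :=
      ((tendsto_precScale hd).atTop_mul_const κ.localLevel_pos).eventually_ge_atTop 1
    filter_upwards [e1, e2, eventually_gt_atTop 0] with n hn1 hn2 hn k hk y₀ h0
    have hk32 : (32 : ℝ) ≤ k := by exact_mod_cast hk
    constructor
    · have hh1 : Real.exp (-((k : ℝ) / 2)) ≤ 1 := by rw [Real.exp_le_one_iff]; linarith
      have ha : 4 ≤ Real.exp (k : ℝ) := by
        have := Real.add_one_le_exp (k : ℝ)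
        linarith
      have h := κ.measureReal_lt_precision_le hd hR hY hρ hn h0 (a := Real.exp k) (b := k / 32)
        (h := Real.exp (-((k : ℝ) / 2))) ha (Real.exp_pos _) hh1 (hh1.trans hn2) (by linarith)
      -- The fourth-order term of the exponential series turns the stretched exponential into a
      -- multiple of `k⁻²`; hence `24 * 1024` in `C₁`, from `4!` and `32²`.
      have t1 : Real.exp (-(x * √((k : ℝ) / 32))) ≤ C₁ * (1 / (k : ℝ) ^ 2) := by
        have h1 := Real.pow_div_factorial_le_exp (x * √((k : ℝ) / 32)) (by positivity) 4
        have h2 : √((k : ℝ) / 32) ^ 4 = (k / 32) ^ 2 := by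
          calc √((k : ℝ) / 32) ^ 4 = (√((k : ℝ) / 32) ^ 2) ^ 2 := by ring
            _ = _ := by rw [Real.sq_sqrt (by positivity)]
        rw [mul_pow, h2] at h1
        rw [Real.exp_neg, inv_le_comm₀ (Real.exp_pos _) (by positivity)]
        refine le_trans (le_of_eq ?_) h1
        rw [hC₁]
        simp [Nat.factorial]
        field_simp
        norm_num
      have t2 : √√(Real.exp (-((k : ℝ) / 2))) = Real.exp (-((k : ℝ) / 8)) := by
        rw [← Real.exp_half, ← Real.exp_half]
        congr 1; ring
      have t3 : ((k : ℝ) / 32 + 1) ^ d ≤ d.factorial * (Real.exp 1 * Real.exp (k / 32)) := by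
        have h1 := Real.pow_div_factorial_le_exp ((k : ℝ) / 32 + 1) (by positivity) d
        rw [div_le_iff₀ (by positivity), add_comm ((k : ℝ) / 32), Real.exp_add] at h1
        rw [add_comm ((k : ℝ) / 32)]
        linarith
      have t4 : Real.exp (-(Real.exp k * Real.exp (-((k : ℝ) / 2)) / 4)) ≤
          Real.exp (-((k : ℝ) / 8)) := by
        rw [← Real.exp_add]
        refine Real.exp_le_exp.2 ?_
        have := Real.add_one_le_exp ((k : ℝ) + -((k : ℝ) / 2))
        linarith
      rw [t2] at h
      refine h.trans ?_
      have hlast : 0 ≤ Real.exp ρ * Real.exp (k * (-κ.lowerRate)) := by positivity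
      refine le_trans (add_le_add t1 (le_of_le_of_eq (b := κ.expConst 1 * Real.exp (k / 32) *
        (2 * (κ.shellConst * (d.factorial * (Real.exp 1 * Real.exp (k / 32)) *
          Real.exp (-((k : ℝ) / 8)))) +
        2 * (Real.exp (-((k : ℝ) / 8)) * Real.exp (k / 32)) * κ.expConst 1) / Real.log ρ)
        ?_ ?_)) (le_add_of_nonneg_right hlast)
      · gcongr
      · have e : Real.exp (k * (-(1 / 16))) = Real.exp (k / 32) * Real.exp (k / 32) *
            Real.exp (-((k : ℝ) / 8)) := by
          rw [← Real.exp_add, ← Real.exp_add]; congr 1; ring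
        rw [e, hK]
        ring
    · have h := κ.measureReal_precision_lt_le hd hR hY hρ hn1 h0 k
      have e : (k : ℝ) * -κ.lowerRate = -(κ.lowerRate * k) := by ring
      rw [e]
      refine h.trans (le_add_of_nonneg_left (by positivity))

lemma measurable_precision (hY : IsUniformSample c R P Y) {ρ : ℝ} (hρ : 1 < ρ) (n : ℕ) :
    Measurable fun p : Euc d × Ω => κ.precision ρ n p.1 fun j => Y j p.2 := by
  refine measurable_gibbsPrecision hρ _ fun j => ?_
  exact (κ.measurable.comp (measurable_fst.prodMk
    ((hY.measurable j).comp measurable_snd))).const_mul _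

lemma measurableSet_hasLocal (hY : IsUniformSample c R P Y) (n : ℕ) :
    MeasurableSet {p : Euc d × Ω | κ.HasLocal n p.1 fun j => Y j p.2} := by
  have : {p : Euc d × Ω | κ.HasLocal n p.1 fun j => Y j p.2} =
      ⋃ j, ⋃ _ : j < n, {p | κ.toFun p.1 (Y j p.2) ≤ κ.localLevel} := by
    ext p
    simp [HasLocal]
  rw [this]
  refine MeasurableSet.iUnion fun j => MeasurableSet.iUnion fun _ => ?_
  exact measurableSet_le (κ.measurable.comp (measurable_fst.prodMk
    ((hY.measurable j).comp measurable_snd))) measurable_const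

/-- Two points of the sample have the same energy only far away. -/
lemma ae_local_energy_ne (hd : 0 < d) (hR : 0 < R) {y₀ : Euc d} (h0 : y₀ ∈ closedBall c R) :
    ∀ᵐ z ∂(uniformBall c R).prod (uniformBall c R),
      κ.toFun y₀ z.1 = κ.toFun y₀ z.2 → κ.localLevel < κ.toFun y₀ z.1 := by
  have := isProbabilityMeasure_uniformBall (c := c) hR
  have hm1 : Measurable fun z : Euc d × Euc d => κ.toFun y₀ z.1 :=
    (κ.measurable_right y₀).comp measurable_fst
  have hm2 : Measurable fun z : Euc d × Euc d => κ.toFun y₀ z.2 :=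
    (κ.measurable_right y₀).comp measurable_snd
  have hms : MeasurableSet {z : Euc d × Euc d |
      κ.toFun y₀ z.1 = κ.toFun y₀ z.2 → κ.localLevel < κ.toFun y₀ z.1} := by
    have : {z : Euc d × Euc d |
      κ.toFun y₀ z.1 = κ.toFun y₀ z.2 → κ.localLevel < κ.toFun y₀ z.1} =
      {z | κ.toFun y₀ z.1 = κ.toFun y₀ z.2}ᶜ ∪ {z | κ.localLevel < κ.toFun y₀ z.1} := by
      ext z
      simp [imp_iff_not_or]
    rw [this]
    exact (measurableSet_eq_fun hm1 hm2).compl.union (measurableSet_lt measurable_const hm1)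
  refine (Measure.ae_prod_iff_ae_ae hms).2 (Eventually.of_forall fun y => ?_)
  have h1 := measure_eq_zero_iff_ae_notMem.1 (κ.uniformBall_level_eq_zero hd hR h0 (κ.toFun y₀ y))
  filter_upwards [h1, ae_mem_uniformBall (c := c) (R := R)] with y' hy' hy'c heq
  by_contra! hcon
  refine hy' ⟨hy'c, κ.norm_le_rad h0 hy'c ?_, heq.symm⟩
  have := κ.localLevel_pos
  linarith

/-- A local sample point forces the minimal energy to be local, where ties have probability zero;
the ground state is then almost surely unique. -/
lemma ae_precision_pos (hd : 0 < d) (hR : 0 < R) (hY : IsUniformSample c R P Y)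
    {ρ : ℝ} (hρ : 1 < ρ) {n : ℕ} (hn : ρ < n) {y₀ : Euc d} (h0 : y₀ ∈ closedBall c R) :
    ∀ᵐ ω ∂P, κ.HasLocal n y₀ (fun j => Y j ω) → 0 < κ.precision ρ n y₀ (fun j => Y j ω) := by
  have hn0 : 0 < n := by
    have : (0 : ℝ) < n := by linarith
    exact_mod_cast this
  have hp := precScale_pos d hn0
  have h1 : ∀ i j : ℕ, i ≠ j → ∀ᵐ ω ∂P, κ.toFun y₀ (Y i ω) = κ.toFun y₀ (Y j ω) →
      κ.localLevel < κ.toFun y₀ (Y i ω) := by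
    intro i j hij
    have h := κ.ae_local_energy_ne hd hR h0
    rw [← hY.map_prod hij] at h
    exact ae_of_ae_map ((hY.measurable i).prodMk (hY.measurable j)).aemeasurable h
  have h2 : ∀ᵐ ω ∂P, ∀ i j : ℕ, i ≠ j → κ.toFun y₀ (Y i ω) = κ.toFun y₀ (Y j ω) →
      κ.localLevel < κ.toFun y₀ (Y i ω) := by
    simpa only [ae_all_iff] using h1
  filter_upwards [h2] with ω hω
  rintro ⟨l, hl, hll⟩
  obtain ⟨i, hi, hmin⟩ := Finset.exists_min_image (Finset.range n)
    (fun j => κ.toFun y₀ (Y j ω)) ⟨l, Finset.mem_range.2 hl⟩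
  refine gibbsPrecision_pos hρ hi (fun j hj hji => ?_) (by simpa using hn)
  refine mul_lt_mul_of_pos_left (lt_of_le_of_ne (hmin j hj) fun heq => ?_) hp
  have := hω i j hji.symm heq
  have := hmin l (Finset.mem_range.2 hl)
  linarith

end MetricKernel

/-! ### Discretisation of the logarithm -/

lemma card_filter_lt_le (N : ℕ) (u : ℝ) :
    (((Finset.range N).filter fun i : ℕ => (i : ℝ) < u).card : ℝ) ≤ max 0 (u + 1) := by
  have h1 : (Finset.range N).filter (fun i : ℕ => (i : ℝ) < u) ⊆ Finset.range ⌈u⌉₊ := by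
    intro i hi
    rw [Finset.mem_range, Nat.lt_ceil]
    exact (Finset.mem_filter.1 hi).2
  have h2 := Finset.card_le_card h1
  rw [Finset.card_range] at h2
  have h3 : (((Finset.range N).filter fun i : ℕ => (i : ℝ) < u).card : ℝ) ≤ ⌈u⌉₊ := by
    exact_mod_cast h2
  refine h3.trans ?_
  rcases le_or_gt u 0 with h | h
  · rw [Nat.ceil_eq_zero.2 h]
    simp
  · exact (Nat.ceil_lt_add_one h.le).le.trans (le_max_right _ _)

lemma le_card_filter_lt (N : ℕ) (u : ℝ) :
    min (N : ℝ) u ≤ ((Finset.range N).filter fun i : ℕ => (i : ℝ) < u).card := by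
  have h1 : Finset.range (min N ⌈u⌉₊) ⊆ (Finset.range N).filter fun i : ℕ => (i : ℝ) < u := by
    intro i hi
    rw [Finset.mem_range, lt_min_iff, Nat.lt_ceil] at hi
    exact Finset.mem_filter.2 ⟨Finset.mem_range.2 hi.1, hi.2⟩
  have h2 := Finset.card_le_card h1
  rw [Finset.card_range] at h2
  have h3 : ((min N ⌈u⌉₊ : ℕ) : ℝ) ≤ ((Finset.range N).filter fun i : ℕ => (i : ℝ) < u).card := by
    exact_mod_cast h2
  refine le_trans ?_ h3
  rw [Nat.cast_min]
  exact min_le_min le_rfl (Nat.le_ceil u)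

/-- The grid of mesh `1 / m` in `[-m, m]`. -/
def gridPoint (m i : ℕ) : ℝ := -m + i / m

/-- A real number is recovered from smoothed indicators of the half-lines at the grid points. -/
lemma abs_sub_discretisation_le {m : ℕ} (hm : 0 < m) {x : ℝ} {χ b : ℕ → ℝ}
    (h0 : ∀ i, 0 ≤ χ i) (h1 : ∀ i, χ i ≤ 1) (hχ : ∀ i, x ≤ gridPoint m i → χ i = 0)
    (hb0 : ∀ i, 0 ≤ b i) (hb : ∀ i, gridPoint m (i + 1) < x → 1 - b i ≤ χ i) :
    |x - (-m + (m : ℝ)⁻¹ * ∑ i ∈ Finset.range (2 * m ^ 2), χ i)| ≤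
      (m : ℝ)⁻¹ + max 0 (x - m) + max 0 (-m - x) +
        (m : ℝ)⁻¹ * ∑ i ∈ Finset.range (2 * m ^ 2), b i := by
  have hm' : (0 : ℝ) < m := by exact_mod_cast hm
  have hgrid : ∀ i : ℕ, gridPoint m i < x ↔ (i : ℝ) < m * (x + m) := by
    intro i
    rw [gridPoint, neg_add_lt_iff_lt_add, div_lt_iff₀ hm', add_comm (m : ℝ) x, mul_comm (m : ℝ)]
  -- The number of grid points below `x` is about `m (x + m)` when `|x| ≤ m`, so the count divided
  -- by `m` recovers `x + m` up to one mesh. Values outside `[-m, m]` account for the two positive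
  -- parts.
  have hup : ∑ i ∈ Finset.range (2 * m ^ 2), χ i ≤ max 0 (m * (x + m) + 1) := by
    refine le_trans ?_ (card_filter_lt_le (2 * m ^ 2) (m * (x + m)))
    rw [Finset.card_filter, Nat.cast_sum]
    refine Finset.sum_le_sum fun i _ => ?_
    split_ifs with h
    · simpa using h1 i
    · rw [hχ i (not_lt.1 fun h' => h ((hgrid i).1 h'))]
      simp
  have hlow : min ((2 * m ^ 2 : ℕ) : ℝ) (m * (x + m) - 1) ≤
      ∑ i ∈ Finset.range (2 * m ^ 2), χ i + ∑ i ∈ Finset.range (2 * m ^ 2), b i := by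
    refine le_trans (le_card_filter_lt (2 * m ^ 2) (m * (x + m) - 1)) ?_
    rw [Finset.card_filter, Nat.cast_sum, ← Finset.sum_add_distrib]
    refine Finset.sum_le_sum fun i _ => ?_
    split_ifs with h
    · have : gridPoint m (i + 1) < x := by
        rw [hgrid]
        push_cast
        linarith
      have := hb i this
      push_cast
      linarith
    · have := h0 i
      have := hb0 i
      push_cast
      linarith
  set A := ∑ i ∈ Finset.range (2 * m ^ 2), χ i
  set B := ∑ i ∈ Finset.range (2 * m ^ 2), b i
  have hB : 0 ≤ B := Finset.sum_nonneg fun i _ => hb0 i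
  have hup' : (m : ℝ)⁻¹ * A ≤ max 0 (x + m + (m : ℝ)⁻¹) := by
    have := mul_le_mul_of_nonneg_left hup (inv_nonneg.2 hm'.le)
    rw [mul_max_of_nonneg _ _ (inv_nonneg.2 hm'.le), mul_zero, mul_add,
      inv_mul_cancel_left₀ hm'.ne', mul_one] at this
    exact this
  have hlow' : min (2 * m : ℝ) (x + m - (m : ℝ)⁻¹) ≤ (m : ℝ)⁻¹ * A + (m : ℝ)⁻¹ * B := by
    have := mul_le_mul_of_nonneg_left hlow (inv_nonneg.2 hm'.le)
    rw [mul_min_of_nonneg _ _ (inv_nonneg.2 hm'.le), mul_sub,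
      inv_mul_cancel_left₀ hm'.ne', mul_one, mul_add] at this
    refine le_trans (le_of_eq ?_) this
    congr 1
    push_cast
    field_simp
  have hmi : 0 < (m : ℝ)⁻¹ := inv_pos.2 hm'
  have hmB : 0 ≤ (m : ℝ)⁻¹ * B := by positivity
  rw [abs_le]
  constructor
  · rcases le_total 0 (x + m + (m : ℝ)⁻¹) with h | h
    · rw [max_eq_right h] at hup'
      have := le_max_left 0 (x - m)
      have := le_max_left 0 (-m - x)
      linarith
    · rw [max_eq_left h] at hup'
      have := le_max_left 0 (x - m)
      have := le_max_right 0 (-m - x)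
      linarith
  · rcases le_total (2 * m : ℝ) (x + m - (m : ℝ)⁻¹) with h | h
    · rw [min_eq_left h] at hlow'
      have := le_max_right 0 (x - m)
      have := le_max_left 0 (-m - x)
      linarith
    · rw [min_eq_right h] at hlow'
      have := le_max_left 0 (x - m)
      have := le_max_left 0 (-m - x)
      linarith

/-- A discrete layer-cake bound, which turns tail probabilities at integers into a first moment. -/
lemma ofReal_le_tsum_indicator (t : ℝ) :
    ENNReal.ofReal t ≤ ∑' k : ℕ, {t : ℝ | (k : ℝ) < t}.indicator 1 t := by
  refine le_trans ?_ (ENNReal.sum_le_tsum (Finset.range ⌈t⌉₊))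
  have h : ∀ k ∈ Finset.range ⌈t⌉₊, {t : ℝ | (k : ℝ) < t}.indicator (1 : ℝ → ENNReal) t = 1 := by
    intro k hk
    rw [Finset.mem_range, Nat.lt_ceil] at hk
    rw [Set.indicator_of_mem (by exact hk)]
    rfl
  rw [Finset.sum_congr rfl h, Finset.sum_const, Finset.card_range, nsmul_eq_mul, mul_one,
    ← ENNReal.ofReal_natCast]
  exact ENNReal.ofReal_le_ofReal (Nat.le_ceil t)

end NeighbourEmbedding
end

noncomputable section
namespace NeighbourEmbedding
open MeasureTheory ProbabilityTheory Matrix Filter Topology Metric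

/-! ### Convergence of the mean logarithm of the scaled precision -/

namespace MetricKernel
variable {d : ℕ} {c : Euc d} {R : ℝ} (κ : MetricKernel c R)
variable {Ω : Type*} [MeasurableSpace Ω] {P : Measure Ω} [IsProbabilityMeasure P]
  {Y : ℕ → Ω → Euc d}

/-- The discretisation of the logarithm of the scaled precision. -/
def discretisation (ρ : ℝ) (m : ℕ) (η : ℝ) (n : ℕ) (y₀ : Euc d) (y : ℕ → Euc d) : ℝ :=
  -m + (m : ℝ)⁻¹ * ∑ i ∈ Finset.range (2 * m ^ 2),
    rampExcess ρ (Real.exp (gridPoint m i)) η (κ.scaledSums (Real.exp (gridPoint m i)) n y₀ y)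

/-- The set where the excess entropy is small at a grid point, but positive at the next one. -/
def badSet (ρ : ℝ) (m : ℕ) (η : ℝ) (n i : ℕ) (y₀ : Euc d) : Set (ℕ → Euc d) :=
  {y | entropyExcess ρ (Finset.range n) (κ.energy n y₀ y) (Real.exp (gridPoint m i)) < η ∧
    0 < entropyExcess ρ (Finset.range n) (κ.energy n y₀ y) (Real.exp (gridPoint m (i + 1)))}

/-- The ramp of the excess at a grid point vanishes when the grid point is not below the log
precision. When even the next grid point is below it, the ramp can differ from one only on the bad
set of that index. -/
lemma abs_log_precision_sub_le {ρ : ℝ} (hρ : 1 < ρ) {m : ℕ} (hm : 0 < m) {η : ℝ} (hη : 0 < η)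
    {n : ℕ} {y₀ : Euc d} {y : ℕ → Euc d} (hpos : 0 < κ.precision ρ n y₀ y) :
    |Real.log (κ.precision ρ n y₀ y) - κ.discretisation ρ m η n y₀ y| ≤
      (m : ℝ)⁻¹ + max 0 (Real.log (κ.precision ρ n y₀ y) - m) +
        max 0 (-m - Real.log (κ.precision ρ n y₀ y)) +
        (m : ℝ)⁻¹ * ∑ i ∈ Finset.range (2 * m ^ 2), (κ.badSet ρ m η n i y₀).indicator 1 y := by
  have hlt : ∀ t : ℝ, 0 < entropyExcess ρ (Finset.range n) (κ.energy n y₀ y) (Real.exp t) ↔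
      t < Real.log (κ.precision ρ n y₀ y) := by
    intro t
    rw [entropyExcess_pos_iff_lt hρ (Real.exp_pos t) hpos, Real.lt_log_iff_exp_lt hpos]
    rfl
  refine abs_sub_discretisation_le hm ?_ ?_ ?_ ?_ ?_
  · exact fun i => ramp_nonneg _ _
  · exact fun i => ramp_le_one _ _
  · intro i hi
    rw [κ.rampExcess_scaledSums]
    exact ramp_eq_zero hη (not_lt.1 fun h => absurd ((hlt _).1 h) (not_lt.2 hi))
  · exact fun i => Set.indicator_nonneg (fun _ _ => zero_le_one) _
  · intro i hi
    rw [κ.rampExcess_scaledSums]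
    by_cases hb : y ∈ κ.badSet ρ m η n i y₀
    · rw [Set.indicator_of_mem hb, Pi.one_apply, sub_self]
      exact ramp_nonneg _ _
    · have : η ≤ entropyExcess ρ (Finset.range n) (κ.energy n y₀ y)
          (Real.exp (gridPoint m i)) := by
        by_contra! hc
        exact hb ⟨hc, (hlt _).2 hi⟩
      rw [ramp_eq_one hη this, Set.indicator_of_notMem hb, sub_zero]

lemma measurable_precision_right (hY : IsUniformSample c R P Y) {ρ : ℝ} (hρ : 1 < ρ) (n : ℕ)
    (y₀ : Euc d) : Measurable fun ω => κ.precision ρ n y₀ fun j => Y j ω :=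
  measurable_gibbsPrecision hρ _ fun j =>
    ((κ.measurable_right y₀).comp (hY.measurable j)).const_mul _

lemma measurableSet_hasLocal_right (hY : IsUniformSample c R P Y) (n : ℕ) (y₀ : Euc d) :
    MeasurableSet {ω | κ.HasLocal n y₀ fun j => Y j ω} := by
  have : {ω | κ.HasLocal n y₀ fun j => Y j ω} =
      ⋃ j, ⋃ _ : j < n, {ω | κ.toFun y₀ (Y j ω) ≤ κ.localLevel} := by
    ext p
    simp [HasLocal]
  rw [this]
  exact MeasurableSet.iUnion fun j => MeasurableSet.iUnion fun _ =>
    measurableSet_le ((κ.measurable_right y₀).comp (hY.measurable j)) measurable_const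

lemma measurable_entropyExcess (hY : IsUniformSample c R P Y) (ρ : ℝ) (n : ℕ) (y₀ : Euc d) (α : ℝ) :
    Measurable fun ω => entropyExcess ρ (Finset.range n) (κ.energy n y₀ fun j => Y j ω) α := by
  have h : ∀ j, Measurable fun ω => κ.energy n y₀ (fun j => Y j ω) j := fun j =>
    ((κ.measurable_right y₀).comp (hY.measurable j)).const_mul _
  unfold entropyExcess partitionSum energySum
  fun_prop

lemma measurable_discretisation (hY : IsUniformSample c R P Y) (ρ : ℝ) (m : ℕ) (η : ℝ) (n : ℕ) :
    Measurable fun p : Euc d × Ω => κ.discretisation ρ m η n p.1 fun j => Y j p.2 := by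
  unfold discretisation
  refine measurable_const.add (measurable_const.mul (Finset.measurable_sum _ fun i _ => ?_))
  exact (rampExcess ρ (Real.exp (gridPoint m i)) η).continuous.measurable.comp
    (κ.measurable_scaledSums_uncurry hY _ n)

/-- The discretisation error, on the event that some point is local. -/
def discretisationError (ρ : ℝ) (m : ℕ) (η : ℝ) (n : ℕ) (y₀ : Euc d) (y : ℕ → Euc d) : ENNReal :=
  {y | κ.HasLocal n y₀ y ∧ 0 < κ.precision ρ n y₀ y}.indicator (fun y => ENNReal.ofReal
    |Real.log (κ.precision ρ n y₀ y) - κ.discretisation ρ m η n y₀ y|) y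

lemma measurable_discretisationError (hY : IsUniformSample c R P Y) {ρ : ℝ} (hρ : 1 < ρ) (m : ℕ)
    (η : ℝ) (n : ℕ) :
    Measurable fun p : Euc d × Ω => κ.discretisationError ρ m η n p.1 fun j => Y j p.2 := by
  have h1 := κ.measurable_precision hY hρ n
  have h2 := κ.measurable_discretisation hY ρ m η n
  have h3 := κ.measurableSet_hasLocal hY n
  have h4 : MeasurableSet {p : Euc d × Ω | κ.HasLocal n p.1 (fun j => Y j p.2) ∧
      0 < κ.precision ρ n p.1 fun j => Y j p.2} :=
    h3.inter (measurableSet_lt measurable_const h1)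
  exact Measurable.indicator (f := fun p : Euc d × Ω => ENNReal.ofReal
    |Real.log (κ.precision ρ n p.1 fun j => Y j p.2) -
      κ.discretisation ρ m η n p.1 fun j => Y j p.2|) (by fun_prop) h4

lemma lintegral_positive_part_le {A : Set Ω} {X : Ω → ℝ} (hA : MeasurableSet A)
    (hX : Measurable X) {b : ℕ → ℝ} (hb : Summable b)
    (h : ∀ k : ℕ, P.real (A ∩ {ω | (k : ℝ) < X ω}) ≤ b k) :
    ∫⁻ ω, A.indicator (fun ω => ENNReal.ofReal (max 0 (X ω))) ω ∂P ≤
      ENNReal.ofReal (∑' k, b k) := by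
  have hb0 : ∀ k, 0 ≤ b k := fun k => measureReal_nonneg.trans (h k)
  have h1 : ∀ ω, A.indicator (fun ω => ENNReal.ofReal (max 0 (X ω))) ω ≤
      ∑' k : ℕ, (A ∩ {ω | (k : ℝ) < X ω}).indicator 1 ω := by
    intro ω
    refine Set.indicator_apply_le' (fun hω => ?_) fun _ => zero_le
    have h2 := ofReal_le_tsum_indicator (X ω)
    rw [ENNReal.ofReal_max, ENNReal.ofReal_zero, max_eq_right (zero_le)]
    refine h2.trans (le_of_eq ?_)
    congr 1
    ext1 k
    by_cases hk : (k : ℝ) < X ω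
    · rw [Set.indicator_of_mem (by exact hk), Set.indicator_of_mem (by exact ⟨hω, hk⟩)]
      rfl
    · rw [Set.indicator_of_notMem (by exact hk), Set.indicator_of_notMem (by exact fun h => hk h.2)]
  refine (lintegral_mono h1).trans ?_
  have hm : ∀ k : ℕ, MeasurableSet (A ∩ {ω | (k : ℝ) < X ω}) := fun k =>
    hA.inter (measurableSet_lt measurable_const hX)
  rw [lintegral_tsum fun k => (measurable_one.indicator (hm k)).aemeasurable,
    ENNReal.ofReal_tsum_of_nonneg hb0 hb]
  refine ENNReal.tsum_le_tsum fun k => ?_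
  rw [lintegral_indicator_one (hm k), ← ofReal_measureReal]
  exact ENNReal.ofReal_le_ofReal (h k)

/-- The order of choices matters: `m` makes the mesh and the tails small, then `η` makes the
finitely many bad sets unlikely, and only then is `n` taken large. The bound is uniform in `y₀`, so
it can be integrated. -/
lemma exists_forall_lintegral_discretisationError_le (hd : 0 < d) (hR : 0 < R)
    (hY : IsUniformSample c R P Y) {ρ : ℝ} (hρ : 1 < ρ) {ε : ℝ} (hε : 0 < ε) :
    ∀ᶠ m : ℕ in atTop, ∀ᶠ η in 𝓝[>] (0 : ℝ), ∀ᶠ n : ℕ in atTop, ∀ y₀ ∈ closedBall c R,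
      ∫⁻ ω, κ.discretisationError ρ m η n y₀ (fun j => Y j ω) ∂P ≤ ENNReal.ofReal ε := by
  obtain ⟨b, hbs, hb0, hbn⟩ := κ.exists_summable_tail hd hR hY hρ
  have htail : Tendsto (fun m : ℕ => ∑' k, b (k + m)) atTop (𝓝 0) :=
    tendsto_sum_nat_add b
  have hinv : Tendsto (fun m : ℕ => ((m : ℕ) : ℝ)⁻¹) atTop (𝓝 0) :=
    tendsto_inv_atTop_zero.comp tendsto_natCast_atTop_atTop
  have hlim : Tendsto (fun m : ℕ => (m : ℝ)⁻¹ + ∑' k, b (k + m) + ∑' k, b (k + m) + (m : ℝ)⁻¹)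
      atTop (𝓝 0) := by
    simpa using ((hinv.add htail).add htail).add hinv
  filter_upwards [hlim.eventually_le_const hε, eventually_ge_atTop 32] with m hmε hm32
  have hm0 : 0 < m := by omega
  have hm' : (0 : ℝ) < m := by exact_mod_cast hm0
  have hgrid : ∀ i, Real.exp (gridPoint m i) < Real.exp (gridPoint m (i + 1)) := by
    intro i
    refine Real.exp_lt_exp.2 ?_
    unfold gridPoint
    gcongr
    simp
  -- There are `2 m²` grid points; with this probability for each, the bad sets have total
  -- probability at most one, and the prefactor `1 / m` makes their contribution small.
  have hθ : 0 < (2 * (m : ℝ) ^ 2)⁻¹ := by positivity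
  choose η₀ hη₀ hη₀n using fun i => κ.exists_forall_measureReal_excess_le hd hR hY ρ
    (Real.exp_pos (gridPoint m i)) (hgrid i) hθ
  have hη : ∀ᶠ η in 𝓝[>] (0 : ℝ), ∀ i ∈ Finset.range (2 * m ^ 2), η ≤ η₀ i := by
    rw [Filter.eventually_all_finset]
    intro i _
    exact eventually_nhdsWithin_of_eventually_nhds (eventually_le_nhds (hη₀ i))
  filter_upwards [hη, self_mem_nhdsWithin] with η hηle hη0
  have hη0' : (0 : ℝ) < η := hη0
  have hn : ∀ᶠ n : ℕ in atTop, ∀ i ∈ Finset.range (2 * m ^ 2), ∀ y₀ ∈ closedBall c R,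
      P.real {ω | (fun j => Y j ω) ∈ κ.badSet ρ m η n i y₀} ≤ (2 * (m : ℝ) ^ 2)⁻¹ := by
    rw [Filter.eventually_all_finset]
    intro i hi
    filter_upwards [hη₀n i] with n hn y₀ h0
    refine (measureReal_mono fun ω hω => ?_).trans (hn y₀ h0)
    exact ⟨hω.1.trans_le (hηle i hi), hω.2⟩
  filter_upwards [hn, hbn] with n hnbad hntail y₀ h0
  set A : Set Ω := {ω | κ.HasLocal n y₀ (fun j => Y j ω) ∧
    0 < κ.precision ρ n y₀ fun j => Y j ω} with hA
  set X : Ω → ℝ := fun ω => Real.log (κ.precision ρ n y₀ fun j => Y j ω) with hX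
  have hpm : Measurable fun ω => κ.precision ρ n y₀ fun j => Y j ω :=
    κ.measurable_precision_right hY hρ n y₀
  have hXm : Measurable X := hpm.log
  have hAm : MeasurableSet A :=
    (κ.measurableSet_hasLocal_right hY n y₀).inter (measurableSet_lt measurable_const hpm)
  have hbadm : ∀ i, MeasurableSet {ω | (fun j => Y j ω) ∈ κ.badSet ρ m η n i y₀} := fun i =>
    (measurableSet_lt (κ.measurable_entropyExcess hY ρ n y₀ _) measurable_const).inter
      (measurableSet_lt measurable_const (κ.measurable_entropyExcess hY ρ n y₀ _))
  have hpt : ∀ ω, κ.discretisationError ρ m η n y₀ (fun j => Y j ω) ≤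
      ENNReal.ofReal (m : ℝ)⁻¹ + A.indicator (fun ω => ENNReal.ofReal (max 0 (X ω - m))) ω +
        A.indicator (fun ω => ENNReal.ofReal (max 0 (-m - X ω))) ω +
        ENNReal.ofReal (m : ℝ)⁻¹ * ∑ i ∈ Finset.range (2 * m ^ 2),
          {ω | (fun j => Y j ω) ∈ κ.badSet ρ m η n i y₀}.indicator 1 ω := by
    intro ω
    refine Set.indicator_apply_le' (fun hω => ?_) fun _ => zero_le
    have hωA : ω ∈ A := hω
    rw [Set.indicator_of_mem hωA, Set.indicator_of_mem hωA]
    have h1 := κ.abs_log_precision_sub_le hρ hm0 hη0' hω.2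
    refine (ENNReal.ofReal_le_ofReal h1).trans (le_of_eq ?_)
    have hs1 : ∀ i ∈ Finset.range (2 * m ^ 2), 0 ≤ (κ.badSet ρ m η n i y₀).indicator
        (1 : (ℕ → Euc d) → ℝ) (fun j => Y j ω) := fun i _ =>
      Set.indicator_nonneg (fun _ _ => zero_le_one) _
    have hs := Finset.sum_nonneg hs1
    rw [ENNReal.ofReal_add (by positivity) (by positivity),
      ENNReal.ofReal_add (by positivity) (by positivity),
      ENNReal.ofReal_add (by positivity) (by positivity),
      ENNReal.ofReal_mul (by positivity), ENNReal.ofReal_sum_of_nonneg hs1]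
    congr 2
    refine Finset.sum_congr rfl fun i _ => ?_
    by_cases hb : (fun j => Y j ω) ∈ κ.badSet ρ m η n i y₀
    · rw [Set.indicator_of_mem hb, Set.indicator_of_mem (by exact hb)]
      simp
    · rw [Set.indicator_of_notMem hb, Set.indicator_of_notMem (by exact hb)]
      simp
  have hbs' : Summable fun k => b (k + m) := (summable_nat_add_iff m).2 hbs
  have hu : ∫⁻ ω, A.indicator (fun ω => ENNReal.ofReal (max 0 (X ω - m))) ω ∂P ≤
      ENNReal.ofReal (∑' k, b (k + m)) := by
    refine lintegral_positive_part_le hAm (hXm.sub_const _) hbs' fun k => ?_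
    refine (measureReal_mono ?_).trans (hntail (k + m) (by omega) y₀ h0).1
    rintro ω ⟨hωA, hω⟩
    refine ⟨hωA.1, ?_⟩
    have h2 : (k : ℝ) < X ω - m := hω
    rw [← Real.lt_log_iff_exp_lt hωA.2]
    push_cast
    simp only [hX] at h2
    linarith
  have hl : ∫⁻ ω, A.indicator (fun ω => ENNReal.ofReal (max 0 (-m - X ω))) ω ∂P ≤
      ENNReal.ofReal (∑' k, b (k + m)) := by
    refine lintegral_positive_part_le hAm (hXm.const_sub _) hbs' fun k => ?_
    refine (measureReal_mono ?_).trans (hntail (k + m) (by omega) y₀ h0).2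
    rintro ω ⟨hωA, hω⟩
    refine ⟨hωA.2, ?_⟩
    have h2 : (k : ℝ) < -m - X ω := hω
    rw [← Real.log_lt_iff_lt_exp hωA.2]
    push_cast
    simp only [hX] at h2
    linarith
  refine (lintegral_mono hpt).trans ?_
  have hm1 : Measurable fun ω => A.indicator (fun ω => ENNReal.ofReal (max 0 (X ω - m))) ω :=
    Measurable.indicator (by fun_prop) hAm
  have hm2 : Measurable fun ω => A.indicator (fun ω => ENNReal.ofReal (max 0 (-m - X ω))) ω :=
    Measurable.indicator (by fun_prop) hAm
  have hm3 : ∀ i ∈ Finset.range (2 * m ^ 2), Measurable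
      ({ω | (fun j => Y j ω) ∈ κ.badSet ρ m η n i y₀}.indicator (1 : Ω → ENNReal)) := fun i _ =>
    measurable_one.indicator (hbadm i)
  have hm4 : Measurable fun ω => ∑ i ∈ Finset.range (2 * m ^ 2),
      {ω | (fun j => Y j ω) ∈ κ.badSet ρ m η n i y₀}.indicator (1 : Ω → ENNReal) ω :=
    Finset.measurable_sum _ hm3
  rw [lintegral_add_right _ (hm4.const_mul _), lintegral_add_right _ hm2,
    lintegral_add_right _ hm1, lintegral_const_mul _ hm4, lintegral_finsetSum _ hm3]
  have hbad : ENNReal.ofReal (m : ℝ)⁻¹ * ∑ i ∈ Finset.range (2 * m ^ 2),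
      ∫⁻ ω, {ω | (fun j => Y j ω) ∈ κ.badSet ρ m η n i y₀}.indicator 1 ω ∂P ≤
      ENNReal.ofReal (m : ℝ)⁻¹ := by
    refine mul_le_of_le_one_right (zero_le) ?_
    calc _ ≤ ∑ i ∈ Finset.range (2 * m ^ 2), ENNReal.ofReal (2 * (m : ℝ) ^ 2)⁻¹ := by
          refine Finset.sum_le_sum fun i hi => ?_
          rw [lintegral_indicator_one (hbadm i), ← ofReal_measureReal]
          exact ENNReal.ofReal_le_ofReal (hnbad i hi y₀ h0)
      _ = ENNReal.ofReal ((2 * m ^ 2 : ℕ) * (2 * (m : ℝ) ^ 2)⁻¹) := by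
          rw [Finset.sum_const, Finset.card_range, nsmul_eq_mul,
            ENNReal.ofReal_mul (by positivity), ENNReal.ofReal_natCast]
      _ = 1 := by
          push_cast
          rw [mul_inv_cancel₀ (by positivity), ENNReal.ofReal_one]
  refine (add_le_add (add_le_add (add_le_add
    (show ∫⁻ _, ENNReal.ofReal (m : ℝ)⁻¹ ∂P ≤ ENNReal.ofReal (m : ℝ)⁻¹ by simp) hu) hl) hbad).trans ?_
  have hT : 0 ≤ ∑' k, b (k + m) := tsum_nonneg fun k => hb0 _
  rw [← ENNReal.ofReal_add (by positivity) hT, ← ENNReal.ofReal_add (by positivity) hT,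
    ← ENNReal.ofReal_add (by positivity) (by positivity)]
  exact ENNReal.ofReal_le_ofReal hmε

end MetricKernel
end NeighbourEmbedding
end

noncomputable section
namespace NeighbourEmbedding
open MeasureTheory ProbabilityTheory Matrix Filter Topology Metric

/-! ### Laws of large numbers -/

namespace IsUniformSample
variable {d : ℕ} {Ω : Type*} [MeasurableSpace Ω] {c : Euc d} {R : ℝ}
    {P : Measure Ω} [IsProbabilityMeasure P] {Y : ℕ → Ω → Euc d}

lemma tendsto_measureReal_average (hY : IsUniformSample c R P Y) (hR : 0 < R) {g : Euc d → ℝ}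
    (hg : Measurable g) {C : ℝ} (hC : ∀ y ∈ closedBall c R, |g y| ≤ C) {ε : ℝ} (hε : 0 < ε) :
    Tendsto (fun n : ℕ => P.real {ω | ε ≤ |(∑ j ∈ Finset.range n, g (Y j ω)) / n -
      ∫ y, g y ∂uniformBall c R|}) atTop (𝓝 0) := by
  have := isProbabilityMeasure_uniformBall (c := c) hR
  have hm : ∀ j, Measurable fun ω => g (Y j ω) := fun j => hg.comp (hY.measurable j)
  have h1 := strong_law_ae_real (μ := P) (fun j ω => g (Y j ω)) ?_ ?_ ?_
  · rw [hY.integral_comp 0 hg] at h1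
    have h2 := tendstoInMeasure_of_tendsto_ae (μ := P) (f := fun n : ℕ => fun ω =>
      (∑ j ∈ Finset.range n, g (Y j ω)) / n) (fun n =>
      ((Finset.measurable_sum _ fun j _ => hm j).div_const _).aestronglyMeasurable) h1
    have h3 := tendstoInMeasure_iff_measureReal_norm.1 h2 ε hε
    simpa only [Real.norm_eq_abs] using h3
  · refine Integrable.of_bound (hm 0).aestronglyMeasurable C ?_
    filter_upwards [hY.ae_mem] with ω hω using hC _ (hω 0)
  · intro i j hij
    exact (hY.indep.indepFun hij).comp hg hg
  · intro i
    refine IdentDistrib.comp (u := g) ⟨(hY.measurable i).aemeasurable,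
      (hY.measurable 0).aemeasurable, ?_⟩ hg
    rw [hY.law, hY.law]

/-- With high probability, every ball of given radius contains a positive fraction of the
sample. -/
lemma exists_fraction (hY : IsUniformSample c R P Y) (hR : 0 < R) {δ : ℝ} (hδ : 0 < δ) :
    ∃ q : ℝ, 0 < q ∧ Tendsto (fun n : ℕ => P.real {ω | ¬ ∀ y ∈ closedBall c R, q * n ≤
      (((Finset.range n).filter fun j => dist (Y j ω) y ≤ δ).card : ℝ)}) atTop (𝓝 0) := by
  classical
  have := isProbabilityMeasure_uniformBall (c := c) hR
  -- Every `y` is within `r` of one of finitely many centres `x`, and the ball of radius `r` about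
  -- `x` then lies within `δ` of `y`; the law of large numbers is needed only at those centres. Half
  -- of the lower bound `p` is given up for fluctuations.
  set r := min (δ / 2) R with hr
  have hr0 : 0 < r := lt_min (by positivity) hR
  obtain ⟨t, htK, htf, htc⟩ := (isCompact_closedBall c R).finite_cover_balls hr0
  set p := (r / 2) ^ d / R ^ d with hp
  have hp0 : 0 < p := by positivity
  refine ⟨p / 2, by positivity, ?_⟩
  have hlim : Tendsto (fun n : ℕ => ∑ x ∈ htf.toFinset, P.real {ω | p / 2 ≤
      |(∑ j ∈ Finset.range n, (closedBall x r).indicator (1 : Euc d → ℝ) (Y j ω)) / n -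
      ∫ y, (closedBall x r).indicator (1 : Euc d → ℝ) y ∂uniformBall c R|}) atTop (𝓝 0) := by
    have h := tendsto_finsetSum htf.toFinset fun x _ => hY.tendsto_measureReal_average hR
      (g := (closedBall x r).indicator 1) (measurable_one.indicator measurableSet_closedBall)
      (C := 1) (fun y _ => by
        by_cases hy : y ∈ closedBall x r
        · rw [Set.indicator_of_mem hy]; simp
        · rw [Set.indicator_of_notMem hy]; simp) (ε := p / 2) (by positivity)
    simpa using h
  refine squeeze_zero' (Eventually.of_forall fun _ => measureReal_nonneg) ?_ hlim
  filter_upwards [eventually_gt_atTop 0] with n hn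
  have hn' : (0 : ℝ) < n := by exact_mod_cast hn
  refine le_trans (measureReal_mono ?_ (measure_ne_top _ _)) (measureReal_biUnion_finset_le _ _)
  intro ω hω
  by_contra hcon
  refine hω fun y hy => ?_
  simp only [Set.mem_iUnion, not_exists] at hcon
  obtain ⟨x, hx, hyx⟩ := Set.mem_iUnion₂.1 (htc hy)
  have h1 := hcon x (htf.mem_toFinset.2 hx)
  simp only [Set.mem_ofPred_eq, not_le] at h1
  rw [integral_indicator_one measurableSet_closedBall, abs_lt] at h1
  have h2 := le_uniformBall_real_closedBall hR (htK hx) hr0.le (min_le_right _ _)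
  have h3 : p / 2 ≤ (∑ j ∈ Finset.range n, (closedBall x r).indicator (1 : Euc d → ℝ)
      (Y j ω)) / n := by linarith [h1.1]
  rw [le_div_iff₀ hn'] at h3
  refine h3.trans ?_
  rw [Finset.card_filter, Nat.cast_sum]
  refine Finset.sum_le_sum fun j _ => ?_
  refine Set.indicator_apply_le' (fun hj => ?_) fun _ => by positivity
  rw [if_pos]
  · simp
  · have h4 := mem_closedBall.1 hj
    have h5 := mem_ball.1 hyx
    have h6 := dist_triangle_right (Y j ω) y x
    have h7 := min_le_left (δ / 2) R
    linarith

end IsUniformSample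

namespace MetricKernel
variable {d : ℕ} {c : Euc d} {R : ℝ} (κ : MetricKernel c R)
variable {Ω : Type*} [MeasurableSpace Ω] {P : Measure Ω} [IsProbabilityMeasure P]
  {Y : ℕ → Ω → Euc d}

/-- Within this distance all points are local. -/
def localRadius : ℝ := √(κ.localLevel / κ.hi)

lemma localRadius_pos : 0 < κ.localRadius :=
  Real.sqrt_pos.2 (div_pos κ.localLevel_pos κ.hi_pos)

lemma toFun_le_localLevel {y₀ y : Euc d} (h0 : y₀ ∈ closedBall c R) (hy : y ∈ closedBall c R)
    (h : dist y y₀ ≤ κ.localRadius) : κ.toFun y₀ y ≤ κ.localLevel := by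
  have hhi := κ.hi_pos
  have h1 := κ.upper y₀ h0 y hy
  rw [dist_eq_norm] at h
  have h2 : ‖y - y₀‖ ^ 2 ≤ κ.localLevel / κ.hi := by
    calc _ ≤ κ.localRadius ^ 2 := pow_le_pow_left₀ (norm_nonneg _) h 2
      _ = _ := Real.sq_sqrt (div_pos κ.localLevel_pos hhi).le
  rw [le_div_iff₀ hhi] at h2
  linarith

lemma tendsto_measureReal_not_hasLocal (hR : 0 < R) (hY : IsUniformSample c R P Y) :
    Tendsto (fun n : ℕ => P.real {ω | ¬ ∀ y ∈ closedBall c R, κ.HasLocal n y fun j => Y j ω})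
      atTop (𝓝 0) := by
  obtain ⟨q, hq, hlim⟩ := hY.exists_fraction hR κ.localRadius_pos
  refine squeeze_zero' (Eventually.of_forall fun _ => measureReal_nonneg) ?_ hlim
  filter_upwards [eventually_gt_atTop 0] with n hn
  refine measureReal_le_of_ae ?_
  filter_upwards [hY.ae_mem] with ω hω hbad hgood
  refine hbad fun y hy => ?_
  have h1 := hgood y hy
  have h2 : 0 < ((Finset.range n).filter fun j => dist (Y j ω) y ≤ κ.localRadius).card := by
    have hn' : (0 : ℝ) < n := by exact_mod_cast hn
    have : (0 : ℝ) < ((Finset.range n).filter fun j => dist (Y j ω) y ≤ κ.localRadius).card :=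
      lt_of_lt_of_le (by positivity) h1
    exact_mod_cast this
  obtain ⟨j, hj⟩ := Finset.card_pos.1 h2
  rw [Finset.mem_filter, Finset.mem_range] at hj
  exact ⟨j, hj.1, κ.toFun_le_localLevel hy (hω j) hj.2⟩

/-- Fubini exchanges the null sets: positivity is known for each base point almost surely, and is
needed for almost every base point along one sample. -/
lemma ae_ae_precision_pos (hd : 0 < d) (hR : 0 < R) (hY : IsUniformSample c R P Y)
    {ρ : ℝ} (hρ : 1 < ρ) {n : ℕ} (hn : ρ < n) :
    ∀ᵐ ω ∂P, ∀ᵐ y₀ ∂uniformBall c R, κ.HasLocal n y₀ (fun j => Y j ω) →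
      0 < κ.precision ρ n y₀ (fun j => Y j ω) := by
  have := isProbabilityMeasure_uniformBall (c := c) hR
  refine Measure.ae_ae_comm (p := fun y₀ ω => κ.HasLocal n y₀ (fun j => Y j ω) →
      0 < κ.precision ρ n y₀ (fun j => Y j ω)) ?_ |>.1 ?_
  · have : {z : Euc d × Ω | κ.HasLocal n z.1 (fun j => Y j z.2) →
        0 < κ.precision ρ n z.1 (fun j => Y j z.2)} =
        {z | κ.HasLocal n z.1 fun j => Y j z.2}ᶜ ∪
        {z | 0 < κ.precision ρ n z.1 fun j => Y j z.2} := by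
      ext z
      simp [imp_iff_not_or]
    rw [this]
    exact (κ.measurableSet_hasLocal hY n).compl.union
      (measurableSet_lt measurable_const (κ.measurable_precision hY hρ n))
  · filter_upwards [ae_mem_uniformBall (c := c) (R := R)] with y₀ h0
    exact κ.ae_precision_pos hd hR hY hρ hn h0

end MetricKernel

/-! ### Convergence in probability of the mean logarithm to a universal constant. -/

/-- The approximations to the limit of the mean logarithm of the scaled precision. -/
def limitApprox {d : ℕ} (hd : 0 < d) (c : Euc d) {R : ℝ} (hR : 0 < R) (ρ : ℝ) (m : ℕ) (η : ℝ) : ℝ :=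
  -m + (m : ℝ)⁻¹ * ∑ i ∈ Finset.range (2 * m ^ 2), ∫ x, rampExcess ρ (Real.exp (gridPoint m i)) η x
    ∂(limitLaw hd c hR (Real.exp_pos (gridPoint m i)) : Measure (Euc 2))

namespace MetricKernel
variable {d : ℕ} {c : Euc d} {R : ℝ} (κ : MetricKernel c R)
variable {Ω : Type*} [MeasurableSpace Ω] {P : Measure Ω} [IsProbabilityMeasure P]
  {Y : ℕ → Ω → Euc d}

lemma integrable_rampExcess (hR : 0 < R) (hY : IsUniformSample c R P Y) (ρ α η : ℝ) (n : ℕ) (ω : Ω) :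
    Integrable (fun y₀ => rampExcess ρ α η (κ.scaledSums α n y₀ fun j => Y j ω))
      (uniformBall c R) := by
  have := isProbabilityMeasure_uniformBall (c := c) hR
  have h : Measurable fun p : Euc d × Ω =>
      rampExcess ρ α η (κ.scaledSums α n p.1 fun j => Y j p.2) :=
    (rampExcess ρ α η).continuous.measurable.comp (κ.measurable_scaledSums_uncurry hY α n)
  exact Integrable.of_bound (h.comp (measurable_prodMk_right (y := ω))).aestronglyMeasurable
    ‖rampExcess ρ α η‖ (Eventually.of_forall fun y => (rampExcess ρ α η).norm_coe_le_norm _)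

lemma integrable_discretisation (hR : 0 < R) (hY : IsUniformSample c R P Y) (ρ : ℝ) (m : ℕ) (η : ℝ)
    (n : ℕ) (ω : Ω) :
    Integrable (fun y₀ => κ.discretisation ρ m η n y₀ fun j => Y j ω) (uniformBall c R) := by
  have := isProbabilityMeasure_uniformBall (c := c) hR
  exact (integrable_const _).add (Integrable.const_mul (integrable_finsetSum _ fun i _ =>
    κ.integrable_rampExcess hR hY ρ _ η n ω) _)

lemma tendsto_measureReal_integral_discretisation (hd : 0 < d) (hR : 0 < R)
    (hY : IsUniformSample c R P Y) (ρ : ℝ) {m : ℕ} (hm : 0 < m) (η : ℝ) {ε : ℝ} (hε : 0 < ε) :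
    Tendsto (fun n : ℕ => P.real {ω | ε ≤
      |∫ y₀, κ.discretisation ρ m η n y₀ (fun j => Y j ω) ∂uniformBall c R -
        limitApprox hd c hR ρ m η|}) atTop (𝓝 0) := by
  have := isProbabilityMeasure_uniformBall (c := c) hR
  have hm' : (0 : ℝ) < m := by exact_mod_cast hm
  -- The sum has `2 m²` terms and the prefactor `1 / m`, so errors `ε'` add up to `ε`.
  set ε' := ε / (2 * m) with hε'
  have hε'0 : 0 < ε' := by positivity
  set I : ℕ → ℕ → Ω → ℝ := fun i n ω => ∫ y₀, rampExcess ρ (Real.exp (gridPoint m i)) η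
    (κ.scaledSums (Real.exp (gridPoint m i)) n y₀ fun j => Y j ω) ∂uniformBall c R with hI
  set L : ℕ → ℝ := fun i => ∫ x, rampExcess ρ (Real.exp (gridPoint m i)) η x
    ∂(limitLaw hd c hR (Real.exp_pos (gridPoint m i)) : Measure (Euc 2)) with hL
  have hlim : Tendsto (fun n : ℕ => ∑ i ∈ Finset.range (2 * m ^ 2),
      P.real {ω | ε' ≤ |I i n ω - L i|}) atTop (𝓝 0) := by
    have h := tendsto_finsetSum (Finset.range (2 * m ^ 2)) fun i _ =>
      κ.tendsto_measureReal_average hd hR hY (Real.exp_pos (gridPoint m i))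
        (rampExcess ρ (Real.exp (gridPoint m i)) η) hε'0
    simpa using h
  refine squeeze_zero (fun _ => measureReal_nonneg) (fun n => ?_) hlim
  refine le_trans (measureReal_mono ?_ (measure_ne_top _ _)) (measureReal_biUnion_finset_le _ _)
  intro ω hω
  by_contra hcon
  simp only [Set.mem_iUnion, not_exists, Set.mem_ofPred_eq, not_le] at hcon
  refine (not_le.2 ?_) (Set.mem_ofPred_eq ▸ hω)
  have hintegr : ∀ i ∈ Finset.range (2 * m ^ 2), Integrable (fun y₀ =>
      rampExcess ρ (Real.exp (gridPoint m i)) η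
        (κ.scaledSums (Real.exp (gridPoint m i)) n y₀ fun j => Y j ω)) (uniformBall c R) :=
    fun i _ => κ.integrable_rampExcess hR hY ρ _ η n ω
  have e : ∫ y₀, κ.discretisation ρ m η n y₀ (fun j => Y j ω) ∂uniformBall c R =
      -m + (m : ℝ)⁻¹ * ∑ i ∈ Finset.range (2 * m ^ 2), I i n ω := by
    unfold discretisation
    rw [integral_add (integrable_const _) (Integrable.const_mul (integrable_finsetSum _ hintegr) _),
      integral_const_mul, integral_finsetSum _ hintegr]
    simp [hI]
  rw [e, limitApprox, add_sub_add_left_eq_sub, ← mul_sub, ← Finset.sum_sub_distrib, abs_mul,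
    abs_of_pos (inv_pos.2 hm'), inv_mul_lt_iff₀ hm']
  refine lt_of_le_of_lt (Finset.abs_sum_le_sum_abs _ _) ?_
  have hne : (Finset.range (2 * m ^ 2)).Nonempty := Finset.nonempty_range_iff.2 (by positivity)
  refine lt_of_lt_of_le (Finset.sum_lt_sum_of_nonempty hne fun i hi => hcon i hi) ?_
  rw [Finset.sum_const, Finset.card_range, nsmul_eq_mul, hε']
  push_cast
  refine le_of_eq ?_
  field_simp

/-- The event on which the mean logarithm of the scaled precision is close to `a`. -/
def LogMeanNear (ρ : ℝ) (n : ℕ) (y : ℕ → Euc d) (a ε : ℝ) : Prop :=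
  (∀ᵐ y₀ ∂uniformBall c R, 0 < κ.precision ρ n y₀ y) ∧
  Integrable (fun y₀ => Real.log (κ.precision ρ n y₀ y)) (uniformBall c R) ∧
  |∫ y₀, Real.log (κ.precision ρ n y₀ y) ∂uniformBall c R - a| < ε

/-- The mean of the logarithm is compared with the mean of its discretisation through the expected
error, and the latter mean with its limit through concentration. On the event that every base point
has a local sample point, the indicator in `discretisationError` can be dropped. -/
lemma eventually_logMeanNear_limitApprox (hd : 0 < d) (hR : 0 < R) (hY : IsUniformSample c R P Y)
    {ρ : ℝ} (hρ : 1 < ρ) {θ : ℝ} (hθ : 0 < θ) :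
    ∀ᶠ m : ℕ in atTop, ∀ᶠ η in 𝓝[>] (0 : ℝ), ∀ᶠ n : ℕ in atTop,
      P.real {ω | ¬ κ.LogMeanNear ρ n (fun j => Y j ω) (limitApprox hd c hR ρ m η) θ} ≤ θ := by
  have := isProbabilityMeasure_uniformBall (c := c) hR
  filter_upwards [κ.exists_forall_lintegral_discretisationError_le hd hR hY hρ
    (show 0 < θ / 2 * (θ / 3) by positivity), eventually_gt_atTop 0] with m hm hm0
  filter_upwards [hm] with η hη
  have e1 := (κ.tendsto_measureReal_integral_discretisation hd hR hY ρ hm0 η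
    (half_pos hθ)).eventually_le_const (show 0 < θ / 3 by positivity)
  have e2 := (κ.tendsto_measureReal_not_hasLocal hR hY).eventually_le_const
    (show 0 < θ / 3 by positivity)
  have e3 : ∀ᶠ n : ℕ in atTop, ρ < n := tendsto_natCast_atTop_atTop.eventually_gt_atTop ρ
  filter_upwards [hη, e1, e2, e3] with n hn h1 h2 h3
  have hmE := κ.measurable_discretisationError hY hρ m η n
  set D : Ω → ENNReal := fun ω =>
    ∫⁻ y₀, κ.discretisationError ρ m η n y₀ (fun j => Y j ω) ∂uniformBall c R with hD
  have hDm : Measurable D := hmE.lintegral_prod_left'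
  have hDint : ∫⁻ ω, D ω ∂P ≤ ENNReal.ofReal (θ / 2 * (θ / 3)) := by
    rw [hD, lintegral_lintegral_swap (f := fun ω y₀ =>
      κ.discretisationError ρ m η n y₀ fun j => Y j ω)
      (hmE.comp measurable_swap).aemeasurable]
    calc _ ≤ ∫⁻ _, ENNReal.ofReal (θ / 2 * (θ / 3)) ∂uniformBall c R := by
          refine lintegral_mono_ae ?_
          filter_upwards [ae_mem_uniformBall (c := c) (R := R)] with y₀ h0 using hn y₀ h0
      _ = _ := by simp
  -- Markov's inequality at level `θ / 2`; this is why the expected error was asked to be at most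
  -- `(θ / 2) (θ / 3)`.
  have h4 : P.real {ω | ENNReal.ofReal (θ / 2) ≤ D ω} ≤ θ / 3 := by
    have h5 := (mul_meas_ge_le_lintegral hDm (ENNReal.ofReal (θ / 2))).trans hDint
    rw [ENNReal.ofReal_mul (by positivity)] at h5
    have h6 := (ENNReal.mul_le_mul_iff_right (by simpa using half_pos hθ)
      ENNReal.ofReal_ne_top).1 h5
    exact ENNReal.toReal_le_of_le_ofReal (by positivity) h6
  refine (measureReal_le_of_ae (t := _ ∪ (_ ∪ _)) ?_).trans ((measureReal_union_le _ _).trans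
    (add_le_add h4 ((measureReal_union_le _ _).trans (add_le_add h1 h2)))) |>.trans (by linarith)
  filter_upwards [κ.ae_ae_precision_pos hd hR hY hρ h3] with ω hω hbad
  by_contra hcon
  simp only [Set.mem_union, not_or, Set.mem_ofPred_eq, not_not, not_le] at hcon
  obtain ⟨c1, c2, c3⟩ := hcon
  refine hbad ?_
  have hpos : ∀ᵐ y₀ ∂uniformBall c R, 0 < κ.precision ρ n y₀ fun j => Y j ω := by
    filter_upwards [hω, ae_mem_uniformBall (c := c) (R := R)] with y₀ h5 h6 using h5 (c3 y₀ h6)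
  have hDe : D ω = ∫⁻ y₀, ENNReal.ofReal |Real.log (κ.precision ρ n y₀ fun j => Y j ω) -
      κ.discretisation ρ m η n y₀ fun j => Y j ω| ∂uniformBall c R := by
    refine lintegral_congr_ae ?_
    filter_upwards [hpos, ae_mem_uniformBall (c := c) (R := R)] with y₀ h5 h6
    exact Set.indicator_of_mem (by exact ⟨c3 y₀ h6, h5⟩) _
  have hΞ := κ.integrable_discretisation hR hY ρ m η n ω
  have hlm : Measurable fun y₀ => Real.log (κ.precision ρ n y₀ fun j => Y j ω) :=
    ((κ.measurable_precision hY hρ n).comp measurable_prodMk_right).log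
  have hdiff : Integrable (fun y₀ => Real.log (κ.precision ρ n y₀ fun j => Y j ω) -
      κ.discretisation ρ m η n y₀ fun j => Y j ω) (uniformBall c R) := by
    refine ⟨hlm.aestronglyMeasurable.sub hΞ.aestronglyMeasurable, ?_⟩
    rw [hasFiniteIntegral_iff_norm]
    simp only [Real.norm_eq_abs]
    rw [← hDe]
    exact c1.trans ENNReal.ofReal_lt_top
  have hintegr : Integrable (fun y₀ => Real.log (κ.precision ρ n y₀ fun j => Y j ω))
      (uniformBall c R) := by
    refine (hdiff.add hΞ).congr (Eventually.of_forall fun y => ?_)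
    simp
  refine ⟨hpos, hintegr, ?_⟩
  have h7 : |∫ y₀, Real.log (κ.precision ρ n y₀ fun j => Y j ω) ∂uniformBall c R -
      ∫ y₀, κ.discretisation ρ m η n y₀ (fun j => Y j ω) ∂uniformBall c R| < θ / 2 := by
    rw [← integral_sub hintegr hΞ]
    rw [← Real.norm_eq_abs]
    refine lt_of_le_of_lt (norm_integral_le_lintegral_norm _) ?_
    simp only [Real.norm_eq_abs]
    rw [← hDe]
    exact (ENNReal.lt_ofReal_iff_toReal_lt (c1.trans ENNReal.ofReal_lt_top).ne).1 c1
  rw [abs_lt] at h7 c2 ⊢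
  constructor <;> linarith [h7.1, h7.2, c2.1, c2.2]

end MetricKernel

/-- The curried filter encodes the iterated limit in which `η` tends to zero after `m` is fixed;
nontriviality allows an actual pair `(m, η)` to be extracted. -/
lemma curry_neBot {α β : Type*} (f : Filter α) (g : Filter β) [NeBot f] [NeBot g] :
    NeBot (f.curry g) := by
  refine ⟨fun h => ?_⟩
  have h1 : ∀ᶠ _ : α × β in f.curry g, False := by
    rw [h]; exact eventually_bot
  rw [eventually_curry_iff] at h1
  obtain ⟨x, hx⟩ := h1.exists
  exact hx.exists.choose_spec

/-- The universal limit of the mean logarithm of the scaled precision. -/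
lemma exists_tendsto_limitApprox {d : ℕ} (hd : 0 < d) (c : Euc d) {R : ℝ} (hR : 0 < R) {ρ : ℝ}
    (hρ : 1 < ρ) : ∃ a : ℝ, Tendsto (fun p : ℕ × ℝ => limitApprox hd c hR ρ p.1 p.2)
      (atTop.curry (𝓝[>] 0)) (𝓝 a) := by
  have := isProbabilityMeasure_uniformBall (c := c) hR
  obtain ⟨Ω, _, P, Y, hm, hl, hi, _⟩ := exists_iid ℕ (uniformBall c R)
  have hY : IsUniformSample c R P Y := ⟨hm, hi, fun i => (hl i).map_eq⟩
  have hne := curry_neBot (atTop : Filter ℕ) (𝓝[>] (0 : ℝ))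
  refine CompleteSpace.complete (Metric.cauchy_iff.2 ⟨inferInstance, fun ε hε => ?_⟩)
  -- Two good parameter pairs fail together with probability at most `1 / 2`, so some sample has its
  -- mean logarithm within `ε / 2` of both approximations. Hence the approximations are Cauchy.
  have hθ : 0 < min (ε / 2) (1 / 4) := by positivity
  have h1 := (euclideanKernel c R).eventually_logMeanNear_limitApprox hd hR hY hρ hθ
  rw [← eventually_curry_iff (p := fun p : ℕ × ℝ => ∀ᶠ n : ℕ in atTop, P.real {ω | ¬
    (euclideanKernel c R).LogMeanNear ρ n (fun j => Y j ω) (limitApprox hd c hR ρ p.1 p.2)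
      (min (ε / 2) (1 / 4))} ≤ min (ε / 2) (1 / 4))] at h1
  refine ⟨_, image_mem_map h1, ?_⟩
  rintro _ ⟨p, hp, rfl⟩ _ ⟨p', hp', rfl⟩
  obtain ⟨n, hn, hn'⟩ := (hp.and hp').exists
  have h2 : P.real ({ω | ¬ (euclideanKernel c R).LogMeanNear ρ n (fun j => Y j ω)
      (limitApprox hd c hR ρ p.1 p.2) (min (ε / 2) (1 / 4))} ∪
      {ω | ¬ (euclideanKernel c R).LogMeanNear ρ n (fun j => Y j ω)
      (limitApprox hd c hR ρ p'.1 p'.2) (min (ε / 2) (1 / 4))}) < 1 := by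
    refine lt_of_le_of_lt ((measureReal_union_le _ _).trans (add_le_add hn hn')) ?_
    have := min_le_right (ε / 2) (1 / 4 : ℝ)
    linarith
  obtain ⟨ω, hω⟩ : ∃ ω, ω ∉ ({ω | ¬ (euclideanKernel c R).LogMeanNear ρ n (fun j => Y j ω)
      (limitApprox hd c hR ρ p.1 p.2) (min (ε / 2) (1 / 4))} ∪
      {ω | ¬ (euclideanKernel c R).LogMeanNear ρ n (fun j => Y j ω)
      (limitApprox hd c hR ρ p'.1 p'.2) (min (ε / 2) (1 / 4))}) := by
    by_contra! hall
    rw [Set.eq_univ_of_forall hall] at h2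
    simp at h2
  simp only [Set.mem_union, not_or, Set.mem_ofPred_eq, not_not] at hω
  obtain ⟨⟨-, -, ha⟩, ⟨-, -, hb⟩⟩ := hω
  rw [Real.dist_eq]
  have := min_le_left (ε / 2) (1 / 4 : ℝ)
  rw [abs_lt] at ha hb ⊢
  constructor <;> linarith [ha.1, ha.2, hb.1, hb.2]

/-- The limit of the mean logarithm of the scaled precision. -/
def logPrecisionLimit {d : ℕ} (hd : 0 < d) (c : Euc d) {R : ℝ} (hR : 0 < R) {ρ : ℝ}
    (hρ : 1 < ρ) : ℝ := (exists_tendsto_limitApprox hd c hR hρ).choose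

/-- The constant was constructed with the Euclidean kernel, but the approximations to it involve
only the limit law, which is common to all kernels on the ball. -/
lemma MetricKernel.eventually_logMeanNear {d : ℕ} {c : Euc d} {R : ℝ} (κ : MetricKernel c R)
    {Ω : Type*} [MeasurableSpace Ω] {P : Measure Ω} [IsProbabilityMeasure P] {Y : ℕ → Ω → Euc d}
    (hd : 0 < d) (hR : 0 < R) (hY : IsUniformSample c R P Y) {ρ : ℝ} (hρ : 1 < ρ) {θ : ℝ}
    (hθ : 0 < θ) : ∀ᶠ n : ℕ in atTop,
      P.real {ω | ¬ κ.LogMeanNear ρ n (fun j => Y j ω) (logPrecisionLimit hd c hR hρ) θ} ≤ θ := by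
  have hne := curry_neBot (atTop : Filter ℕ) (𝓝[>] (0 : ℝ))
  have h1 := κ.eventually_logMeanNear_limitApprox hd hR hY hρ (half_pos hθ)
  rw [← eventually_curry_iff (p := fun p : ℕ × ℝ => ∀ᶠ n : ℕ in atTop, P.real {ω | ¬
    κ.LogMeanNear ρ n (fun j => Y j ω) (limitApprox hd c hR ρ p.1 p.2) (θ / 2)} ≤ θ / 2)] at h1
  have h2 := (exists_tendsto_limitApprox hd c hR hρ).choose_spec.eventually
    (Metric.ball_mem_nhds _ (half_pos hθ))
  obtain ⟨p, hp1, hp2⟩ := (h1.and h2).exists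
  filter_upwards [hp1] with n hn
  refine (measureReal_mono ?_).trans (hn.trans (by linarith))
  intro ω hω hgood
  refine hω ?_
  refine ⟨hgood.1, hgood.2.1, ?_⟩
  have h3 := hgood.2.2
  have h4 : |limitApprox hd c hR ρ p.1 p.2 - logPrecisionLimit hd c hR hρ| < θ / 2 := hp2
  rw [abs_lt] at h3 h4 ⊢
  constructor <;> linarith [h3.1, h3.2, h4.1, h4.2]

end NeighbourEmbedding
end

noncomputable section
namespace NeighbourEmbedding
open MeasureTheory ProbabilityTheory Matrix Filter Topology Metric

/-! ### The cost of stochastic neighbour embedding -/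

lemma abs_log_sub_log_le {a b m : ℝ} (hm : 0 < m) (ha : m ≤ a) (hb : m ≤ b) :
    |Real.log a - Real.log b| ≤ |a - b| / m := by
  have key : ∀ a b : ℝ, m ≤ a → m ≤ b → Real.log a - Real.log b ≤ |a - b| / m := by
    intro a b ha hb
    have ha0 := hm.trans_le ha
    have hb0 := hm.trans_le hb
    rw [← Real.log_div ha0.ne' hb0.ne']
    calc _ ≤ a / b - 1 := Real.log_le_sub_one_of_pos (by positivity)
      _ = (a - b) / b := by field_simp
      _ ≤ |a - b| / b := div_le_div_of_nonneg_right (le_abs_self _) hb0.le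
      _ ≤ _ := div_le_div_of_nonneg_left (abs_nonneg _) hm hb
  rw [abs_le]
  have h1 := key a b ha hb
  have h2 := key b a hb ha
  rw [abs_sub_comm] at h2
  constructor <;> linarith

lemma abs_exp_neg_sub_exp_neg_le {a b : ℝ} (ha : 0 ≤ a) (hb : 0 ≤ b) :
    |Real.exp (-a) - Real.exp (-b)| ≤ |a - b| := by
  have key : ∀ a b : ℝ, 0 ≤ a → 0 ≤ b → Real.exp (-a) - Real.exp (-b) ≤ |a - b| := by
    intro a b ha hb
    have h1 := Real.add_one_le_exp (-(b - a))
    have h2 : Real.exp (-b) = Real.exp (-a) * Real.exp (-(b - a)) := by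
      rw [← Real.exp_add]; congr 1; ring
    have h3 : Real.exp (-a) ≤ 1 := by rw [Real.exp_le_one_iff]; linarith
    have h4 := Real.exp_pos (-a)
    rw [h2]
    have h5 : Real.exp (-a) - Real.exp (-a) * Real.exp (-(b - a)) ≤ Real.exp (-a) * (b - a) := by
      nlinarith
    refine h5.trans ?_
    calc _ ≤ Real.exp (-a) * |b - a| := mul_le_mul_of_nonneg_left (le_abs_self _) h4.le
      _ ≤ 1 * |b - a| := mul_le_mul_of_nonneg_right h3 (abs_nonneg _)
      _ = _ := by rw [one_mul, abs_sub_comm]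
  rw [abs_le]
  have h1 := key a b ha hb
  have h2 := key b a hb ha
  rw [abs_sub_comm] at h2
  constructor <;> linarith

lemma norm_sub_le_of_mem_closedBall {d : ℕ} {c : Euc d} {R : ℝ} {x y : Euc d}
    (hx : x ∈ closedBall c R) (hy : y ∈ closedBall c R) : ‖x - y‖ ≤ 2 * R := by
  rw [← dist_eq_norm]
  have := dist_triangle_right x y c
  have := mem_closedBall.1 hx
  have := mem_closedBall.1 hy
  linarith

lemma similarity_eq {d : ℕ} (y₀ y : Euc d) : similarity y₀ y = Real.exp (-(‖y - y₀‖ ^ 2 / 2)) := by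
  unfold similarity
  congr 1
  ring

lemma similarity_pos {d : ℕ} (y₀ y : Euc d) : 0 < similarity y₀ y := Real.exp_pos _

lemma similarity_le_one {d : ℕ} (y₀ y : Euc d) : similarity y₀ y ≤ 1 := by
  rw [similarity_eq, Real.exp_le_one_iff, neg_nonpos]
  positivity

lemma continuous_similarity {d : ℕ} :
    Continuous fun p : Euc d × Euc d => similarity p.1 p.2 := by
  unfold similarity
  fun_prop

lemma measurable_similarity {d : ℕ} (y₀ : Euc d) : Measurable (similarity y₀) := by
  unfold similarity
  fun_prop

lemma le_similarity {d : ℕ} {c : Euc d} {R : ℝ} {y₀ y : Euc d}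
    (h0 : y₀ ∈ closedBall c R) (hy : y ∈ closedBall c R) :
    Real.exp (-(2 * R ^ 2)) ≤ similarity y₀ y := by
  rw [similarity_eq, Real.exp_le_exp, neg_le_neg_iff]
  have := pow_le_pow_left₀ (norm_nonneg _) (norm_sub_le_of_mem_closedBall hy h0) 2
  nlinarith

lemma abs_similarity_sub_le {d : ℕ} {c : Euc d} {R : ℝ} {x y z : Euc d}
    (hx : x ∈ closedBall c R) (hy : y ∈ closedBall c R) (hz : z ∈ closedBall c R) :
    |similarity x z - similarity y z| ≤ 2 * R * dist x y := by
  rw [similarity_eq, similarity_eq]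
  refine (abs_exp_neg_sub_exp_neg_le (by positivity) (by positivity)).trans ?_
  have h1 : ‖z - x‖ ^ 2 / 2 - ‖z - y‖ ^ 2 / 2 =
      (‖z - x‖ - ‖z - y‖) * ((‖z - x‖ + ‖z - y‖) / 2) := by ring
  have h2 : |‖z - x‖ - ‖z - y‖| ≤ dist x y := by
    refine (abs_norm_sub_norm_le _ _).trans (le_of_eq ?_)
    rw [sub_sub_sub_cancel_left, dist_comm, dist_eq_norm]
  have h3 := norm_sub_le_of_mem_closedBall hz hx
  have h4 := norm_sub_le_of_mem_closedBall hz hy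
  rw [h1, abs_mul, abs_of_nonneg (by positivity : 0 ≤ (‖z - x‖ + ‖z - y‖) / 2)]
  calc _ ≤ dist x y * (2 * R) := mul_le_mul h2 (by linarith) (by positivity) dist_nonneg
    _ = _ := by ring

/-- The mean similarity to a point of the ball. -/
def meanSimilarity {d : ℕ} (c : Euc d) (R : ℝ) (y₀ : Euc d) : ℝ :=
  ∫ y, similarity y₀ y ∂uniformBall c R

section
variable {d : ℕ} {c : Euc d} {R : ℝ}

lemma integrable_similarity (hR : 0 < R) (y₀ : Euc d) :
    Integrable (similarity y₀) (uniformBall c R) := by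
  have := isProbabilityMeasure_uniformBall (c := c) hR
  refine Integrable.of_bound (measurable_similarity y₀).aestronglyMeasurable 1
    (Eventually.of_forall fun y => ?_)
  rw [Real.norm_of_nonneg (similarity_pos _ _).le]
  exact similarity_le_one _ _

lemma le_meanSimilarity (hR : 0 < R) {y₀ : Euc d} (h0 : y₀ ∈ closedBall c R) :
    Real.exp (-(2 * R ^ 2)) ≤ meanSimilarity c R y₀ := by
  have := isProbabilityMeasure_uniformBall (c := c) hR
  have h := integral_mono_ae (integrable_const (Real.exp (-(2 * R ^ 2))))
    (integrable_similarity hR y₀) (μ := uniformBall c R) (by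
      filter_upwards [ae_mem_uniformBall (c := c) (R := R)] with y hy using le_similarity h0 hy)
  simpa [meanSimilarity] using h

lemma meanSimilarity_le_one (hR : 0 < R) (y₀ : Euc d) : meanSimilarity c R y₀ ≤ 1 := by
  have := isProbabilityMeasure_uniformBall (c := c) hR
  have h := integral_mono (integrable_similarity hR y₀) (integrable_const (1 : ℝ))
    (μ := uniformBall c R) (fun y => similarity_le_one y₀ y)
  simpa [meanSimilarity] using h

lemma measurable_meanSimilarity (hR : 0 < R) : Measurable (meanSimilarity c R) := by
  have := isProbabilityMeasure_uniformBall (c := c) hR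
  exact (StronglyMeasurable.integral_prod_right
    (continuous_similarity (d := d)).stronglyMeasurable).measurable

lemma abs_log_meanSimilarity_le (hR : 0 < R) {y₀ : Euc d} (h0 : y₀ ∈ closedBall c R) :
    |Real.log (meanSimilarity c R y₀)| ≤ 2 * R ^ 2 := by
  have h1 := le_meanSimilarity hR h0
  have h2 := meanSimilarity_le_one (c := c) hR y₀
  have h3 := (Real.exp_pos (-(2 * R ^ 2))).trans_le h1
  rw [abs_le]
  refine ⟨(Real.le_log_iff_exp_le h3).2 h1, (Real.log_nonpos h3.le h2).trans (by positivity)⟩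

lemma abs_meanSimilarity_sub_le (hR : 0 < R) {x y : Euc d} (hx : x ∈ closedBall c R)
    (hy : y ∈ closedBall c R) :
    |meanSimilarity c R x - meanSimilarity c R y| ≤ 2 * R * dist x y := by
  have := isProbabilityMeasure_uniformBall (c := c) hR
  unfold meanSimilarity
  rw [← integral_sub (integrable_similarity hR x) (integrable_similarity hR y),
    ← Real.norm_eq_abs]
  refine (norm_integral_le_of_norm_le_const (C := 2 * R * dist x y) ?_).trans (by simp)
  filter_upwards [ae_mem_uniformBall (c := c) (R := R)] with z hz
  exact abs_similarity_sub_le hx hy hz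

variable {Ω : Type*} [MeasurableSpace Ω] {P : Measure Ω} [IsProbabilityMeasure P]
  {Y : ℕ → Ω → Euc d}

/-- A uniform law of large numbers for the similarities. -/
lemma IsUniformSample.tendsto_measureReal_similarity (hY : IsUniformSample c R P Y) (hR : 0 < R)
    {ε : ℝ} (hε : 0 < ε) :
    Tendsto (fun n : ℕ => P.real {ω | ¬ ∀ y ∈ closedBall c R,
      |(∑ j ∈ Finset.range n, similarity y (Y j ω)) / n - meanSimilarity c R y| < ε})
      atTop (𝓝 0) := by
  -- On the ball the similarity has Lipschitz constant `2 R` in the base point, so moving to a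
  -- centre of the cover costs at most `ε / 4` in the empirical mean and `ε / 4` in the mean.
  have hr0 : 0 < ε / (8 * R) := by positivity
  obtain ⟨t, htK, htf, htc⟩ := (isCompact_closedBall c R).finite_cover_balls hr0
  have hlim : Tendsto (fun n : ℕ => ∑ x ∈ htf.toFinset, P.real {ω | ε / 4 ≤
      |(∑ j ∈ Finset.range n, similarity x (Y j ω)) / n -
      ∫ y, similarity x y ∂uniformBall c R|}) atTop (𝓝 0) := by
    have h := tendsto_finsetSum htf.toFinset fun x _ => hY.tendsto_measureReal_average hR
      (g := similarity x) (measurable_similarity x) (C := 1) (fun y _ => by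
        rw [abs_of_pos (similarity_pos _ _)]
        exact similarity_le_one _ _) (ε := ε / 4) (by positivity)
    simpa using h
  refine squeeze_zero' (Eventually.of_forall fun _ => measureReal_nonneg) ?_ hlim
  filter_upwards [eventually_gt_atTop 0] with n hn
  have hn' : (0 : ℝ) < n := by exact_mod_cast hn
  refine le_trans (measureReal_le_of_ae ?_) (measureReal_biUnion_finset_le _ _)
  filter_upwards [hY.ae_mem] with ω hωm hω
  by_contra hcon
  refine hω fun y hy => ?_
  simp only [Set.mem_iUnion, not_exists] at hcon
  obtain ⟨x, hx, hyx⟩ := Set.mem_iUnion₂.1 (htc hy)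
  have h1 := hcon x (htf.mem_toFinset.2 hx)
  simp only [Set.mem_ofPred_eq, not_le] at h1
  have hd : 2 * R * dist y x ≤ ε / 4 := by
    have := mem_ball.1 hyx
    calc _ ≤ 2 * R * (ε / (8 * R)) := by gcongr
      _ = _ := by field_simp; norm_num
  have h2 := (abs_meanSimilarity_sub_le hR hy (htK hx)).trans hd
  have h3 : |(∑ j ∈ Finset.range n, similarity y (Y j ω)) / n -
      (∑ j ∈ Finset.range n, similarity x (Y j ω)) / n| ≤ ε / 4 := by
    rw [← sub_div, ← Finset.sum_sub_distrib, abs_div, abs_of_pos hn', div_le_iff₀ hn']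
    refine (Finset.abs_sum_le_sum_abs _ _).trans ?_
    refine (Finset.sum_le_sum fun j _ =>
      (abs_similarity_sub_le hy (htK hx) (hωm j)).trans hd).trans ?_
    rw [Finset.sum_const, Finset.card_range, nsmul_eq_mul, mul_comm]
  have h1' : |(∑ j ∈ Finset.range n, similarity x (Y j ω)) / n - meanSimilarity c R x| < ε / 4 := h1
  rw [abs_lt] at h1' ⊢
  rw [abs_le] at h2 h3
  constructor <;> linarith [h1'.1, h1'.2, h2.1, h2.2, h3.1, h3.2]

end

/-- The divergence is cross-entropy minus entropy; the normaliser of `w` separates because the Gibbs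
weights sum to one. -/
lemma simplexKL_normalize_exp {ι : Type*} {N : Finset ι} (hN : N.Nonempty) (e w : ι → ℝ)
    (hw : ∀ j, 0 < w j) (lam : ℝ) :
    simplexKL N (normalize N fun j => Real.exp (-(lam * e j))) (normalize N w) =
      -gibbsEntropy N e lam +
        ∑ j ∈ N, normalize N (fun j => Real.exp (-(lam * e j))) j * -Real.log (w j) +
        Real.log (∑ j ∈ N, w j) := by
  have hW := partitionSum_pos hN e lam
  have hZ : 0 < ∑ j ∈ N, w j := Finset.sum_pos (fun j _ => hw j) hN
  have hp : ∀ j, normalize N (fun j => Real.exp (-(lam * e j))) j =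
      Real.exp (-(lam * e j)) / partitionSum N e lam := fun j => rfl
  have hsum : ∑ j ∈ N, Real.exp (-(lam * e j)) / partitionSum N e lam = 1 := by
    rw [← Finset.sum_div]
    exact div_self hW.ne'
  unfold simplexKL
  have h1 : ∀ j ∈ N, normalize N (fun j => Real.exp (-(lam * e j))) j *
      Real.log (normalize N (fun j => Real.exp (-(lam * e j))) j / normalize N w j) =
      -(lam * (e j * Real.exp (-(lam * e j))) / partitionSum N e lam) +
      normalize N (fun j => Real.exp (-(lam * e j))) j * -Real.log (w j) +
      Real.exp (-(lam * e j)) / partitionSum N e lam *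
        (Real.log (∑ j ∈ N, w j) - Real.log (partitionSum N e lam)) := by
    intro j _
    have hnw : normalize N w j = w j / ∑ j ∈ N, w j := rfl
    rw [hp, hnw, Real.log_div (by positivity) (div_pos (hw j) hZ).ne',
      Real.log_div (by positivity) hW.ne', Real.log_div (hw j).ne' hZ.ne', Real.log_exp]
    ring
  rw [Finset.sum_congr rfl h1, Finset.sum_add_distrib, Finset.sum_add_distrib, ← Finset.sum_mul,
    hsum, Finset.sum_neg_distrib, ← Finset.sum_div, ← Finset.mul_sum]
  unfold gibbsEntropy energySum
  ring

namespace MetricKernel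
variable {d : ℕ} {c : Euc d} {R : ℝ} (κ : MetricKernel c R)

/-- At high precision the input similarities concentrate near the reference point. -/
lemma sum_normalize_mul_sq_le {ι : Type*} {N : Finset ι} {y : ι → Euc d} {y₀ : Euc d}
    (h0 : y₀ ∈ closedBall c R) (hy : ∀ j ∈ N, y j ∈ closedBall c R) {lam δ ε m : ℝ}
    (hlam : 0 ≤ lam) (hε : 0 ≤ ε) (hm : 0 < m)
    (hδ : κ.hi * δ ^ 2 ≤ κ.lo * ε ^ 2 / 2)
    (hcard : m ≤ ((N.filter fun j => dist (y j) y₀ ≤ δ).card : ℝ)) :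
    ∑ j ∈ N, normalize N (fun j => Real.exp (-(lam * κ.toFun y₀ (y j)))) j *
      (‖y j - y₀‖ ^ 2 / 2) ≤
      ε ^ 2 / 2 + 2 * R ^ 2 * (N.card / m) * Real.exp (-(lam * (κ.lo * ε ^ 2 / 2))) := by
  have hlo := κ.lo_pos
  have hhi := κ.hi_pos
  set W := ∑ j ∈ N, Real.exp (-(lam * κ.toFun y₀ (y j))) with hW
  -- Points within `δ` have energy at most `lo ε² / 2`, while points beyond `ε` have energy at least
  -- `lo ε²`. The gap `lo ε² / 2` makes the mass of the distant points exponentially small in `lam`.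
  have hWm : m * Real.exp (-(lam * (κ.lo * ε ^ 2 / 2))) ≤ W := by
    calc _ ≤ ((N.filter fun j => dist (y j) y₀ ≤ δ).card : ℝ) *
          Real.exp (-(lam * (κ.lo * ε ^ 2 / 2))) :=
          mul_le_mul_of_nonneg_right hcard (Real.exp_pos _).le
      _ = ∑ j ∈ N.filter fun j => dist (y j) y₀ ≤ δ, Real.exp (-(lam * (κ.lo * ε ^ 2 / 2))) := by
          rw [Finset.sum_const, nsmul_eq_mul]
      _ ≤ ∑ j ∈ N.filter fun j => dist (y j) y₀ ≤ δ, Real.exp (-(lam * κ.toFun y₀ (y j))) := by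
          refine Finset.sum_le_sum fun j hj => Real.exp_le_exp.2 (neg_le_neg ?_)
          rw [Finset.mem_filter, dist_eq_norm] at hj
          refine mul_le_mul_of_nonneg_left ?_ hlam
          refine (κ.upper y₀ h0 _ (hy j hj.1)).trans (le_trans ?_ hδ)
          gcongr
          exact hj.2
      _ ≤ W := Finset.sum_le_sum_of_subset_of_nonneg (Finset.filter_subset _ _)
          fun _ _ _ => (Real.exp_pos _).le
  have hW0 : 0 < W := lt_of_lt_of_le (by positivity) hWm
  have hpt : ∀ j ∈ N, normalize N (fun j => Real.exp (-(lam * κ.toFun y₀ (y j)))) j *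
      (‖y j - y₀‖ ^ 2 / 2) ≤ Real.exp (-(lam * κ.toFun y₀ (y j))) / W * (ε ^ 2 / 2) +
      2 * R ^ 2 * (Real.exp (-(lam * (κ.lo * ε ^ 2))) / W) := by
    intro j hj
    have hpj : normalize N (fun j => Real.exp (-(lam * κ.toFun y₀ (y j)))) j =
      Real.exp (-(lam * κ.toFun y₀ (y j))) / W := rfl
    rw [hpj]
    have hR2 : 0 ≤ 2 * R ^ 2 := by positivity
    rcases le_or_gt ‖y j - y₀‖ ε with h | h
    · have h1 : ‖y j - y₀‖ ^ 2 / 2 ≤ ε ^ 2 / 2 := by gcongr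
      have h2 := mul_le_mul_of_nonneg_left h1
        (show 0 ≤ Real.exp (-(lam * κ.toFun y₀ (y j))) / W by positivity)
      have : 0 ≤ 2 * R ^ 2 * (Real.exp (-(lam * (κ.lo * ε ^ 2))) / W) := by positivity
      linarith
    · have h1 : Real.exp (-(lam * κ.toFun y₀ (y j))) ≤ Real.exp (-(lam * (κ.lo * ε ^ 2))) := by
        refine Real.exp_le_exp.2 (neg_le_neg (mul_le_mul_of_nonneg_left ?_ hlam))
        refine le_trans ?_ (κ.lower y₀ h0 _ (hy j hj))
        gcongr
      have h2 : ‖y j - y₀‖ ^ 2 / 2 ≤ 2 * R ^ 2 := by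
        have := pow_le_pow_left₀ (norm_nonneg _) (norm_sub_le_of_mem_closedBall (hy j hj) h0) 2
        nlinarith
      have h3 : Real.exp (-(lam * κ.toFun y₀ (y j))) / W * (‖y j - y₀‖ ^ 2 / 2) ≤
          Real.exp (-(lam * (κ.lo * ε ^ 2))) / W * (2 * R ^ 2) :=
        mul_le_mul (div_le_div_of_nonneg_right h1 hW0.le) h2 (by positivity) (by positivity)
      have : 0 ≤ Real.exp (-(lam * κ.toFun y₀ (y j))) / W * (ε ^ 2 / 2) := by positivity
      linarith
  refine (Finset.sum_le_sum hpt).trans ?_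
  rw [Finset.sum_add_distrib, ← Finset.sum_mul, ← Finset.sum_div, ← hW, div_self hW0.ne', one_mul,
    Finset.sum_const, nsmul_eq_mul]
  refine add_le_add le_rfl ?_
  have h4 : Real.exp (-(lam * (κ.lo * ε ^ 2))) / W ≤
      Real.exp (-(lam * (κ.lo * ε ^ 2 / 2))) / m := by
    rw [div_le_div_iff₀ hW0 hm]
    have e : Real.exp (-(lam * (κ.lo * ε ^ 2))) = Real.exp (-(lam * (κ.lo * ε ^ 2 / 2))) *
        Real.exp (-(lam * (κ.lo * ε ^ 2 / 2))) := by
      rw [← Real.exp_add]; congr 1; ring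
    rw [e]
    calc _ = Real.exp (-(lam * (κ.lo * ε ^ 2 / 2))) *
          (m * Real.exp (-(lam * (κ.lo * ε ^ 2 / 2)))) := by ring
      _ ≤ _ := mul_le_mul_of_nonneg_left hWm (Real.exp_pos _).le
  calc (N.card : ℝ) * (2 * R ^ 2 * (Real.exp (-(lam * (κ.lo * ε ^ 2))) / W)) ≤
        N.card * (2 * R ^ 2 * (Real.exp (-(lam * (κ.lo * ε ^ 2 / 2))) / m)) := by gcongr
    _ = _ := by ring

variable {Ω : Type*} [MeasurableSpace Ω] {P : Measure Ω} [IsProbabilityMeasure P]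
  {Y : ℕ → Ω → Euc d}

/-- Seen from a point of the sample, two other points have the same energy only far away. -/
lemma ae_forall_local_energy_ne (hd : 0 < d) (hR : 0 < R) (hY : IsUniformSample c R P Y) :
    ∀ᵐ ω ∂P, ∀ i j k : ℕ, i ≠ j → i ≠ k → j ≠ k →
      κ.toFun (Y i ω) (Y j ω) = κ.toFun (Y i ω) (Y k ω) →
      κ.localLevel < κ.toFun (Y i ω) (Y j ω) := by
  have := isProbabilityMeasure_uniformBall (c := c) hR
  simp only [ae_all_iff]
  intro i j k hij hik hjk
  have h1 := (hY.indep.indepFun_prodMk hY.measurable j k i hij.symm hik.symm).symm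
  rw [indepFun_iff_map_prod_eq_prod_map_map (hY.measurable i).aemeasurable
    ((hY.measurable j).prodMk (hY.measurable k)).aemeasurable, hY.law, hY.map_prod hjk] at h1
  have hm1 : Measurable fun q : Euc d × (Euc d × Euc d) => κ.toFun q.1 q.2.1 :=
    κ.measurable.comp (measurable_fst.prodMk (measurable_fst.comp measurable_snd))
  have hm2 : Measurable fun q : Euc d × (Euc d × Euc d) => κ.toFun q.1 q.2.2 :=
    κ.measurable.comp (measurable_fst.prodMk (measurable_snd.comp measurable_snd))
  have hms : MeasurableSet {q : Euc d × (Euc d × Euc d) |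
      κ.toFun q.1 q.2.1 = κ.toFun q.1 q.2.2 → κ.localLevel < κ.toFun q.1 q.2.1} := by
    have : {q : Euc d × (Euc d × Euc d) |
      κ.toFun q.1 q.2.1 = κ.toFun q.1 q.2.2 → κ.localLevel < κ.toFun q.1 q.2.1} =
      {q | κ.toFun q.1 q.2.1 = κ.toFun q.1 q.2.2}ᶜ ∪ {q | κ.localLevel < κ.toFun q.1 q.2.1} := by
      ext z
      simp [imp_iff_not_or]
    rw [this]
    exact (measurableSet_eq_fun hm1 hm2).compl.union (measurableSet_lt measurable_const hm1)
  have h2 : ∀ᵐ q ∂(uniformBall c R).prod ((uniformBall c R).prod (uniformBall c R)),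
      κ.toFun q.1 q.2.1 = κ.toFun q.1 q.2.2 → κ.localLevel < κ.toFun q.1 q.2.1 := by
    refine (Measure.ae_prod_iff_ae_ae hms).2 ?_
    filter_upwards [ae_mem_uniformBall (c := c) (R := R)] with y hy
    exact κ.ae_local_energy_ne hd hR hy
  rw [← h1] at h2
  exact ae_of_ae_map ((hY.measurable i).prodMk
    ((hY.measurable j).prodMk (hY.measurable k))).aemeasurable h2

end MetricKernel
end NeighbourEmbedding
end

/-! ### The individual terms of the cost and their average. -/

noncomputable section
namespace NeighbourEmbedding
open MeasureTheory ProbabilityTheory Matrix Filter Topology Metric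

namespace MetricKernel
variable {d D : ℕ} {c : Euc d} {R : ℝ} (κ : MetricKernel c R)

lemma calibratedPrecision_eq_mul {ι : Type*} {f : Euc d → Euc D} {τ : Euc d → ℝ}
    (hτ : ∀ y ∈ closedBall c R, 0 < τ y)
    (hκ : ∀ y₀ ∈ closedBall c R, ∀ y ∈ closedBall c R,
      κ.toFun y₀ y = τ y₀ * (‖f y₀ - f y‖ ^ 2 / 2)) {ρ : ℝ} (hρ : 1 < ρ) {N : Finset ι}
    {y : ι → Euc d} {y₀ : Euc d} (h0 : y₀ ∈ closedBall c R)
    (hy : ∀ j ∈ N, y j ∈ closedBall c R) :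
    calibratedPrecision ρ N (fun j => f (y j)) (f y₀) =
      τ y₀ * gibbsPrecision ρ N fun j => κ.toFun y₀ (y j) := by
  rw [calibratedPrecision_eq hρ, ← gibbsPrecision_const_mul ρ N _ (hτ y₀ h0)]
  congr 1
  exact gibbsPrecision_congr ρ fun j hj => (hκ y₀ h0 _ (hy j hj)).symm

/-- At the calibrated precision the entropy is exactly `log ρ`; the factor `τ y₀` cancels between
precision and energy, so the weights are Gibbs weights of the kernel. -/
lemma simplexKL_eq {ι : Type*} {f : Euc d → Euc D} {τ : Euc d → ℝ}
    (hτ : ∀ y ∈ closedBall c R, 0 < τ y)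
    (hκ : ∀ y₀ ∈ closedBall c R, ∀ y ∈ closedBall c R,
      κ.toFun y₀ y = τ y₀ * (‖f y₀ - f y‖ ^ 2 / 2)) {ρ : ℝ} (hρ : 1 < ρ) {N : Finset ι}
    {y : ι → Euc d} {y₀ : Euc d} (h0 : y₀ ∈ closedBall c R)
    (hy : ∀ j ∈ N, y j ∈ closedBall c R)
    (hpos : 0 < gibbsPrecision ρ N fun j => κ.toFun y₀ (y j)) :
    simplexKL N (inputProb N (fun j => f (y j)) (f y₀)
        (calibratedPrecision ρ N (fun j => f (y j)) (f y₀))) (outputProb N y y₀) =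
      -Real.log ρ + ∑ j ∈ N, normalize N (fun j => Real.exp
        (-((gibbsPrecision ρ N fun j => κ.toFun y₀ (y j)) * κ.toFun y₀ (y j)))) j *
          (‖y j - y₀‖ ^ 2 / 2) + Real.log (∑ j ∈ N, similarity y₀ (y j)) := by
  have hN := nonempty_of_gibbsPrecision_pos hρ hpos
  have hH := (exists_ne_of_gibbsPrecision_pos hρ hpos).2
  set lam := gibbsPrecision ρ N fun j => κ.toFun y₀ (y j) with hlam
  have hw : ∀ j ∈ N, Real.exp (-(calibratedPrecision ρ N (fun j => f (y j)) (f y₀) / 2) *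
      ‖f y₀ - f (y j)‖ ^ 2) = Real.exp (-(lam * κ.toFun y₀ (y j))) := by
    intro j hj
    rw [κ.calibratedPrecision_eq_mul hτ hκ hρ h0 hy, hκ y₀ h0 _ (hy j hj)]
    congr 1
    ring
  have hin : ∀ j ∈ N, inputProb N (fun j => f (y j)) (f y₀)
      (calibratedPrecision ρ N (fun j => f (y j)) (f y₀)) j =
      normalize N (fun j => Real.exp (-(lam * κ.toFun y₀ (y j)))) j := by
    intro j hj
    exact congrArg₂ (· / ·) (hw j hj) (Finset.sum_congr rfl hw)
  have h1 := simplexKL_normalize_exp hN (fun j => κ.toFun y₀ (y j)) (fun j => similarity y₀ (y j))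
    (fun j => similarity_pos _ _) lam
  rw [hH] at h1
  have h2 : simplexKL N (inputProb N (fun j => f (y j)) (f y₀)
      (calibratedPrecision ρ N (fun j => f (y j)) (f y₀))) (outputProb N y y₀) =
      simplexKL N (normalize N fun j => Real.exp (-(lam * κ.toFun y₀ (y j))))
        (normalize N fun j => similarity y₀ (y j)) := by
    refine Finset.sum_congr rfl fun j hj => ?_
    rw [hin j hj]
    rfl
  rw [h2, h1]
  congr 2
  refine Finset.sum_congr rfl fun j _ => ?_
  rw [similarity_eq, Real.log_exp, neg_neg]

/-- A deterministic lower bound growing like `log n`. It makes both the cross term of the cost and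
the trace term of the discrepancy vanish in the limit. -/
lemma log_card_div_le_gibbsPrecision {ι : Type*} (hR : 0 < R) {ρ : ℝ} (hρ : 1 < ρ) {N : Finset ι}
    {y : ι → Euc d} {y₀ : Euc d} (h0 : y₀ ∈ closedBall c R)
    (hy : ∀ j ∈ N, y j ∈ closedBall c R)
    (hpos : 0 < gibbsPrecision ρ N fun j => κ.toFun y₀ (y j)) :
    Real.log (N.card / ρ) / (κ.hi * (2 * R) ^ 2) ≤ gibbsPrecision ρ N fun j => κ.toFun y₀ (y j) := by
  have hhi := κ.hi_pos
  rw [div_le_iff₀ (by positivity)]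
  refine log_card_div_le_gibbsPrecision_mul hρ (fun j hj => κ.nonneg h0 (hy j hj))
    (fun j hj => (κ.upper _ h0 _ (hy j hj)).trans ?_) hpos
  exact mul_le_mul_of_nonneg_left (pow_le_pow_left₀ (norm_nonneg _)
    (norm_sub_le_of_mem_closedBall (hy j hj) h0) 2) hhi.le

lemma card_filter_erase_ge {n : ℕ} (i : Fin n) (p : ℕ → Prop) [DecidablePred p] :
    (((Finset.range n).filter p).card : ℝ) - 1 ≤
      (((Finset.univ : Finset (Fin n)).erase i).filter fun j : Fin n => p j).card := by
  have h1 : ((Finset.range n).filter p).card =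
      ((Finset.univ : Finset (Fin n)).filter fun j : Fin n => p j).card := by
    rw [Finset.card_filter, Finset.card_filter,
      Fin.sum_univ_eq_sum_range (fun j => if p j then 1 else 0) n]
  rw [Finset.filter_erase, h1]
  have h2 := Finset.pred_card_le_card_erase (s := (Finset.univ : Finset (Fin n)).filter
    fun j : Fin n => p j) (a := i)
  have h3 : ((Finset.univ : Finset (Fin n)).filter fun j : Fin n => p j).card ≤
      (((Finset.univ : Finset (Fin n)).filter fun j : Fin n => p j).erase i).card + 1 := by omega
  have h4 : (((Finset.univ : Finset (Fin n)).filter fun j : Fin n => p j).card : ℝ) ≤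
      (((Finset.univ : Finset (Fin n)).filter fun j : Fin n => p j).erase i).card + 1 := by exact_mod_cast h3
  linarith

lemma sum_similarity_erase {n : ℕ} (i : Fin n) (y : ℕ → Euc d) :
    ∑ j ∈ (Finset.univ : Finset (Fin n)).erase i, similarity (y i) (y j) =
      ∑ j ∈ Finset.range n, similarity (y i) (y j) - 1 := by
  have h := Finset.sum_erase_add Finset.univ (fun j : Fin n => similarity (y i) (y j))
    (Finset.mem_univ i)
  rw [Fin.sum_univ_eq_sum_range (fun j => similarity (y i) (y j)) n] at h
  have h1 : similarity (y i) (y i) = 1 := by simp [similarity]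
  linarith

/-- The terms of the cost of a sufficiently dense and generic sample. -/
lemma abs_simplexKL_sub_le {f : Euc d → Euc D} {τ : Euc d → ℝ} (hR : 0 < R)
    (hτ : ∀ y ∈ closedBall c R, 0 < τ y)
    (hκ : ∀ y₀ ∈ closedBall c R, ∀ y ∈ closedBall c R,
      κ.toFun y₀ y = τ y₀ * (‖f y₀ - f y‖ ^ 2 / 2)) {ρ : ℝ} (hρ : 1 < ρ) {n : ℕ}
    {y : ℕ → Euc d} (hy : ∀ j, y j ∈ closedBall c R) {q δ ε ε' : ℝ} (hε : 0 ≤ ε)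
    (hδloc : δ ≤ κ.localRadius) (hδ : κ.hi * δ ^ 2 ≤ κ.lo * ε ^ 2 / 2)
    (htie : ∀ i j k : ℕ, i ≠ j → i ≠ k → j ≠ k → κ.toFun (y i) (y j) = κ.toFun (y i) (y k) →
      κ.localLevel < κ.toFun (y i) (y j))
    (hcount : ∀ x ∈ closedBall c R,
      q * n ≤ (((Finset.range n).filter fun j => dist (y j) x ≤ δ).card : ℝ))
    (hsim : ∀ x ∈ closedBall c R,
      |(∑ j ∈ Finset.range n, similarity x (y j)) / n - meanSimilarity c R x| < ε')
    (hnρ : ρ < (n : ℝ) - 1) (hq : 0 < q) (hnq : 2 ≤ q * n) (i : Fin n) :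
    |simplexKL (Finset.univ.erase i) (inputProb (Finset.univ.erase i) (fun j : Fin n => f (y j))
        (f (y i)) (calibratedPrecision ρ (Finset.univ.erase i) (fun j : Fin n => f (y j)) (f (y i))))
        (outputProb (Finset.univ.erase i) (fun j : Fin n => y j) (y i)) -
      (-Real.log ρ + Real.log n + Real.log (meanSimilarity c R (y i)))| ≤
      ε ^ 2 / 2 + 4 * R ^ 2 / q * Real.exp (-(Real.log ((n - 1) / ρ) / (κ.hi * (2 * R) ^ 2) *
        (κ.lo * ε ^ 2 / 2))) + (ε' + 1 / n) * (2 / Real.exp (-(2 * R ^ 2))) := by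
  classical
  have hlo := κ.lo_pos
  have hhi := κ.hi_pos
  have hn2 : (2 : ℝ) < n := by linarith
  have hn0 : (0 : ℝ) < n := by linarith
  set N : Finset (Fin n) := Finset.univ.erase i with hN
  have hNcard : (N.card : ℝ) = n - 1 := by
    rw [hN, Finset.card_erase_of_mem (Finset.mem_univ i), Finset.card_univ, Fintype.card_fin,
      Nat.cast_sub (by have := i.2; omega)]
    simp
  -- The count of nearby points may include `i` itself; removing it costs at most half, since `q n ≥
  -- 2`.
  have hcardN : q * n / 2 ≤ ((N.filter fun j : Fin n => dist (y j) (y i) ≤ δ).card : ℝ) := by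
    have h1 := card_filter_erase_ge i fun j => dist (y j) (y i) ≤ δ
    have h2 := hcount (y i) (hy i)
    linarith
  obtain ⟨l, hl⟩ : (N.filter fun j : Fin n => dist (y j) (y i) ≤ δ).Nonempty := by
    rw [← Finset.card_pos]
    have : (0 : ℝ) < ((N.filter fun j : Fin n => dist (y j) (y i) ≤ δ).card : ℝ) := by linarith
    exact_mod_cast this
  rw [Finset.mem_filter] at hl
  obtain ⟨m, hm, hmin⟩ := Finset.exists_min_image N (fun j => κ.toFun (y i) (y j)) ⟨l, hl.1⟩
  -- The nearby neighbour `l` has energy at most `localLevel`, so the minimum is local and a tie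
  -- with it would contradict `htie`.
  have hpos : 0 < gibbsPrecision ρ N fun j => κ.toFun (y i) (y j) := by
    refine gibbsPrecision_pos hρ hm (fun j hj hjm => lt_of_le_of_ne (hmin j hj) fun heq => ?_)
      (by rw [hNcard]; exact hnρ)
    have hne : ∀ j ∈ N, (i : ℕ) ≠ j := fun j hj h =>
      (Finset.ne_of_mem_erase hj) (Fin.ext h).symm
    have h1 := htie i m j (hne m hm) (hne j hj) (fun h => hjm (Fin.ext h).symm) heq
    have h2 := hmin l hl.1
    have h3 := κ.toFun_le_localLevel (hy i) (hy l) (hl.2.trans hδloc)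
    linarith
  have hkl := κ.simplexKL_eq hτ hκ hρ (hy i) (fun (j : Fin n) (_ : j ∈ N) => hy j) hpos
  rw [hkl]
  set lam := gibbsPrecision ρ N fun j => κ.toFun (y i) (y j) with hlam
  have hA := κ.sum_normalize_mul_sq_le (N := N) (y := fun j : Fin n => y j) (hy i)
    (fun j _ => hy j) hpos.le hε (show 0 < q * n / 2 by positivity) hδ hcardN
  set A := ∑ j ∈ N, normalize N (fun j => Real.exp (-(lam * κ.toFun (y i) (y j)))) j *
    (‖y j - y i‖ ^ 2 / 2) with hAdef
  have hA0 : 0 ≤ A := by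
    refine Finset.sum_nonneg fun j _ => mul_nonneg ?_ (by positivity)
    exact div_nonneg (Real.exp_pos _).le (Finset.sum_nonneg fun _ _ => (Real.exp_pos _).le)
  have hlamlow : Real.log ((n - 1) / ρ) / (κ.hi * (2 * R) ^ 2) ≤ lam := by
    have h1 := κ.log_card_div_le_gibbsPrecision hR hρ (hy i) (fun (j : Fin n) (_ : j ∈ N) => hy j)
      hpos
    rwa [hNcard] at h1
  have hA' : A ≤ ε ^ 2 / 2 + 4 * R ^ 2 / q * Real.exp (-(Real.log ((n - 1) / ρ) /
      (κ.hi * (2 * R) ^ 2) * (κ.lo * ε ^ 2 / 2))) := by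
    refine hA.trans (add_le_add le_rfl ?_)
    refine mul_le_mul ?_ (Real.exp_le_exp.2 (neg_le_neg
      (mul_le_mul_of_nonneg_right hlamlow (by positivity)))) (Real.exp_pos _).le (by positivity)
    rw [hNcard, mul_div_assoc', div_le_div_iff₀ (by positivity) hq]
    nlinarith [mul_pos (sq_pos_of_pos hR) hq]
  set z₀ := Real.exp (-(2 * R ^ 2)) with hz₀
  have hz₀0 : 0 < z₀ := Real.exp_pos _
  set Z := ∑ j ∈ N, similarity (y i) (y j) with hZ
  -- Only `n - 1` neighbours contribute, and `n - 1 ≥ n / 2`; the lower bound keeps the logarithm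
  -- Lipschitz.
  have hZlow : z₀ / 2 ≤ Z / n := by
    rw [le_div_iff₀ hn0]
    have h1 : N.card • z₀ ≤ Z := Finset.card_nsmul_le_sum N _ _ fun j _ =>
      le_similarity (hy i) (hy j)
    rw [nsmul_eq_mul, hNcard] at h1
    nlinarith
  have hZ0 : 0 < Z := by
    have : 0 < Z / n := lt_of_lt_of_le (by positivity) hZlow
    exact (div_pos_iff_of_pos_right hn0).1 this
  have hlogdiff : |Real.log (Z / n) - Real.log (meanSimilarity c R (y i))| ≤
      (ε' + 1 / n) * (2 / z₀) := by
    refine (abs_log_sub_log_le (m := z₀ / 2) (by positivity) hZlow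
      (le_trans (by linarith) (le_meanSimilarity hR (hy i)))).trans ?_
    rw [div_eq_mul_inv _ (z₀ / 2), inv_div]
    refine mul_le_mul_of_nonneg_right ?_ (by positivity)
    rw [hZ, hN, sum_similarity_erase i y, sub_div]
    have h1 := hsim (y i) (hy i)
    rw [abs_lt] at h1
    have h2 : 0 < 1 / (n : ℝ) := by positivity
    rw [abs_le]
    constructor <;> linarith [h1.1, h1.2]
  rw [Real.log_div hZ0.ne' hn0.ne', abs_le] at hlogdiff
  rw [abs_le]
  have h3 : 0 ≤ ε ^ 2 / 2 + 4 * R ^ 2 / q * Real.exp (-(Real.log ((n - 1) / ρ) /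
      (κ.hi * (2 * R) ^ 2) * (κ.lo * ε ^ 2 / 2))) := hA0.trans hA'
  constructor <;> linarith [hlogdiff.1, hlogdiff.2]

variable {Ω : Type*} [MeasurableSpace Ω] {P : Measure Ω} [IsProbabilityMeasure P]
  {Y : ℕ → Ω → Euc d}

/-- The asymptotics of the cost of stochastic neighbour embedding. -/
lemma eventually_sneCost_near (hd : 0 < d) (hR : 0 < R) (hY : IsUniformSample c R P Y)
    {f : Euc d → Euc D} {τ : Euc d → ℝ} (hτ : ∀ y ∈ closedBall c R, 0 < τ y)
    (hκ : ∀ y₀ ∈ closedBall c R, ∀ y ∈ closedBall c R,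
      κ.toFun y₀ y = τ y₀ * (‖f y₀ - f y‖ ^ 2 / 2)) {ρ : ℝ} (hρ : 1 < ρ) {θ : ℝ} (hθ : 0 < θ) :
    ∀ᶠ n : ℕ in atTop, P.real {ω | ¬ |1 / (n : ℝ) *
      sneCost ρ (fun j : Fin n => f (Y j ω)) (fun j : Fin n => Y j ω) - Real.log n -
        (-Real.log ρ + ∫ y, Real.log (meanSimilarity c R y) ∂uniformBall c R)| < θ} ≤ θ := by
  have hlo := κ.lo_pos
  have hhi := κ.hi_pos
  set z₀ := Real.exp (-(2 * R ^ 2)) with hz₀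
  have hz₀0 : 0 < z₀ := Real.exp_pos _
  -- The error budget for each term is four parts of `θ / 8`: `ε² / 2`, the exponential remainder,
  -- the fluctuation of the mean similarity, and the missing self-similarity `1 / n`. The law of
  -- large numbers for `log (meanSimilarity)` uses a further `θ / 4`.
  set ε := √(θ / 4) with hε
  have hε0 : 0 < ε := Real.sqrt_pos.2 (by positivity)
  have hε2 : ε ^ 2 = θ / 4 := Real.sq_sqrt (by positivity)
  set δ := min κ.localRadius √(κ.lo * ε ^ 2 / 2 / κ.hi) with hδ
  have hδ0 : 0 < δ := lt_min κ.localRadius_pos (Real.sqrt_pos.2 (by positivity))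
  have hδ2 : κ.hi * δ ^ 2 ≤ κ.lo * ε ^ 2 / 2 := by
    have h1 := pow_le_pow_left₀ hδ0.le (min_le_right κ.localRadius √(κ.lo * ε ^ 2 / 2 / κ.hi)) 2
    rw [Real.sq_sqrt (by positivity), le_div_iff₀ hhi] at h1
    linarith
  obtain ⟨q, hq, hfrac⟩ := hY.exists_fraction hR hδ0
  have e1 := hfrac.eventually_le_const (show 0 < θ / 3 by positivity)
  have e2 := (hY.tendsto_measureReal_similarity hR
    (show 0 < θ * z₀ / 16 by positivity)).eventually_le_const (show 0 < θ / 3 by positivity)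
  have e3 := (hY.tendsto_measureReal_average hR (measurable_meanSimilarity (c := c) hR).log
    (fun y hy => abs_log_meanSimilarity_le hR hy)
    (show 0 < θ / 4 by positivity)).eventually_le_const (show 0 < θ / 3 by positivity)
  have hnat : Tendsto (fun n : ℕ => (n : ℝ)) atTop atTop := tendsto_natCast_atTop_atTop
  have e4 : ∀ᶠ n : ℕ in atTop, ρ < (n : ℝ) - 1 :=
    (tendsto_atTop_add_const_right _ (-1) hnat).eventually_gt_atTop ρ
  have e5 : ∀ᶠ n : ℕ in atTop, 2 ≤ q * n := (hnat.const_mul_atTop hq).eventually_ge_atTop 2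
  have e6 : ∀ᶠ n : ℕ in atTop, 1 / (n : ℝ) * (2 / z₀) ≤ θ / 8 := by
    have h : Tendsto (fun n : ℕ => 1 / (n : ℝ) * (2 / z₀)) atTop (𝓝 (0 * (2 / z₀))) :=
      tendsto_one_div_atTop_nhds_zero_nat.mul_const _
    rw [zero_mul] at h
    exact h.eventually_le_const (by positivity)
  have e7 : ∀ᶠ n : ℕ in atTop, 4 * R ^ 2 / q * Real.exp (-(Real.log ((n - 1) / ρ) /
      (κ.hi * (2 * R) ^ 2) * (κ.lo * ε ^ 2 / 2))) ≤ θ / 8 := by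
    have h1 : Tendsto (fun n : ℕ => ((n : ℝ) - 1) / ρ) atTop atTop :=
      (tendsto_atTop_add_const_right _ (-1) hnat).atTop_div_const (by linarith)
    have h2 : Tendsto (fun n : ℕ => Real.log (((n : ℝ) - 1) / ρ) / (κ.hi * (2 * R) ^ 2) *
        (κ.lo * ε ^ 2 / 2)) atTop atTop :=
      ((Real.tendsto_log_atTop.comp h1).atTop_div_const (by positivity)).atTop_mul_const
        (by positivity)
    have h3 := (Real.tendsto_exp_neg_atTop_nhds_zero.comp h2).const_mul (4 * R ^ 2 / q)
    rw [mul_zero] at h3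
    exact h3.eventually_le_const (by positivity)
  filter_upwards [e1, e2, e3, e4, e5, e6, e7, eventually_gt_atTop 0]
    with n h1 h2 h3 h4 h5 h6 h7 hn
  have hn0 : (0 : ℝ) < n := by exact_mod_cast hn
  refine (measureReal_le_of_ae (t := _ ∪ (_ ∪ _)) ?_).trans ((measureReal_union_le _ _).trans
    (add_le_add h1 ((measureReal_union_le _ _).trans (add_le_add h2 h3)))) |>.trans (by linarith)
  filter_upwards [hY.ae_mem, κ.ae_forall_local_energy_ne hd hR hY] with ω hω htie hbad
  by_contra hcon
  simp only [Set.mem_union, not_or, Set.mem_ofPred_eq, not_not, not_le] at hcon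
  obtain ⟨c1, c2, c3⟩ := hcon
  refine hbad ?_
  have hterm := κ.abs_simplexKL_sub_le hR hτ hκ hρ hω hε0.le (min_le_left _ _) hδ2 htie c1 c2 h4
    hq h5
  set T : Fin n → ℝ := fun i => simplexKL (Finset.univ.erase i) (inputProb (Finset.univ.erase i)
    (fun j : Fin n => f (Y j ω)) (f (Y i ω)) (calibratedPrecision ρ (Finset.univ.erase i)
      (fun j : Fin n => f (Y j ω)) (f (Y i ω))))
    (outputProb (Finset.univ.erase i) (fun j : Fin n => Y j ω) (Y i ω)) with hT
  have hcost : sneCost ρ (fun j : Fin n => f (Y j ω)) (fun j : Fin n => Y j ω) = ∑ i, T i := rfl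
  have hsumc : ∑ i : Fin n, (-Real.log ρ + Real.log n + Real.log (meanSimilarity c R (Y i ω))) =
      n * (-Real.log ρ + Real.log n) +
        ∑ j ∈ Finset.range n, Real.log (meanSimilarity c R (Y j ω)) := by
    rw [Finset.sum_add_distrib, Finset.sum_const, Finset.card_univ, Fintype.card_fin, nsmul_eq_mul,
      Fin.sum_univ_eq_sum_range (fun j => Real.log (meanSimilarity c R (Y j ω))) n]
  have hdiff : |∑ i, T i - ∑ i : Fin n, (-Real.log ρ + Real.log n +
      Real.log (meanSimilarity c R (Y i ω)))| ≤ n * (θ / 2) := by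
    rw [← Finset.sum_sub_distrib]
    refine (Finset.abs_sum_le_sum_abs _ _).trans ?_
    refine (Finset.sum_le_sum fun i _ => (hterm i).trans (?_ : _ ≤ θ / 2)).trans ?_
    · rw [← hz₀, add_mul, hε2]
      rw [hε2] at h7
      have h8 : θ * z₀ / 16 * (2 / z₀) = θ / 8 := by field_simp; norm_num
      linarith
    · rw [Finset.sum_const, Finset.card_univ, Fintype.card_fin, nsmul_eq_mul]
  rw [hsumc] at hdiff
  rw [hcost]
  have hscale : |1 / (n : ℝ) * ∑ i, T i - (-Real.log ρ + Real.log n) -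
      (∑ j ∈ Finset.range n, Real.log (meanSimilarity c R (Y j ω))) / n| ≤ θ / 2 := by
    have e : 1 / (n : ℝ) * ∑ i, T i - (-Real.log ρ + Real.log n) -
      (∑ j ∈ Finset.range n, Real.log (meanSimilarity c R (Y j ω))) / n =
      (∑ i, T i - (n * (-Real.log ρ + Real.log n) +
        ∑ j ∈ Finset.range n, Real.log (meanSimilarity c R (Y j ω)))) / n := by
      field_simp
      ring
    rw [e, abs_div, abs_of_pos hn0, div_le_iff₀ hn0]
    linarith
  rw [abs_le] at hscale
  rw [abs_lt] at c3 ⊢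
  constructor <;> linarith [hscale.1, hscale.2, c3.1, c3.2]

end MetricKernel
end NeighbourEmbedding
end

/-! ### The discrepancy with respect to the calibrated metric. -/

noncomputable section
namespace NeighbourEmbedding
open MeasureTheory ProbabilityTheory Matrix Filter Topology Metric

section
variable {d D : ℕ} {f : Euc d → Euc D} {V : Set (Euc d)} {c : Euc d} {R : ℝ}

/-- The trace of the inverse of the metric induced by `f`. -/
def gramInvTrace (f : Euc d → Euc D) (y : Euc d) : ℝ :=
  (((jacobian f y)ᵀ * jacobian f y)⁻¹).trace

lemma gramInvTrace_nonneg {y : Euc d} (himm : Function.Injective (fderiv ℝ f y)) :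
    0 ≤ gramInvTrace f y := (gram_posDef himm).inv.posSemidef.trace_nonneg

lemma continuousOn_gramInvTrace (hV : IsOpen V) (hK : closedBall c R ⊆ V)
    (hf : ContDiffOn ℝ (⊤ : ℕ∞) f V)
    (himm : ∀ y ∈ closedBall c R, Function.Injective (fderiv ℝ f y)) :
    ContinuousOn (gramInvTrace f) (closedBall c R) := by
  have h : ∀ y ∈ closedBall c R, gramInvTrace f y =
      (gramDet f y)⁻¹ * (((jacobian f y)ᵀ * jacobian f y).adjugate).trace := by
    intro y hy
    rw [gramInvTrace, Matrix.inv_def, Ring.inverse_eq_inv', Matrix.trace_smul, smul_eq_mul, gramDet]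
  refine ContinuousOn.congr ?_ h
  refine ((continuousOn_gramDet hV hK hf).inv₀ fun y hy =>
    (gram_posDef (himm y hy)).det_pos.ne').mul ?_
  exact (continuous_id.matrix_adjugate.matrix_trace).comp_continuousOn (continuousOn_gram hV hK hf)

lemma pointDiscrepancy_one_of_smul_one {y : Euc d} (himm : Function.Injective (fderiv ℝ f y))
    {lam : ℝ} (hlam : 0 < lam) {M : Euc D → Matrix (Fin D) (Fin D) ℝ} (hM : M (f y) = lam • 1) :
    pointDiscrepancy 1 M f y = (d : ℝ) / 2 * Real.log lam + 1 / 2 * Real.log (gramDet f y) +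
      1 / 2 * (lam⁻¹ * gramInvTrace f y) - (d : ℝ) / 2 := by
  have hpos : (M (f y)).PosDef := by rw [hM]; exact PosDef.one.smul hlam
  have hpull : pullback M f y = lam • ((jacobian f y)ᵀ * jacobian f y) := by
    rw [pullback, hM, Matrix.mul_smul, Matrix.mul_one, Matrix.smul_mul]
  have hdet : (gramDet f y) ≠ 0 := (gram_posDef himm).det_pos.ne'
  have hinv : (lam • ((jacobian f y)ᵀ * jacobian f y))⁻¹ =
      lam⁻¹ • ((jacobian f y)ᵀ * jacobian f y)⁻¹ := by
    refine Matrix.inv_eq_right_inv ?_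
    rw [Matrix.smul_mul, Matrix.mul_smul, smul_smul, mul_inv_cancel₀ hlam.ne', one_smul,
      Matrix.mul_nonsing_inv _ (isUnit_iff_ne_zero.2 hdet)]
  rw [pointDiscrepancy_one_eq himm hpos, hpull, hinv, Matrix.trace_smul, Matrix.det_smul,
    Fintype.card_fin, ← gramDet, ← gramInvTrace, Real.log_mul (by positivity) hdet, Real.log_pow,
    smul_eq_mul]
  ring

end

namespace MetricKernel
variable {d D : ℕ} {c : Euc d} {R : ℝ} (κ : MetricKernel c R) {f : Euc d → Euc D}

lemma gibbsPrecision_univ_eq {ρ : ℝ} {n : ℕ} (hn : 0 < n) (y₀ : Euc d) (y : ℕ → Euc d) :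
    gibbsPrecision ρ (Finset.univ : Finset (Fin n)) (fun j => κ.toFun y₀ (y j)) =
      precScale d n * κ.precision ρ n y₀ y := by
  rw [gibbsPrecision_univ_eq_range ρ n fun j => κ.toFun y₀ (y j),
    ← gibbsPrecision_const_mul ρ _ _ (precScale_pos d hn)]
  rfl

/-- The conformal factor raised to `d / 2` is the inverse square root of the Gram determinant, and
`n^(2/d)` raised to `d / 2` is `n`. So `f` survives only in the scaled precision and in a trace term
divided by the unscaled precision. -/
lemma pointDiscrepancy_calibratedMetric
    (hκ : ∀ y₀ ∈ closedBall c R, ∀ y ∈ closedBall c R,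
      κ.toFun y₀ y = conformalFactor f y₀ * (‖f y₀ - f y‖ ^ 2 / 2))
    (hinj : Set.InjOn f (closedBall c R))
    (himm : ∀ y ∈ closedBall c R, Function.Injective (fderiv ℝ f y)) (hd : 0 < d) {ρ : ℝ}
    (hρ : 1 < ρ) {n : ℕ} (hn : 0 < n) {y : ℕ → Euc d} (hy : ∀ j, y j ∈ closedBall c R) {y₀ : Euc d}
    (h0 : y₀ ∈ closedBall c R) (hne : ∀ j, y₀ ≠ y j) (hpos : 0 < κ.precision ρ n y₀ y) :
    pointDiscrepancy 1 (calibratedMetric ρ fun j : Fin n => f (y j)) f y₀ =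
      Real.log n + (d : ℝ) / 2 * Real.log (κ.precision ρ n y₀ y) - (d : ℝ) / 2 +
        1 / 2 * (gramInvTrace f y₀ / conformalFactor f y₀ *
          (precScale d n * κ.precision ρ n y₀ y)⁻¹) := by
  have hτ := conformalFactor_pos (himm y₀ h0)
  have hs := precScale_pos d hn
  have hn0 : (0 : ℝ) < n := by exact_mod_cast hn
  have hd0 : (0 : ℝ) < d := by exact_mod_cast hd
  have hM : calibratedMetric ρ (fun j : Fin n => f (y j)) (f y₀) =
      (conformalFactor f y₀ * (precScale d n * κ.precision ρ n y₀ y)) •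
        (1 : Matrix (Fin D) (Fin D) ℝ) := by
    -- A base point outside the sample has all `n` points as neighbours, which matches the index set
    -- `range n` in `precision`; sample points form a null set of base points.
    have hfilter : ∀ j ∈ (Finset.univ : Finset (Fin n)), f (y j) ≠ f y₀ := fun j _ h =>
      hne j (hinj h0 (hy j) h.symm)
    rw [calibratedMetric, Finset.filter_true_of_mem hfilter,
      κ.calibratedPrecision_eq_mul (y := fun j : Fin n => y j)
        (fun z hz => conformalFactor_pos (himm z hz)) hκ hρ h0 (fun j _ => hy j),
      κ.gibbsPrecision_univ_eq hn]
  rw [pointDiscrepancy_one_of_smul_one (himm y₀ h0) (by positivity) hM,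
    Real.log_mul hτ.ne' (by positivity), Real.log_mul hs.ne' hpos.ne']
  have h1 : Real.log (conformalFactor f y₀) = -(1 / (d : ℝ)) * Real.log (gramDet f y₀) :=
    Real.log_rpow (gram_posDef (himm y₀ h0)).det_pos _
  have h2 : Real.log (precScale d n) = 2 / (d : ℝ) * Real.log n := Real.log_rpow hn0 _
  rw [h1, h2]
  field_simp
  ring

/-- The discrepancy with respect to the calibrated metric is determined by the mean of the
logarithm of the rescaled precision. -/
lemma abs_alphaDiscrepancy_sub_le
    (hκ : ∀ y₀ ∈ closedBall c R, ∀ y ∈ closedBall c R,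
      κ.toFun y₀ y = conformalFactor f y₀ * (‖f y₀ - f y‖ ^ 2 / 2))
    (hinj : Set.InjOn f (closedBall c R))
    (himm : ∀ y ∈ closedBall c R, Function.Injective (fderiv ℝ f y)) (hd : 0 < d) (hR : 0 < R)
    {ρ : ℝ} (hρ : 1 < ρ)
    (hcont : ContinuousOn (fun y => gramInvTrace f y / conformalFactor f y) (closedBall c R))
    {K : ℝ} (hK : ∀ y ∈ closedBall c R, gramInvTrace f y / conformalFactor f y ≤ K) {n : ℕ}
    (hn : ρ < n) {y : ℕ → Euc d} (hy : ∀ j, y j ∈ closedBall c R) {a ε : ℝ}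
    (hnear : κ.LogMeanNear ρ n y a ε) :
    |alphaDiscrepancy 1 (uniformBall c R) (calibratedMetric ρ fun j : Fin n => f (y j)) f -
      (Real.log n + (d : ℝ) / 2 * a - (d : ℝ) / 2)| ≤
      (d : ℝ) / 2 * ε + 1 / 2 * (K * (Real.log (n / ρ) / (κ.hi * (2 * R) ^ 2))⁻¹) := by
  have := isProbabilityMeasure_uniformBall (c := c) hR
  have hhi := κ.hi_pos
  obtain ⟨hpos, hintegr, hmean⟩ := hnear
  have hn0 : (0 : ℝ) < n := by linarith
  have hn' : 0 < n := by exact_mod_cast hn0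
  have hs := precScale_pos d hn'
  -- The precision is at least `lb`, of order `log n`, so the trace term `T` is bounded by a
  -- multiple of `1 / log n`.
  set lb := Real.log (n / ρ) / (κ.hi * (2 * R) ^ 2) with hlb
  have hlb0 : 0 < lb :=
    div_pos (Real.log_pos ((one_lt_div (by linarith)).2 hn)) (by positivity)
  set T : Euc d → ℝ := fun y₀ => 1 / 2 * ((closedBall c R).indicator
    (fun y => gramInvTrace f y / conformalFactor f y) y₀ *
      (precScale d n * κ.precision ρ n y₀ y)⁻¹) with hT
  have hTm : Measurable T := by
    have h1 : Measurable fun y₀ => κ.precision ρ n y₀ y :=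
      measurable_gibbsPrecision hρ _ fun j =>
        (κ.measurable.comp (measurable_id.prodMk measurable_const)).const_mul _
    exact ((measurable_indicator_of_continuousOn hcont measurableSet_closedBall).mul
      (h1.const_mul _).inv).const_mul _
  have hTb : ∀ᵐ y₀ ∂uniformBall c R, 0 ≤ T y₀ ∧ T y₀ ≤ 1 / 2 * (K * lb⁻¹) := by
    filter_upwards [hpos, ae_mem_uniformBall (c := c) (R := R)] with y₀ hp h0
    have hr : 0 ≤ gramInvTrace f y₀ / conformalFactor f y₀ :=
      div_nonneg (gramInvTrace_nonneg (himm y₀ h0)) (conformalFactor_pos (himm y₀ h0)).le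
    have hlow : lb ≤ precScale d n * κ.precision ρ n y₀ y := by
      have h1 := κ.log_card_div_le_gibbsPrecision (N := (Finset.univ : Finset (Fin n)))
        (y := fun j : Fin n => y j) hR hρ h0 (fun j _ => hy j)
        (by rw [κ.gibbsPrecision_univ_eq hn']; positivity)
      rwa [κ.gibbsPrecision_univ_eq hn', Finset.card_univ, Fintype.card_fin] at h1
    simp only [hT, Set.indicator_of_mem h0]
    refine ⟨by positivity, mul_le_mul_of_nonneg_left ?_ (by norm_num)⟩
    exact mul_le_mul (hK y₀ h0) (inv_anti₀ hlb0 hlow) (by positivity) (hr.trans (hK y₀ h0))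
  have hTi : Integrable T (uniformBall c R) := by
    refine Integrable.of_bound hTm.aestronglyMeasurable (1 / 2 * (K * lb⁻¹)) ?_
    filter_upwards [hTb] with y₀ h
    rw [Real.norm_eq_abs, abs_of_nonneg h.1]
    exact h.2
  have hae : ∀ᵐ y₀ ∂uniformBall c R,
      pointDiscrepancy 1 (calibratedMetric ρ fun j : Fin n => f (y j)) f y₀ =
        ((d : ℝ) / 2 * Real.log (κ.precision ρ n y₀ y) + (Real.log n - (d : ℝ) / 2)) + T y₀ := by
    have hne : ∀ᵐ y₀ ∂uniformBall c R, ∀ j, y₀ ≠ y j := by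
      rw [ae_all_iff]
      exact fun j => compl_mem_ae_iff.2 (uniformBall_singleton hd (y j))
    filter_upwards [hpos, ae_mem_uniformBall (c := c) (R := R), hne] with y₀ hp h0 hne
    rw [κ.pointDiscrepancy_calibratedMetric hκ hinj himm hd hρ hn' hy h0 hne hp]
    simp only [hT, Set.indicator_of_mem h0]
    ring
  have hval : alphaDiscrepancy 1 (uniformBall c R) (calibratedMetric ρ fun j : Fin n => f (y j)) f =
      (d : ℝ) / 2 * ∫ y₀, Real.log (κ.precision ρ n y₀ y) ∂uniformBall c R +
        (Real.log n - (d : ℝ) / 2) + ∫ y₀, T y₀ ∂uniformBall c R := by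
    have hintegr' : Integrable (fun y₀ => (d : ℝ) / 2 * Real.log (κ.precision ρ n y₀ y) +
        (Real.log n - (d : ℝ) / 2)) (uniformBall c R) :=
      (hintegr.const_mul _).add (integrable_const _)
    rw [alphaDiscrepancy, integral_congr_ae hae, integral_add hintegr' hTi,
      integral_add (hintegr.const_mul _) (integrable_const _), integral_const_mul, integral_const]
    simp
  have hT0 : 0 ≤ ∫ y₀, T y₀ ∂uniformBall c R :=
    integral_nonneg_of_ae (hTb.mono fun _ h => h.1)
  have hT1 : ∫ y₀, T y₀ ∂uniformBall c R ≤ 1 / 2 * (K * lb⁻¹) := by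
    have h1 := integral_mono_ae hTi (integrable_const (1 / 2 * (K * lb⁻¹)))
      (hTb.mono fun _ h => h.2)
    simpa using h1
  rw [abs_lt] at hmean
  have hd2 : (0 : ℝ) ≤ (d : ℝ) / 2 := by positivity
  have m1 := mul_le_mul_of_nonneg_left hmean.1.le hd2
  have m2 := mul_le_mul_of_nonneg_left hmean.2.le hd2
  rw [hval, abs_le]
  constructor <;> nlinarith

variable {Ω : Type*} [MeasurableSpace Ω] {P : Measure Ω} [IsProbabilityMeasure P]
  {Y : ℕ → Ω → Euc d}

/-- The asymptotics of the discrepancy with respect to the calibrated metric. -/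
lemma eventually_alphaDiscrepancy_near (hd : 0 < d) (hR : 0 < R) (hY : IsUniformSample c R P Y)
    {V : Set (Euc d)} (hV : IsOpen V) (hKV : closedBall c R ⊆ V)
    (hf : ContDiffOn ℝ (⊤ : ℕ∞) f V) (hinj : Set.InjOn f (closedBall c R))
    (himm : ∀ y ∈ closedBall c R, Function.Injective (fderiv ℝ f y))
    (hκ : ∀ y₀ ∈ closedBall c R, ∀ y ∈ closedBall c R,
      κ.toFun y₀ y = conformalFactor f y₀ * (‖f y₀ - f y‖ ^ 2 / 2))
    {ρ : ℝ} (hρ : 1 < ρ) {θ : ℝ} (hθ : 0 < θ) :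
    ∀ᶠ n : ℕ in atTop, P.real {ω | ¬ |alphaDiscrepancy 1 (uniformBall c R)
      (calibratedMetric ρ fun j : Fin n => f (Y j ω)) f - Real.log n -
        ((d : ℝ) / 2 * logPrecisionLimit hd c hR hρ - (d : ℝ) / 2)| < θ} ≤ θ := by
  have hhi := κ.hi_pos
  have hd0 : (0 : ℝ) < d := by exact_mod_cast hd
  have hd1 : (1 : ℝ) ≤ d := by exact_mod_cast hd
  have hcont : ContinuousOn (fun y => gramInvTrace f y / conformalFactor f y) (closedBall c R) :=
    (continuousOn_gramInvTrace hV hKV hf himm).div (continuousOn_conformalFactor hV hKV hf himm)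
      fun y hy => (conformalFactor_pos (himm y hy)).ne'
  obtain ⟨K, hK⟩ := (isCompact_closedBall c R).bddAbove_image hcont
  have hK' : ∀ y ∈ closedBall c R, gramInvTrace f y / conformalFactor f y ≤ K :=
    fun y hy => hK (Set.mem_image_of_mem _ hy)
  have hnat : Tendsto (fun n : ℕ => (n : ℝ)) atTop atTop := tendsto_natCast_atTop_atTop
  have hlog : Tendsto (fun n : ℕ => Real.log ((n : ℝ) / ρ) / (κ.hi * (2 * R) ^ 2)) atTop atTop :=
    (Real.tendsto_log_atTop.comp (hnat.atTop_div_const (by linarith))).atTop_div_const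
      (by positivity)
  have hz := ((tendsto_inv_atTop_zero.comp hlog).const_mul K).const_mul (1 / 2)
  rw [mul_zero, mul_zero] at hz
  -- The mean logarithm enters with the factor `d / 2`, so accuracy `θ / d` contributes `θ / 2`; the
  -- other half is left for the trace term.
  have hθd : 0 < θ / d := by positivity
  have hθle : θ / d ≤ θ := div_le_self hθ.le hd1
  filter_upwards [κ.eventually_logMeanNear hd hR hY hρ hθd, hnat.eventually_gt_atTop ρ,
    hz.eventually_lt_const (half_pos hθ)] with n h1 h2 h3
  refine (measureReal_le_of_ae ?_).trans (h1.trans hθle)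
  filter_upwards [hY.ae_mem] with ω hω hbad hnear
  refine hbad ?_
  have h4 := κ.abs_alphaDiscrepancy_sub_le hκ hinj himm hd hR hρ hcont hK' h2 hω hnear
  have h5 : (d : ℝ) / 2 * (θ / d) = θ / 2 := by field_simp
  simp only [Function.comp] at h3
  rw [sub_sub, ← add_sub_assoc]
  linarith

end MetricKernel
end NeighbourEmbedding
end

/-! ### The two asymptotics combined. -/

open NeighbourEmbedding MeasureTheory ProbabilityTheory Filter in
theorem theorem6 (d : ℕ) (hd : 0 < d) (c : Euc d) (R : ℝ) (hR : 0 < R) (ρ : ℝ) (hρ : 1 < ρ) :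
    ∃ C : ℝ, ∀ (D : ℕ) (f : Euc d → Euc D) (V : Set (Euc d)),
      IsOpen V → Metric.closedBall c R ⊆ V → ContDiffOn ℝ (⊤ : ℕ∞) f V →
      Set.InjOn f (Metric.closedBall c R) →
      (∀ y ∈ Metric.closedBall c R, Function.Injective (fderiv ℝ f y)) →
      (∀ (M : Euc D → Matrix (Fin D) (Fin D) ℝ), ∀ y₀ ∈ Metric.closedBall c R,
        (M (f y₀)).PosDef →
        pointDiscrepancy 1 M f y₀ =
          1 / 2 * Real.log (pullback M f y₀).det + 1 / 2 * ((pullback M f y₀)⁻¹).trace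
            - (d : ℝ) / 2) ∧
      ∀ (Ω : Type*) [MeasurableSpace Ω] (P : Measure Ω) [IsProbabilityMeasure P]
        (Y : ℕ → Ω → Euc d),
        (∀ i, Measurable (Y i)) → iIndepFun Y P →
        (∀ i, P.map (Y i) = uniformBall c R) →
        TendstoInMeasure P
          (fun (n : ℕ) ω =>
            1 / (n : ℝ) * sneCost ρ (fun j : Fin n => f (Y j ω)) (fun j : Fin n => Y j ω)
              - alphaDiscrepancy 1 (uniformBall c R)
                  (calibratedMetric ρ fun j : Fin n => f (Y j ω)) f)
          atTop (fun _ => C) := by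
  -- The constant is the limit of the cost minus the limit of the discrepancy, each after
  -- subtraction of the common `log n`; neither limit involves `D` or `f`.
  refine ⟨(-Real.log ρ + ∫ y, Real.log (meanSimilarity c R y) ∂uniformBall c R) -
    ((d : ℝ) / 2 * logPrecisionLimit hd c hR hρ - (d : ℝ) / 2), ?_⟩
  intro D f V hV hK hf hinj himm
  refine ⟨fun M y₀ hy₀ hM => pointDiscrepancy_one_eq (himm y₀ hy₀) hM, ?_⟩
  intro Ω _ P _ Y hmeas hindep hlaw
  have hY : IsUniformSample c R P Y := ⟨hmeas, hindep, hlaw⟩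
  obtain ⟨κ, hκ⟩ := exists_embeddingKernel hd hV hK hf hinj himm
  rw [tendstoInMeasure_iff_measureReal_norm]
  intro ε hε
  rw [Metric.tendsto_atTop']
  intro η hη
  -- Two errors below `θ` add up to less than `ε`, and two exceptional events of probability at most
  -- `θ` to less than `η`.
  set θ := min (ε / 2) (η / 3) with hθdef
  have hθ : 0 < θ := lt_min (by positivity) (by positivity)
  have hθε : θ ≤ ε / 2 := min_le_left _ _
  have hθη : θ ≤ η / 3 := min_le_right _ _
  have h1 := κ.eventually_sneCost_near hd hR hY (fun y hy => conformalFactor_pos (himm y hy)) hκ hρ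
    hθ
  have h2 := κ.eventually_alphaDiscrepancy_near hd hR hY hV hK hf hinj himm hκ hρ hθ
  obtain ⟨N, hN⟩ := eventually_atTop.1 (h1.and h2)
  refine ⟨N, fun n hn => ?_⟩
  obtain ⟨e1, e2⟩ := hN n hn.le
  rw [Real.dist_0_eq_abs, abs_of_nonneg measureReal_nonneg]
  refine lt_of_le_of_lt ((measureReal_mono ?_ (measure_ne_top _ _)).trans
    ((measureReal_union_le _ _).trans (add_le_add e1 e2))) (by linarith)
  intro ω hω
  by_contra hcon
  simp only [Set.mem_union, not_or, Set.mem_ofPred_eq, not_not] at hcon hω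
  obtain ⟨c1, c2⟩ := hcon
  rw [abs_lt] at c1 c2
  rw [Real.norm_eq_abs] at hω
  refine absurd hω (not_le.2 ?_)
  rw [abs_lt]
  constructor <;> linarith [c1.1, c1.2, c2.1, c2.2]
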